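/- For $u:\mathbb C\to\mathbb C$ in some $L^s(\mathbb C)$, $1\le s<\infty$ (Lebesgue measure), the Beurling transform is $$Su(z)=-\frac1\pi\,\mathrm{p.v.}\!\int_{\mathbb C}\frac{u(y)}{(z-y)^2}\,dy=\lim_{\varepsilon\to0^+}\Big(-\frac1\pi\int_{|z-y|>\varepsilon}\frac{u(y)}{(z-y)^2}\,dy\Big),$$ the limit being taken in the sense of distributions. For $b\in L^1_{\mathrm{loc}}(\mathbb C)$ let $[b,S]v=b\,Sv-S(bv)$, $v\in C_c^\infty(\mathbb C)$. We say that $[b,S]:L^p(\mathbb C)\to L^q(\mathbb C)$ is bounded if there is $C<\infty$ such that, for every $v\in C_c^\infty(\mathbb C)$, $[b,S]v\in L^q(\mathbb C)$ and $\|[b,S]v\|_{L^q}\le C\|v\|_{L^p}$ (so that $[b,S]$ extends uniquely to a bounded operator $L^p\to L^q$); the least such $C$ is denoted by $\|[b,S]\|_{L^p\to L^q}$. **Theorem.** Let $1<q<p<\infty$ and $\frac1r=\frac1q-\frac1p$. There is a constant $K<\infty$, depending only on $p$ and $q$, such that the following holds for every complex-valued $b\in L^1_{\mathrm{loc}}(\mathbb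 C)$. 1. $[b,S]:L^p(\mathbb C)\to L^q(\mathbb C)$ is bounded if and only if $b=a+c$ almost everywhere for some $a\in L^r(\mathbb C)$ and some constant $c\in\mathbb C$. 2. In this case, for the (unique) constant $c\in\mathbb C$ with $b-c\in L^r(\mathbb C)$, $$\|b-c\|_{L^r(\mathbb C)}\le K\,\|[b,S]\|_{L^p\to L^q}.$$ -/

import Mathlib

open MeasureTheory Filter Topology
open scoped NNReal ENNReal

noncomputable section

/-- The class `C_c^∞(ℂ)` of (complex-valued, real-smooth) test functions. -/
def IsTestFunction (φ : ℂ → ℂ) : Prop :=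
  ContDiff ℝ (⊤ : ℕ∞) φ ∧ HasCompactSupport φ

/-- The truncated Beurling transform
`S_ε u (z) = -(1/π) ∫_{|z - y| > ε} u(y) / (z - y)² dy` (Lebesgue measure on `ℂ`). -/
def truncBeurling (ε : ℝ) (u : ℂ → ℂ) (z : ℂ) : ℂ :=
  -(1 / (Real.pi : ℂ)) * ∫ y in {y : ℂ | ε < ‖z - y‖}, u y / (z - y) ^ 2

/-- `S u = w`: the locally integrable function `w` is the Beurling transform of `u`, that is, the
principal value `lim_{ε → 0} S_ε u`, the limit being taken in the sense of distributions on `ℂ`.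
This makes sense for `u` in any `L^s`, `1 ≤ s < ∞`, and determines `w` almost everywhere. -/
def IsBeurlingTransform (u w : ℂ → ℂ) : Prop :=
  LocallyIntegrable w volume ∧
    ∀ φ : ℂ → ℂ, IsTestFunction φ →
      Tendsto (fun ε : ℝ => ∫ z, truncBeurling ε u z * φ z) (𝓝[>] 0) (𝓝 (∫ z, w z * φ z))

/-- `[b, S] v = h`, where `[b, S] v = b · S v - S (b · v)`. -/
def IsBeurlingCommutator (b v h : ℂ → ℂ) : Prop :=
  ∃ w₁ w₂ : ℂ → ℂ, IsBeurlingTransform v w₁ ∧ IsBeurlingTransform (fun y => b y * v y) w₂ ∧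
    h =ᵐ[volume] fun z => b z * w₁ z - w₂ z

/-- On the dense subspace `C_c^∞` of `L^p`, the commutator `[b, S]` takes values in `L^q` and
satisfies `‖[b, S] v‖_q ≤ C ‖v‖_p`; equivalently, `[b, S]` extends (uniquely) to a bounded linear
operator `L^p → L^q` of norm at most `C`. -/
def BeurlingCommutatorBound (b : ℂ → ℂ) (p q : ℝ≥0∞) (C : ℝ≥0) : Prop :=
  ∀ v : ℂ → ℂ, IsTestFunction v →
    ∃ h : ℂ → ℂ, IsBeurlingCommutator b v h ∧ MemLp h q volume ∧
      eLpNorm h q volume ≤ C * eLpNorm v p volume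

/-- `[b, S] : L^p(ℂ) → L^q(ℂ)` boundedly. -/
def BeurlingCommutatorBounded (b : ℂ → ℂ) (p q : ℝ≥0∞) : Prop :=
  ∃ C : ℝ≥0, BeurlingCommutatorBound b p q C

/-- The operator norm `‖[b, S]‖_{L^p → L^q}`, the least bound (`∞` if there is none). -/
def beurlingCommutatorNorm (b : ℂ → ℂ) (p q : ℝ≥0∞) : ℝ≥0∞ :=
  ⨅ (C : ℝ≥0) (_ : BeurlingCommutatorBound b p q C), (C : ℝ≥0∞)

end

/-!
# Commutators of the Beurling transform from `L^p` to `L^q`, `q < p`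

**Distributional transforms.** The kernel `h⁻²` changes sign under the rotation `h ↦ I * h`;
averaging over it turns the principal value for a test function `φ` into an absolutely convergent
integral `beurling φ`, which is the limit of the truncations and is `O((1 + ‖z‖)⁻²)`. As the
truncations are symmetric, `IsBeurlingTransform u w` just says that `∫ w φ = ∫ u (beurling φ)` for
all test functions `φ` (`isBeurlingTransform_iff`), and a bound for `[b, S]` bounds the bilinear
form `commForm`.

**Necessity.** Since `(z - y) ^ 2` cancels the kernel, expanding this polynomial around a point
expresses `∫ b ψ ∫ χ - ∫ b χ ∫ ψ` by three values of the commutator form (`commForm_moments`). A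
choice of signs makes this work for a whole family of pairs `(χ, ψ)` at once, with the `L^p` and
`L^q'` norms of sums of absolute values on the right-hand side (`enorm_sum_oscillation_le`). The
family comes from an atomic decomposition of the mean-zero part of a function `f` on a square,
obtained by stopping at levels that grow like `4 ^ j`: an atom of height `λ` is split as `λ ^ α`
times a function of size `λ ^ (1 - α)`, with `α` adapted to `p` and `q'`, and disjointness within a
level together with geometric growth between levels controls both norms by powers of `‖f‖_{r'}`.
By duality `b` minus its mean over a square is bounded in `L^r`, uniformly in the square; letting
the squares exhaust the plane gives the constant and the norm estimate
(`exists_const_eLpNorm_sub_le_mul`).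

**Sufficiency.** By Hölder's inequality, `v ↦ a S v` and `v ↦ S (a v)` map `L^p` to `L^q` when `a`
is in `L^r`, provided that `S` is bounded on `L^s` for `1 < s < ∞` (`exists_boundedOnTests`), and
constants commute with `S`. The bound on `L²` is the identity `‖∂F‖₂ = ‖∂̄F‖₂` for the convolution
`F` of a test function with a regularized Cauchy kernel. For `1 < s < 2` the Calderón–Zygmund
decomposition is used in a form that integrates directly to the strong bound
(`BoundedOnTests.exists_level_inequality`), and for `s > 2` duality.
-/

namespace Beurling

/-! ### The Beurling transform of a test function -/

lemma exists_support_radius {φ : ℂ → ℂ} (hφ : IsTestFunction φ) :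
    ∃ R : ℝ, 1 ≤ R ∧ ∀ z, R < ‖z‖ → φ z = 0 := by
  obtain ⟨R, hR⟩ := hφ.2.isCompact.isBounded.subset_closedBall (0 : ℂ)
  refine ⟨max 1 R, le_max_left _ _, fun z hz => ?_⟩
  by_contra h
  have := hR (subset_tsupport _ h)
  rw [mem_closedBall_zero_iff] at this
  exact absurd (lt_of_le_of_lt (le_max_right 1 R) hz) (not_lt.2 this)

lemma _root_.IsTestFunction.continuous {φ : ℂ → ℂ} (hφ : IsTestFunction φ) : Continuous φ :=
  hφ.1.continuous

lemma _root_.IsTestFunction.integrable {φ : ℂ → ℂ} (hφ : IsTestFunction φ) :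
    Integrable φ volume :=
  hφ.continuous.integrable_of_hasCompactSupport hφ.2

lemma _root_.IsTestFunction.memLp {φ : ℂ → ℂ} (hφ : IsTestFunction φ) (p : ℝ≥0∞) :
    MemLp φ p volume :=
  hφ.continuous.memLp_of_hasCompactSupport hφ.2

lemma _root_.IsTestFunction.add {φ ψ : ℂ → ℂ} (hφ : IsTestFunction φ) (hψ : IsTestFunction ψ) :
    IsTestFunction (fun z => φ z + ψ z) :=
  ⟨hφ.1.add hψ.1, hφ.2.add hψ.2⟩

lemma _root_.IsTestFunction.mul_left {φ g : ℂ → ℂ} (hφ : IsTestFunction φ)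
    (hg : ContDiff ℝ (⊤ : ℕ∞) g) : IsTestFunction (fun z => g z * φ z) :=
  ⟨hg.mul hφ.1, hφ.2.mul_left⟩

lemma _root_.IsTestFunction.const_mul {φ : ℂ → ℂ} (hφ : IsTestFunction φ) (c : ℂ) :
    IsTestFunction (fun z => c * φ z) :=
  hφ.mul_left contDiff_const

lemma isTestFunction_zero : IsTestFunction (fun _ => 0) :=
  ⟨contDiff_const, HasCompactSupport.zero⟩

lemma _root_.IsTestFunction.sum {ι : Type*} {s : Finset ι} {φ : ι → ℂ → ℂ}
    (hφ : ∀ i ∈ s, IsTestFunction (φ i)) : IsTestFunction (fun z => ∑ i ∈ s, φ i z) := by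
  classical
  induction s using Finset.induction_on with
  | empty => simpa using isTestFunction_zero
  | insert a s ha ih =>
    simp only [Finset.sum_insert ha]
    exact (hφ a (by simp)).add (ih fun i hi => hφ i (by simp [hi]))

/-- The Beurling transform of a test function. Since the kernel `h⁻²` changes sign under the
rotation `h ↦ I * h`, averaging over this rotation turns the principal value into an absolutely
convergent integral. -/
noncomputable def beurling (φ : ℂ → ℂ) (z : ℂ) : ℂ :=
  -(1 / (2 * (Real.pi : ℂ))) * ∫ h, (φ (z - h) - φ (z - Complex.I * h)) / h ^ 2

lemma measurePreserving_I_mul :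
    MeasurePreserving (fun h : ℂ => Complex.I * h) volume volume := by
  let e : ℂ ≃ₗᵢ[ℝ] ℂ := rotation ⟨Complex.I, by simp [Submonoid.unitSphere]⟩
  exact e.measurePreserving

lemma measurableEmbedding_I_mul : MeasurableEmbedding (fun h : ℂ => Complex.I * h) :=
  measurableEmbedding_mulLeft₀ Complex.I_ne_zero

lemma integral_comp_I_mul (F : ℂ → ℂ) : ∫ h, F (Complex.I * h) = ∫ h, F h :=
  measurePreserving_I_mul.integral_comp measurableEmbedding_I_mul F

lemma truncBeurling_eq_integral_shift (ε : ℝ) (u : ℂ → ℂ) (z : ℂ) :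
    truncBeurling ε u z =
      -(1 / (Real.pi : ℂ)) * ∫ h in {h : ℂ | ε < ‖h‖}, u (z - h) / h ^ 2 := by
  have hm : MeasurableSet {h : ℂ | ε < ‖h‖} := measurableSet_lt measurable_const measurable_norm
  have hm' : MeasurableSet {y : ℂ | ε < ‖z - y‖} :=
    measurableSet_lt measurable_const (by fun_prop)
  rw [truncBeurling, ← integral_indicator hm, ← integral_indicator hm',
    ← integral_sub_left_eq_self _ volume z]
  congr 2
  ext y
  simp only [Set.indicator, Set.mem_ofPred_eq, sub_sub_cancel]

lemma integrableOn_trunc_kernel {ε : ℝ} (hε : 0 < ε) {φ : ℂ → ℂ} (hφ : Integrable φ volume)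
    (z : ℂ) : IntegrableOn (fun h => φ (z - h) / h ^ 2) {h : ℂ | ε < ‖h‖} volume := by
  have hm : MeasurableSet {h : ℂ | ε < ‖h‖} := measurableSet_lt measurable_const measurable_norm
  have h1 : Integrable (fun h => φ (z - h)) volume := hφ.comp_sub_left z
  refine Integrable.mono' (g := fun h => ‖φ (z - h)‖ * (ε ^ 2)⁻¹)
    (h1.norm.mul_const _).integrableOn ?_ ?_
  · refine (h1.aestronglyMeasurable.restrict).div₀ ?_
    exact (by fun_prop : Continuous fun h : ℂ => h ^ 2).aestronglyMeasurable
  · refine (ae_restrict_iff' hm).2 (Eventually.of_forall fun h hh => ?_)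
    rw [norm_div, norm_pow, div_eq_mul_inv]
    gcongr
    exact le_of_lt hh

lemma truncBeurling_eq_symm {ε : ℝ} (hε : 0 < ε) {φ : ℂ → ℂ} (hφ : Integrable φ volume) (z : ℂ) :
    truncBeurling ε φ z = -(1 / (2 * (Real.pi : ℂ))) *
      ∫ h in {h : ℂ | ε < ‖h‖}, (φ (z - h) - φ (z - Complex.I * h)) / h ^ 2 := by
  have hm : MeasurableSet {h : ℂ | ε < ‖h‖} := measurableSet_lt measurable_const measurable_norm
  set F : ℂ → ℂ := {h : ℂ | ε < ‖h‖}.indicator fun h => φ (z - h) / h ^ 2 with hF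
  have hFi : Integrable F volume := (integrableOn_trunc_kernel hε hφ z).integrable_indicator hm
  have hFI : Integrable (fun h => F (Complex.I * h)) volume :=
    (measurePreserving_I_mul.integrable_comp_emb measurableEmbedding_I_mul).2 hFi
  have key : ∫ h in {h : ℂ | ε < ‖h‖}, (φ (z - h) - φ (z - Complex.I * h)) / h ^ 2
      = 2 * ∫ h, F h := by
    rw [two_mul]
    nth_rewrite 2 [← integral_comp_I_mul F]
    rw [← integral_add hFi hFI, ← integral_indicator hm]
    congr 1
    ext h
    simp only [hF, Set.indicator, Set.mem_ofPred_eq, norm_mul, Complex.norm_I, one_mul, mul_pow,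
      Complex.I_sq]
    split_ifs
    · rw [sub_div, sub_eq_add_neg, neg_mul, one_mul, div_neg]
    · simp
  rw [truncBeurling_eq_integral_shift, key, hF, integral_indicator hm]
  have : (Real.pi : ℂ) ≠ 0 := by exact_mod_cast Real.pi_ne_zero
  field_simp

lemma integrableOn_inv_norm (R : ℝ) :
    IntegrableOn (fun h : ℂ => ‖h‖⁻¹) (Metric.closedBall 0 R) volume := by
  have : IntegrableOn (fun h : ℂ => ‖h‖⁻¹) (Metric.ball 0 (R + 1)) volume := by
    refine integrableOn_ball_of_norm_le_rpow (C := 1) (α := 1) ?_ ?_ ?_ ?_ <;>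
      try simp [Complex.finrank_real_complex]
    · exact ae_of_all _ fun x => by rw [Real.rpow_neg_one]
    · exact (measurable_norm.inv).aestronglyMeasurable
  exact this.mono_set (Metric.closedBall_subset_ball (by linarith))

/-- Size of the symmetrized kernel: it is `O(1 / ‖h‖)` and vanishes for large `h`. -/
lemma exists_symm_kernel_bound {φ : ℂ → ℂ} (hφ : IsTestFunction φ) :
    ∃ A R : ℝ, 0 ≤ A ∧ 1 ≤ R ∧ (∀ z, R < ‖z‖ → φ z = 0) ∧
      ∀ z h, ‖(φ (z - h) - φ (z - Complex.I * h)) / h ^ 2‖ ≤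
        (Metric.closedBall (0 : ℂ) (‖z‖ + R)).indicator (fun h => A * ‖h‖⁻¹) h := by
  obtain ⟨R, hR1, hR⟩ := exists_support_radius hφ
  obtain ⟨L, hL⟩ := ContDiff.lipschitzWith_of_hasCompactSupport hφ.2 hφ.1 (by simp)
  refine ⟨L * 2, R, by positivity, hR1, hR, fun z h => ?_⟩
  by_cases hh : h ∈ Metric.closedBall (0 : ℂ) (‖z‖ + R)
  · rw [Set.indicator_of_mem hh]
    rcases eq_or_ne h 0 with rfl | h0
    · simp
    have h1 := hL.norm_sub_le (z - h) (z - Complex.I * h)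
    have h2 : ‖z - h - (z - Complex.I * h)‖ ≤ 2 * ‖h‖ := by
      have : z - h - (z - Complex.I * h) = Complex.I * h - h := by ring
      rw [this]
      refine (norm_sub_le _ _).trans ?_
      rw [norm_mul, Complex.norm_I]; linarith
    have hpos : 0 < ‖h‖ := norm_pos_iff.2 h0
    rw [norm_div, norm_pow, div_le_iff₀ (by positivity)]
    calc _ ≤ L * (2 * ‖h‖) := h1.trans (by gcongr)
      _ = _ := by field_simp
  · rw [Set.indicator_of_notMem hh]
    rw [mem_closedBall_zero_iff, not_le] at hh
    have e1 : φ (z - h) = 0 := hR _ (by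
      have := norm_sub_norm_le h z; rw [norm_sub_rev] at this; linarith)
    have e2 : φ (z - Complex.I * h) = 0 := hR _ (by
      have := norm_sub_norm_le (Complex.I * h) z
      rw [norm_sub_rev, norm_mul, Complex.norm_I, one_mul] at this; linarith)
    simp [e1, e2]

lemma integrable_symm_kernel {φ : ℂ → ℂ} (hφ : IsTestFunction φ) (z : ℂ) :
    Integrable (fun h => (φ (z - h) - φ (z - Complex.I * h)) / h ^ 2) volume := by
  obtain ⟨A, R, hA, hR1, hR, hb⟩ := exists_symm_kernel_bound hφ
  have hφc := hφ.continuous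
  refine Integrable.mono' (IntegrableOn.integrable_indicator ((integrableOn_inv_norm (‖z‖ + R)).const_mul A)
    Metric.isClosed_closedBall.measurableSet) ?_ (ae_of_all _ (hb z))
  exact ((by fun_prop : Continuous fun h => φ (z - h) - φ (z - Complex.I * h)).measurable.div
    (by fun_prop)).aestronglyMeasurable

lemma tendsto_truncBeurling {φ : ℂ → ℂ} (hφ : IsTestFunction φ) (z : ℂ) :
    Tendsto (fun ε => truncBeurling ε φ z) (𝓝[>] 0) (𝓝 (beurling φ z)) := by
  set G : ℂ → ℂ := fun h => (φ (z - h) - φ (z - Complex.I * h)) / h ^ 2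
  have hG : Integrable G volume := integrable_symm_kernel hφ z
  have hm : ∀ ε : ℝ, MeasurableSet {h : ℂ | ε < ‖h‖} := fun ε =>
    measurableSet_lt measurable_const measurable_norm
  have h1 : Tendsto (fun ε : ℝ => ∫ h, {h : ℂ | ε < ‖h‖}.indicator G h) (𝓝[>] 0)
      (𝓝 (∫ h, G h)) := by
    refine tendsto_integral_filter_of_dominated_convergence (fun h => ‖G h‖)
      (Eventually.of_forall fun ε => hG.aestronglyMeasurable.indicator (hm ε))
      (Eventually.of_forall fun ε => ae_of_all _ fun h => norm_indicator_le_norm_self _ _)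
      hG.norm (ae_of_all _ fun h => ?_)
    rcases eq_or_ne h 0 with rfl | h0
    · have : G 0 = 0 := by simp [G]
      refine tendsto_const_nhds.congr fun ε => ?_
      simp [Set.indicator, this]
    · refine tendsto_const_nhds.congr' ?_
      filter_upwards [nhdsWithin_le_nhds (Iio_mem_nhds (norm_pos_iff.2 h0))] with ε hε
      rw [Set.indicator_of_mem]; exact hε
  refine (h1.const_mul (-(1 / (2 * (Real.pi : ℂ))))).congr' ?_
  filter_upwards [self_mem_nhdsWithin] with ε hε
  rw [truncBeurling_eq_symm hε hφ.integrable, integral_indicator (hm ε)]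

/-- The truncated transforms of a test function are `O((1 + ‖z‖)⁻²)`, uniformly in the
truncation. -/
lemma exists_truncBeurling_bound {φ : ℂ → ℂ} (hφ : IsTestFunction φ) :
    ∃ C : ℝ, 0 ≤ C ∧ ∀ ε > 0, ∀ z, ‖truncBeurling ε φ z‖ ≤ C * ((1 + ‖z‖) ^ 2)⁻¹ := by
  obtain ⟨A, R, hA, hR1, hR, hb⟩ := exists_symm_kernel_bound hφ
  set N := ∫ h in Metric.closedBall (0 : ℂ) (3 * R), A * ‖h‖⁻¹ with hN
  have hN0 : 0 ≤ N := integral_nonneg fun h => by positivity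
  set J := ∫ y, ‖φ y‖ with hJ
  have hJ0 : 0 ≤ J := integral_nonneg fun h => by positivity
  have hpi := Real.pi_pos
  have hpi3 := Real.pi_gt_three
  have hm : ∀ ε : ℝ, MeasurableSet {h : ℂ | ε < ‖h‖} := fun ε =>
    measurableSet_lt measurable_const measurable_norm
  refine ⟨N * (1 + 2 * R) ^ 2 + J * 16, by positivity, fun ε hε z => ?_⟩
  rw [← div_eq_mul_inv, le_div_iff₀ (by positivity)]
  rcases le_or_gt ‖z‖ (2 * R) with hz | hz
  · have h1 : ‖truncBeurling ε φ z‖ ≤ N := by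
      rw [truncBeurling_eq_symm hε hφ.integrable, norm_mul]
      have e : ‖-(1 / (2 * (Real.pi : ℂ)))‖ ≤ 1 := by
        rw [norm_neg, norm_div, norm_mul, norm_one, Complex.norm_real, Real.norm_of_nonneg hpi.le,
          Complex.norm_ofNat, div_le_one (by positivity)]
        linarith
      have hI : Integrable ((Metric.closedBall (0 : ℂ) (3 * R)).indicator
          fun h => A * ‖h‖⁻¹) volume :=
        IntegrableOn.integrable_indicator ((integrableOn_inv_norm (3 * R)).const_mul A)
          Metric.isClosed_closedBall.measurableSet
      calc _ ≤ 1 * ‖∫ h in {h : ℂ | ε < ‖h‖},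
              (φ (z - h) - φ (z - Complex.I * h)) / h ^ 2‖ := by gcongr
        _ = ‖∫ h, {h : ℂ | ε < ‖h‖}.indicator
              (fun h => (φ (z - h) - φ (z - Complex.I * h)) / h ^ 2) h‖ := by
            rw [one_mul, integral_indicator (hm ε)]
        _ ≤ ∫ h, (Metric.closedBall (0 : ℂ) (3 * R)).indicator (fun h => A * ‖h‖⁻¹) h := by
            refine norm_integral_le_of_norm_le hI (ae_of_all _ fun h => ?_)
            refine (norm_indicator_le_norm_self _ _).trans ((hb z h).trans ?_)
            refine Set.indicator_le_indicator_of_subset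
              (Metric.closedBall_subset_closedBall (by linarith)) (fun h => by positivity) h
        _ = N := by rw [integral_indicator Metric.isClosed_closedBall.measurableSet]
    calc _ ≤ N * (1 + 2 * R) ^ 2 := by gcongr
      _ ≤ _ := by linarith
  · have hz0 : 0 < ‖z‖ := by linarith
    have hm' : MeasurableSet {y : ℂ | ε < ‖z - y‖} :=
      measurableSet_lt measurable_const (by fun_prop)
    have h1 : ‖truncBeurling ε φ z‖ ≤ J * (4 / ‖z‖ ^ 2) := by
      rw [truncBeurling, norm_mul, hJ, ← integral_mul_const, ← integral_indicator hm']
      have e : ‖-(1 / (Real.pi : ℂ))‖ ≤ 1 := by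
        rw [norm_neg, norm_div, norm_one, Complex.norm_real, Real.norm_of_nonneg hpi.le,
          div_le_one (by positivity)]
        linarith
      rw [← one_mul (∫ y, ‖φ y‖ * (4 / ‖z‖ ^ 2))]
      refine mul_le_mul e (norm_integral_le_of_norm_le (hφ.integrable.norm.mul_const _)
        (ae_of_all _ fun y => ?_)) (norm_nonneg _) zero_le_one
      refine (norm_indicator_le_norm_self _ _).trans ?_
      rcases lt_or_ge R ‖y‖ with hy | hy
      · simp [hR y hy]
      · have h2 : ‖z‖ / 2 ≤ ‖z - y‖ := by
          have := norm_sub_norm_le z y; linarith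
        rw [norm_div, norm_pow, div_eq_mul_inv]
        gcongr
        have h3 : 0 < ‖z - y‖ := by linarith
        rw [inv_le_comm₀ (by positivity) (by positivity), inv_div]
        calc ‖z‖ ^ 2 / 4 = (‖z‖ / 2) ^ 2 := by ring
          _ ≤ _ := by gcongr
    calc _ ≤ J * (4 / ‖z‖ ^ 2) * (2 * ‖z‖) ^ 2 := by gcongr; linarith
      _ = J * 16 := by field_simp; ring
      _ ≤ _ := by have : 0 ≤ N * (1 + 2 * R) ^ 2 := by positivity
                  linarith

lemma exists_beurling_bound {φ : ℂ → ℂ} (hφ : IsTestFunction φ) :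
    ∃ C : ℝ, 0 ≤ C ∧ ∀ z, ‖beurling φ z‖ ≤ C * ((1 + ‖z‖) ^ 2)⁻¹ := by
  obtain ⟨C, hC, h⟩ := exists_truncBeurling_bound hφ
  refine ⟨C, hC, fun z => le_of_tendsto (tendsto_truncBeurling hφ z).norm ?_⟩
  filter_upwards [self_mem_nhdsWithin] with ε hε using h ε hε z

lemma stronglyMeasurable_beurling {φ : ℂ → ℂ} (hφ : IsTestFunction φ) :
    StronglyMeasurable (beurling φ) := by
  have hφc := hφ.continuous
  have : Measurable (Function.uncurry fun z h : ℂ =>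
      (φ (z - h) - φ (z - Complex.I * h)) / h ^ 2) := by
    have h1 : Continuous fun x : ℂ × ℂ => φ (x.1 - x.2) - φ (x.1 - Complex.I * x.2) := by fun_prop
    have h2 : Measurable fun x : ℂ × ℂ => x.2 ^ 2 := by fun_prop
    exact h1.measurable.div h2
  exact (this.stronglyMeasurable.integral_prod_right).const_mul _

lemma measurable_truncBeurling {ε : ℝ} {φ : ℂ → ℂ} (hφ : Measurable φ) :
    StronglyMeasurable (truncBeurling ε φ) := by
  have h0 : MeasurableSet {x : ℂ × ℂ | ε < ‖x.1 - x.2‖} :=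
    measurableSet_lt measurable_const (by fun_prop)
  have : Measurable (({x : ℂ × ℂ | ε < ‖x.1 - x.2‖}).indicator
      fun x : ℂ × ℂ => φ x.2 / (x.1 - x.2) ^ 2) :=
    ((hφ.comp measurable_snd).div (by fun_prop)).indicator h0
  have h2 := (this.stronglyMeasurable.integral_prod_right' (ν := volume)).const_mul
    (-(1 / (Real.pi : ℂ)))
  convert h2 using 1
  ext z
  have hm' : MeasurableSet {y : ℂ | ε < ‖z - y‖} :=
    measurableSet_lt measurable_const (by fun_prop)
  rw [truncBeurling, ← integral_indicator hm']
  rfl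

lemma integrable_decay_rpow {t : ℝ} (ht : 1 < t) :
    Integrable (fun z : ℂ => (((1 + ‖z‖) ^ 2)⁻¹ : ℝ) ^ t) volume := by
  have h := integrable_one_add_norm (E := ℂ) (μ := volume) (r := 2 * t)
    (by rw [Complex.finrank_real_complex]; push_cast; linarith)
  refine h.congr (ae_of_all _ fun z => ?_)
  have : (0 : ℝ) < 1 + ‖z‖ := by positivity
  simp only
  rw [← Real.rpow_natCast, ← Real.rpow_neg this.le, ← Real.rpow_mul this.le]
  congr 1; push_cast; ring

lemma memLp_decay {t : ℝ≥0∞} (ht : 1 < t) :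
    MemLp (fun z : ℂ => (((1 + ‖z‖) ^ 2)⁻¹ : ℝ)) t volume := by
  have hc : Continuous fun z : ℂ => (((1 + ‖z‖) ^ 2)⁻¹ : ℝ) :=
    Continuous.inv₀ (by fun_prop) (fun z => by positivity)
  rcases eq_or_ne t ∞ with rfl | h
  · refine memLp_top_of_bound hc.aestronglyMeasurable 1 (ae_of_all _ fun z => ?_)
    rw [Real.norm_of_nonneg (by positivity)]
    apply inv_le_one_of_one_le₀
    nlinarith [norm_nonneg z]
  · have ht0 : t ≠ 0 := (zero_lt_one.trans ht).ne'
    rw [← integrable_norm_rpow_iff hc.aestronglyMeasurable ht0 h]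
    refine (integrable_decay_rpow (t := t.toReal) ?_).congr (ae_of_all _ fun z => ?_)
    · rwa [← ENNReal.toReal_one, ENNReal.toReal_lt_toReal (by simp) h]
    · simp only
      rw [Real.norm_of_nonneg (by positivity)]

lemma memLp_beurling {φ : ℂ → ℂ} (hφ : IsTestFunction φ) {t : ℝ≥0∞} (ht : 1 < t) :
    MemLp (beurling φ) t volume := by
  obtain ⟨C, hC, h⟩ := exists_beurling_bound hφ
  refine (memLp_decay ht).of_le_mul (c := C) (stronglyMeasurable_beurling hφ).aestronglyMeasurable
    (ae_of_all _ fun z => ?_)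
  rw [Real.norm_of_nonneg (by positivity)]
  exact h z

/-! ### The distributional Beurling transform as a transpose -/

/-- The functions that can be paired with a bounded function of size `O((1 + ‖z‖)⁻²)`, in
particular with the Beurling transform of a test function. All `L^s`, `1 ≤ s < ∞`, qualify. -/
def TailIntegrable (u : ℂ → ℂ) : Prop :=
  AEStronglyMeasurable u volume ∧ Integrable (fun y => ‖u y‖ * ((1 + ‖y‖) ^ 2)⁻¹) volume

lemma exists_holderConjugate {s : ℝ≥0∞} (hs : 1 ≤ s) : ∃ t : ℝ≥0∞, s.HolderConjugate t := by
  refine ⟨(1 - s⁻¹)⁻¹, ENNReal.holderConjugate_iff.2 ?_⟩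
  rw [inv_inv, add_tsub_cancel_of_le (ENNReal.inv_le_one.2 hs)]

lemma _root_.MeasureTheory.MemLp.tailIntegrable {s : ℝ≥0∞} (hs : 1 ≤ s) (hs' : s ≠ ∞) {u : ℂ → ℂ}
    (hu : MemLp u s volume) : TailIntegrable u := by
  obtain ⟨t, ht⟩ := exists_holderConjugate hs
  have h1 : 1 < t := (ENNReal.HolderConjugate.lt_top_iff_one_lt s t).1 hs'.lt_top
  exact ⟨hu.1, hu.norm.integrable_mul (memLp_decay h1)⟩

lemma TailIntegrable.integrable_mul {u : ℂ → ℂ} (hu : TailIntegrable u) {g : ℂ → ℂ}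
    (hg : AEStronglyMeasurable g volume) {C : ℝ}
    (hC : ∀ z, ‖g z‖ ≤ C * ((1 + ‖z‖) ^ 2)⁻¹) : Integrable (fun z => u z * g z) volume := by
  refine Integrable.mono' (hu.2.const_mul C) (hu.1.mul hg) (ae_of_all _ fun z => ?_)
  rw [norm_mul]
  calc _ ≤ ‖u z‖ * (C * ((1 + ‖z‖) ^ 2)⁻¹) := by gcongr; exact hC z
    _ = _ := by ring

lemma TailIntegrable.integrable_mul_beurling {u : ℂ → ℂ} (hu : TailIntegrable u) {φ : ℂ → ℂ}
    (hφ : IsTestFunction φ) : Integrable (fun z => u z * beurling φ z) volume := by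
  obtain ⟨C, -, hC⟩ := exists_beurling_bound hφ
  exact hu.integrable_mul (stronglyMeasurable_beurling hφ).aestronglyMeasurable hC

/-- The truncated transforms are symmetric, because their kernel is even. -/
lemma integral_truncBeurling_mul {u : ℂ → ℂ} (hu : TailIntegrable u) {φ : ℂ → ℂ}
    (hφ : IsTestFunction φ) {ε : ℝ} (hε : 0 < ε) :
    ∫ z, truncBeurling ε u z * φ z = ∫ y, u y * truncBeurling ε φ y := by
  obtain ⟨R, hR1, hR⟩ := exists_support_radius hφ
  set H : ℂ → ℂ → ℂ := fun z y =>
    {x : ℂ × ℂ | ε < ‖x.1 - x.2‖}.indicator (fun x => u x.2 * φ x.1 / (x.1 - x.2) ^ 2) (z, y)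
  set K : ℝ := (1 + R) / ε + 1 with hK
  have hKpos : 0 < K := by positivity
  have hH : Integrable (Function.uncurry H) (volume.prod volume) := by
    refine Integrable.mono' ((hφ.integrable.norm.mul_prod hu.2).const_mul (K ^ 2)) ?_
      (ae_of_all _ ?_)
    · have h0 : MeasurableSet {x : ℂ × ℂ | ε < ‖x.1 - x.2‖} :=
        measurableSet_lt measurable_const (by fun_prop)
      have h1 : AEStronglyMeasurable (fun x : ℂ × ℂ => u x.2 * φ x.1 / (x.1 - x.2) ^ 2)
          (volume.prod volume) := by
        refine (hu.1.comp_snd.mul (hφ.continuous.aestronglyMeasurable.comp_fst)).div₀ ?_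
        exact (by fun_prop : Continuous fun x : ℂ × ℂ => (x.1 - x.2) ^ 2).aestronglyMeasurable
      exact h1.indicator h0
    · rintro ⟨z, y⟩
      simp only [Function.uncurry, H, Set.indicator, Set.mem_ofPred_eq]
      split_ifs with h
      · rcases lt_or_ge R ‖z‖ with hz | hz
        · simp [hR z hz]
        · have hpos : 0 < ‖z - y‖ := hε.trans h
          have h2 : 1 + ‖y‖ ≤ K * ‖z - y‖ := by
            have h3 : ‖y‖ ≤ ‖z‖ + ‖z - y‖ := by
              have := norm_sub_norm_le y z; rw [norm_sub_rev] at this; linarith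
            have h4 : 1 + R ≤ (1 + R) / ε * ‖z - y‖ := by
              rw [div_mul_eq_mul_div, le_div_iff₀ hε]; gcongr
            rw [hK, add_mul, one_mul]; linarith
          rw [norm_div, norm_mul, norm_pow, div_le_iff₀ (by positivity)]
          have h5 : 1 ≤ K ^ 2 * ((1 + ‖y‖) ^ 2)⁻¹ * ‖z - y‖ ^ 2 := by
            rw [mul_right_comm, ← mul_pow, ← div_eq_mul_inv, one_le_div (by positivity)]
            gcongr
          calc ‖u y‖ * ‖φ z‖ ≤ ‖u y‖ * ‖φ z‖ * (K ^ 2 * ((1 + ‖y‖) ^ 2)⁻¹ * ‖z - y‖ ^ 2) :=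
                le_mul_of_one_le_right (by positivity) h5
            _ = _ := by ring
      · rw [norm_zero]; positivity
  have hm : ∀ z : ℂ, MeasurableSet {y : ℂ | ε < ‖z - y‖} := fun z =>
    measurableSet_lt measurable_const (by fun_prop)
  have hs := integral_integral_swap (μ := volume) (ν := volume) hH
  have e1 : ∀ z, truncBeurling ε u z * φ z = -(1 / (Real.pi : ℂ)) * ∫ y, H z y := by
    intro z
    rw [truncBeurling, mul_assoc, ← integral_mul_const, ← integral_indicator (hm z)]
    congr 2
    ext y
    simp only [H, Set.indicator, Set.mem_ofPred_eq]
    split_ifs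
    · ring
    · rfl
  have e2 : ∀ y, u y * truncBeurling ε φ y = -(1 / (Real.pi : ℂ)) * ∫ z, H z y := by
    intro y
    rw [truncBeurling, mul_left_comm, ← integral_const_mul, ← integral_indicator (hm y)]
    congr 2
    ext z
    simp only [H, Set.indicator, Set.mem_ofPred_eq]
    rw [norm_sub_rev]
    split_ifs
    · rw [← neg_sub y z, neg_sq]; ring
    · rfl
  simp only [e1, e2, integral_const_mul, hs]

/-- `w` is the transpose Beurling transform of `u`: it is locally integrable, and pairing it with
a test function amounts to pairing `u` with the Beurling transform of that function. -/
def IsTransposeBeurling (u w : ℂ → ℂ) : Prop :=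
  LocallyIntegrable w volume ∧
    ∀ φ : ℂ → ℂ, IsTestFunction φ → ∫ z, w z * φ z = ∫ z, u z * beurling φ z

lemma tendsto_integral_mul_truncBeurling {u : ℂ → ℂ} (hu : TailIntegrable u) {φ : ℂ → ℂ}
    (hφ : IsTestFunction φ) :
    Tendsto (fun ε => ∫ y, u y * truncBeurling ε φ y) (𝓝[>] 0)
      (𝓝 (∫ y, u y * beurling φ y)) := by
  obtain ⟨C, hC0, hC⟩ := exists_truncBeurling_bound hφ
  refine tendsto_integral_filter_of_dominated_convergence
    (fun y => C * (‖u y‖ * ((1 + ‖y‖) ^ 2)⁻¹)) ?_ ?_ (hu.2.const_mul C) ?_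
  · exact Eventually.of_forall fun ε =>
      hu.1.mul (measurable_truncBeurling hφ.continuous.measurable).aestronglyMeasurable
  · filter_upwards [self_mem_nhdsWithin] with ε hε
    refine ae_of_all _ fun y => ?_
    rw [norm_mul]
    calc _ ≤ ‖u y‖ * (C * ((1 + ‖y‖) ^ 2)⁻¹) := by gcongr; exact hC ε hε y
      _ = _ := by ring
  · exact ae_of_all _ fun y => (tendsto_truncBeurling hφ y).const_mul _

lemma isBeurlingTransform_iff {u w : ℂ → ℂ} (hu : TailIntegrable u) :
    IsBeurlingTransform u w ↔ IsTransposeBeurling u w := by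
  refine and_congr_right fun _ => forall₂_congr fun φ hφ => ?_
  have h := tendsto_integral_mul_truncBeurling hu hφ
  have h' : Tendsto (fun ε => ∫ z, truncBeurling ε u z * φ z) (𝓝[>] 0)
      (𝓝 (∫ y, u y * beurling φ y)) := by
    refine h.congr' ?_
    filter_upwards [self_mem_nhdsWithin] with ε hε
    exact (integral_truncBeurling_mul hu hφ hε).symm
  exact ⟨fun h2 => tendsto_nhds_unique h2 h', fun h2 => h2 ▸ h'⟩

lemma locallyIntegrable_beurling {φ : ℂ → ℂ} (hφ : IsTestFunction φ) :
    LocallyIntegrable (beurling φ) volume :=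
  (memLp_beurling hφ (t := 2) (by norm_num)).locallyIntegrable (by norm_num)

lemma integrable_mul_test {w φ : ℂ → ℂ} (hw : LocallyIntegrable w volume)
    (hφ : IsTestFunction φ) : Integrable (fun z => w z * φ z) volume :=
  (hw.integrable_smul_left_of_hasCompactSupport hφ.continuous hφ.2).congr
    (ae_of_all _ fun z => by simp [mul_comm])

lemma isTransposeBeurling_beurling {v : ℂ → ℂ} (hv : IsTestFunction v) :
    IsTransposeBeurling v (beurling v) := by
  refine ⟨locallyIntegrable_beurling hv, fun φ hφ => ?_⟩
  have hvt : TailIntegrable v := (hv.memLp 1).tailIntegrable le_rfl (by simp)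
  have hφt : TailIntegrable φ := (hφ.memLp 1).tailIntegrable le_rfl (by simp)
  have h1 := tendsto_integral_mul_truncBeurling hvt hφ
  have h2 := tendsto_integral_mul_truncBeurling hφt hv
  have h3 : ∫ y, φ y * beurling v y = ∫ y, v y * beurling φ y := by
    refine tendsto_nhds_unique h2 (h1.congr' ?_)
    filter_upwards [self_mem_nhdsWithin] with ε hε
    rw [← integral_truncBeurling_mul hvt hφ hε]
    simp only [mul_comm]
  rw [← h3]
  simp only [mul_comm]

lemma isTestFunction_ofReal {g : ℂ → ℝ} (hg : ContDiff ℝ (⊤ : ℕ∞) g) (hgc : HasCompactSupport g) :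
    IsTestFunction (fun z => (g z : ℂ)) :=
  ⟨Complex.ofRealCLM.contDiff.comp hg, hgc.comp_left (g := fun x : ℝ => (x : ℂ)) (by simp)⟩

lemma ae_eq_of_forall_integral_mul_test {w w' : ℂ → ℂ} (hw : LocallyIntegrable w volume)
    (hw' : LocallyIntegrable w' volume)
    (h : ∀ φ, IsTestFunction φ → ∫ z, w z * φ z = ∫ z, w' z * φ z) : w =ᵐ[volume] w' := by
  refine ae_eq_of_integral_contDiff_smul_eq hw hw' fun g hg hgc => ?_
  have := h _ (isTestFunction_ofReal hg hgc)
  simpa [mul_comm] using this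

lemma IsTransposeBeurling.ae_eq {u w w' : ℂ → ℂ} (h : IsTransposeBeurling u w)
    (h' : IsTransposeBeurling u w') : w =ᵐ[volume] w' :=
  ae_eq_of_forall_integral_mul_test h.1 h'.1 fun φ hφ => by rw [h.2 φ hφ, h'.2 φ hφ]

lemma IsTransposeBeurling.add {u w u' w' : ℂ → ℂ} (hu : TailIntegrable u) (hu' : TailIntegrable u')
    (h : IsTransposeBeurling u w) (h' : IsTransposeBeurling u' w') :
    IsTransposeBeurling (fun z => u z + u' z) (fun z => w z + w' z) := by
  refine ⟨h.1.add h'.1, fun φ hφ => ?_⟩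
  simp only [add_mul]
  rw [integral_add (integrable_mul_test h.1 hφ) (integrable_mul_test h'.1 hφ), h.2 φ hφ,
    h'.2 φ hφ, integral_add (hu.integrable_mul_beurling hφ) (hu'.integrable_mul_beurling hφ)]

lemma IsTransposeBeurling.const_mul {u w : ℂ → ℂ} (h : IsTransposeBeurling u w) (c : ℂ) :
    IsTransposeBeurling (fun z => c * u z) (fun z => c * w z) := by
  refine ⟨h.1.smul c, fun φ hφ => ?_⟩
  simp only [mul_assoc, integral_const_mul, h.2 φ hφ]

lemma TailIntegrable.add {u v : ℂ → ℂ} (hu : TailIntegrable u) (hv : TailIntegrable v) :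
    TailIntegrable (fun z => u z + v z) := by
  refine ⟨hu.1.add hv.1, Integrable.mono' (hu.2.add hv.2) ?_ (ae_of_all _ fun z => ?_)⟩
  · refine (hu.1.add hv.1).norm.mul ?_
    exact (Continuous.inv₀ (by fun_prop) (fun z => by positivity)).aestronglyMeasurable
  · rw [Real.norm_of_nonneg (by positivity), Pi.add_apply, ← add_mul]
    gcongr
    exact norm_add_le _ _

lemma integral_sub_add {μ : Measure ℂ} {f g h : ℂ → ℂ} (hf : Integrable f μ) (hg : Integrable g μ)
    (hh : Integrable h μ) :
    (∫ x, f x ∂μ) - (∫ x, g x ∂μ) + ∫ x, h x ∂μ = ∫ x, (f x - g x + h x) ∂μ := by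
  rw [← integral_sub hf hg]
  exact (integral_add (hf.sub hg) hh).symm

/-! ### The commutator form -/

lemma tendsto_setIntegral_trunc {χ : ℂ → ℂ} (hχ : Integrable χ volume) (z : ℂ) :
    Tendsto (fun ε : ℝ => ∫ y in {y : ℂ | ε < ‖z - y‖}, χ y) (𝓝[>] 0) (𝓝 (∫ y, χ y)) := by
  have hm : ∀ ε : ℝ, MeasurableSet {y : ℂ | ε < ‖z - y‖} := fun ε =>
    measurableSet_lt measurable_const (by fun_prop)
  simp only [← integral_indicator (hm _)]
  refine tendsto_integral_filter_of_dominated_convergence (fun y => ‖χ y‖)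
    (Eventually.of_forall fun ε => hχ.aestronglyMeasurable.indicator (hm ε))
    (Eventually.of_forall fun ε => ae_of_all _ fun h => norm_indicator_le_norm_self _ _)
    hχ.norm ?_
  have h0 : ∀ᵐ y : ℂ, y ≠ z := by
    simp [ae_iff, measure_singleton]
  filter_upwards [h0] with y hy
  refine tendsto_const_nhds.congr' ?_
  have : 0 < ‖z - y‖ := norm_pos_iff.2 (sub_ne_zero.2 hy.symm)
  filter_upwards [nhdsWithin_le_nhds (Iio_mem_nhds this)] with ε hε
  rw [Set.indicator_of_mem]; exact hε

/-- The polynomial `(z - y) ^ 2`, expanded around `w`, cancels the kernel of the Beurling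
transform. -/
lemma beurling_moments {χ : ℂ → ℂ} (hχ : IsTestFunction χ) (w z : ℂ) :
    (z - w) ^ 2 * beurling χ z - 2 * (z - w) * beurling (fun y => (y - w) * χ y) z
      + beurling (fun y => (y - w) ^ 2 * χ y) z = -(1 / (Real.pi : ℂ)) * ∫ y, χ y := by
  have h1 : IsTestFunction (fun y => (y - w) * χ y) := hχ.mul_left (by fun_prop)
  have h2 : IsTestFunction (fun y => (y - w) ^ 2 * χ y) := hχ.mul_left (by fun_prop)
  have l1 := (((tendsto_truncBeurling hχ z).const_mul ((z - w) ^ 2)).sub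
    ((tendsto_truncBeurling h1 z).const_mul (2 * (z - w)))).add (tendsto_truncBeurling h2 z)
  have l2 := (tendsto_setIntegral_trunc hχ.integrable z).const_mul (-(1 / (Real.pi : ℂ)))
  refine tendsto_nhds_unique l1 (l2.congr' ?_)
  filter_upwards [self_mem_nhdsWithin] with ε hε
  have hε' : (0 : ℝ) < ε := hε
  have hm : MeasurableSet {y : ℂ | ε < ‖z - y‖} := measurableSet_lt measurable_const (by fun_prop)
  have hint : ∀ φ : ℂ → ℂ, IsTestFunction φ →
      IntegrableOn (fun y => φ y / (z - y) ^ 2) {y : ℂ | ε < ‖z - y‖} volume := by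
    intro φ hφ
    refine Integrable.mono' (g := fun y => ‖φ y‖ * (ε ^ 2)⁻¹)
      (hφ.integrable.norm.mul_const _).integrableOn ?_ ?_
    · exact (hφ.continuous.measurable.div (by fun_prop)).aestronglyMeasurable
    · refine (ae_restrict_iff' hm).2 (Eventually.of_forall fun y hy => ?_)
      rw [norm_div, norm_pow, div_eq_mul_inv]
      gcongr
      exact le_of_lt hy
  simp only [truncBeurling]
  rw [show (z - w) ^ 2 * (-(1 / (Real.pi : ℂ)) * ∫ y in {y : ℂ | ε < ‖z - y‖}, χ y / (z - y) ^ 2)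
      - 2 * (z - w) * (-(1 / (Real.pi : ℂ)) *
        ∫ y in {y : ℂ | ε < ‖z - y‖}, (y - w) * χ y / (z - y) ^ 2)
      + -(1 / (Real.pi : ℂ)) * ∫ y in {y : ℂ | ε < ‖z - y‖}, (y - w) ^ 2 * χ y / (z - y) ^ 2
      = -(1 / (Real.pi : ℂ)) * ((z - w) ^ 2 * (∫ y in {y : ℂ | ε < ‖z - y‖}, χ y / (z - y) ^ 2)
      - 2 * (z - w) * (∫ y in {y : ℂ | ε < ‖z - y‖}, (y - w) * χ y / (z - y) ^ 2)
      + ∫ y in {y : ℂ | ε < ‖z - y‖}, (y - w) ^ 2 * χ y / (z - y) ^ 2) by ring]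
  congr 1
  rw [← integral_const_mul, ← integral_const_mul, integral_sub_add ((hint _ hχ).const_mul _)
    ((hint _ h1).const_mul _) (hint _ h2)]
  refine setIntegral_congr_fun hm fun y hy => ?_
  have hy0 : z - y ≠ 0 := by
    rw [← norm_pos_iff]; exact hε'.trans hy
  field_simp
  ring

/-- The bilinear form `⟨[b, S] v, φ⟩ = ∫ b (φ S v - v S φ)` of the commutator. -/
noncomputable def commForm (b v φ : ℂ → ℂ) : ℂ :=
  ∫ z, b z * (φ z * beurling v z - v z * beurling φ z)

lemma integrable_mul_test_mul_beurling {b v φ : ℂ → ℂ} (hb : LocallyIntegrable b volume)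
    (hv : IsTestFunction v) (hφ : IsTestFunction φ) :
    Integrable (fun z => b z * (φ z * beurling v z)) volume := by
  obtain ⟨C, hC0, hC⟩ := exists_beurling_bound hv
  have := (integrable_mul_test hb hφ).mul_bdd (c := C)
    (stronglyMeasurable_beurling hv).aestronglyMeasurable (ae_of_all _ fun z => (hC z).trans (by
      refine mul_le_of_le_one_right hC0 (inv_le_one_of_one_le₀ ?_)
      nlinarith [norm_nonneg z]))
  exact this.congr (ae_of_all _ fun z => by simp [mul_assoc])

lemma integrable_commForm {b v φ : ℂ → ℂ} (hb : LocallyIntegrable b volume)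
    (hv : IsTestFunction v) (hφ : IsTestFunction φ) :
    Integrable (fun z => b z * (φ z * beurling v z - v z * beurling φ z)) volume := by
  simp only [mul_sub]
  exact (integrable_mul_test_mul_beurling hb hv hφ).sub (integrable_mul_test_mul_beurling hb hφ hv)

lemma beurling_add {v v' : ℂ → ℂ} (hv : IsTestFunction v) (hv' : IsTestFunction v') (z : ℂ) :
    beurling (fun y => v y + v' y) z = beurling v z + beurling v' z := by
  rw [beurling, beurling, beurling, ← mul_add, ← integral_add (integrable_symm_kernel hv z)
    (integrable_symm_kernel hv' z)]
  congr 2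
  ext h
  ring

lemma beurling_const_mul (c : ℂ) (v : ℂ → ℂ) (z : ℂ) :
    beurling (fun y => c * v y) z = c * beurling v z := by
  have : ∀ h : ℂ, (c * v (z - h) - c * v (z - Complex.I * h)) / h ^ 2 =
      c * ((v (z - h) - v (z - Complex.I * h)) / h ^ 2) := fun h => by ring
  simp only [beurling, this, integral_const_mul]
  ring

lemma commForm_add_left {b v v' φ : ℂ → ℂ} (hb : LocallyIntegrable b volume)
    (hv : IsTestFunction v) (hv' : IsTestFunction v') (hφ : IsTestFunction φ) :
    commForm b (fun y => v y + v' y) φ = commForm b v φ + commForm b v' φ := by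
  rw [commForm, commForm, commForm, ← integral_add (integrable_commForm hb hv hφ)
    (integrable_commForm hb hv' hφ)]
  congr 1
  ext z
  rw [beurling_add hv hv']
  ring

lemma commForm_swap (b v φ : ℂ → ℂ) : commForm b φ v = -commForm b v φ := by
  rw [commForm, commForm, ← integral_neg]
  congr 1
  ext z
  ring

lemma commForm_add_right {b v φ φ' : ℂ → ℂ} (hb : LocallyIntegrable b volume)
    (hv : IsTestFunction v) (hφ : IsTestFunction φ) (hφ' : IsTestFunction φ') :
    commForm b v (fun y => φ y + φ' y) = commForm b v φ + commForm b v φ' := by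
  rw [commForm_swap b (fun y => φ y + φ' y) v, commForm_add_left hb hφ hφ' hv,
    commForm_swap b v φ, commForm_swap b v φ']
  ring

lemma commForm_const_mul_left (b : ℂ → ℂ) (c : ℂ) (v φ : ℂ → ℂ) :
    commForm b (fun y => c * v y) φ = c * commForm b v φ := by
  rw [commForm, commForm, ← integral_const_mul]
  congr 1
  ext z
  rw [beurling_const_mul]
  ring

lemma commForm_const_mul_right (b : ℂ → ℂ) (c : ℂ) (v φ : ℂ → ℂ) :
    commForm b v (fun y => c * φ y) = c * commForm b v φ := by
  rw [commForm_swap b _ v, commForm_const_mul_left, commForm_swap b v φ]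
  ring

/-- Three values of the commutator form recover the oscillation of `b` between `ψ` and `χ`. -/
lemma commForm_moments {b χ ψ : ℂ → ℂ} (hb : LocallyIntegrable b volume) (hχ : IsTestFunction χ)
    (hψ : IsTestFunction ψ) (w : ℂ) :
    (∫ z, b z * ψ z) * (∫ y, χ y) - (∫ z, b z * χ z) * (∫ y, ψ y) =
      -(Real.pi : ℂ) * (commForm b χ (fun z => (z - w) ^ 2 * ψ z)
        - 2 * commForm b (fun y => (y - w) * χ y) (fun z => (z - w) * ψ z)
        + commForm b (fun y => (y - w) ^ 2 * χ y) ψ) := by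
  have hχ1 : IsTestFunction (fun y => (y - w) * χ y) := hχ.mul_left (by fun_prop)
  have hχ2 : IsTestFunction (fun y => (y - w) ^ 2 * χ y) := hχ.mul_left (by fun_prop)
  have hψ1 : IsTestFunction (fun y => (y - w) * ψ y) := hψ.mul_left (by fun_prop)
  have hψ2 : IsTestFunction (fun y => (y - w) ^ 2 * ψ y) := hψ.mul_left (by fun_prop)
  rw [← integral_mul_const, ← integral_mul_const, ← integral_sub
    ((integrable_mul_test hb hψ).mul_const _) ((integrable_mul_test hb hχ).mul_const _)]
  simp only [commForm]
  rw [← integral_const_mul 2, integral_sub_add (integrable_commForm hb hχ hψ2)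
    ((integrable_commForm hb hχ1 hψ1).const_mul 2) (integrable_commForm hb hχ2 hψ),
    ← integral_const_mul]
  congr 1
  ext z
  have h1 := beurling_moments hχ w z
  have h2 := beurling_moments hψ w z
  have hpi : (Real.pi : ℂ) ≠ 0 := by exact_mod_cast Real.pi_ne_zero
  have h1' : ∫ y, χ y = -Real.pi * ((z - w) ^ 2 * beurling χ z
      - 2 * (z - w) * beurling (fun y => (y - w) * χ y) z
      + beurling (fun y => (y - w) ^ 2 * χ y) z) := by rw [h1]; field_simp
  have h2' : ∫ y, ψ y = -Real.pi * ((z - w) ^ 2 * beurling ψ z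
      - 2 * (z - w) * beurling (fun y => (y - w) * ψ y) z
      + beurling (fun y => (y - w) ^ 2 * ψ y) z) := by rw [h2]; field_simp
  rw [h1', h2']
  ring

lemma enorm_integral_mul_le {f g : ℂ → ℂ} {p q : ℝ≥0∞} [p.HolderConjugate q]
    (hf : AEStronglyMeasurable f volume) (hg : AEStronglyMeasurable g volume) :
    ‖∫ z, f z * g z‖ₑ ≤ eLpNorm f p volume * eLpNorm g q volume := by
  refine (enorm_integral_le_lintegral_enorm _).trans ?_
  rw [← eLpNorm_one_eq_lintegral_enorm]
  have h := eLpNorm_le_eLpNorm_mul_eLpNorm'_of_norm (p := p) (q := q) (r := 1) hf hg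
    (fun a b : ℂ => a * b) 1 (ae_of_all _ fun z => by simp)
  simpa using h

lemma TailIntegrable.of_mul_test {b v : ℂ → ℂ} (hb : LocallyIntegrable b volume)
    (hv : IsTestFunction v) : TailIntegrable (fun y => b y * v y) :=
  (memLp_one_iff_integrable.2 (integrable_mul_test hb hv)).tailIntegrable le_rfl (by simp)

lemma _root_.IsTestFunction.tailIntegrable {v : ℂ → ℂ} (hv : IsTestFunction v) :
    TailIntegrable v := (hv.memLp 1).tailIntegrable le_rfl (by simp)

/-- A norm bound for the commutator bounds its bilinear form. -/
lemma enorm_commForm_le {b : ℂ → ℂ} (hb : LocallyIntegrable b volume) {p q q' : ℝ≥0∞}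
    [q.HolderConjugate q'] {C : ℝ≥0} (hC : BeurlingCommutatorBound b p q C) {v φ : ℂ → ℂ}
    (hv : IsTestFunction v) (hφ : IsTestFunction φ) :
    ‖commForm b v φ‖ₑ ≤ C * eLpNorm v p volume * eLpNorm φ q' volume := by
  obtain ⟨h, ⟨w₁, w₂, hw₁, hw₂, hh⟩, hhq, hle⟩ := hC v hv
  rw [isBeurlingTransform_iff hv.tailIntegrable] at hw₁
  rw [isBeurlingTransform_iff (TailIntegrable.of_mul_test hb hv)] at hw₂
  have e1 := hw₁.ae_eq (isTransposeBeurling_beurling hv)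
  have key : commForm b v φ = ∫ z, h z * φ z := by
    have e2 : ∫ z, h z * φ z = ∫ z, (b z * (φ z * beurling v z) - w₂ z * φ z) := by
      refine integral_congr_ae ?_
      filter_upwards [hh, e1] with z hz1 hz2
      rw [hz1, hz2]; ring
    rw [e2, integral_sub (integrable_mul_test_mul_beurling hb hv hφ)
      (integrable_mul_test hw₂.1 hφ), hw₂.2 φ hφ, commForm]
    simp only [mul_sub]
    rw [integral_sub (integrable_mul_test_mul_beurling hb hv hφ)
      (integrable_mul_test_mul_beurling hb hφ hv)]
    simp only [mul_assoc]
  rw [key]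
  exact (enorm_integral_mul_le (p := q) (q := q') hhq.1
    hφ.continuous.aestronglyMeasurable).trans (by gcongr)

/-! ### Squares and the Calderón–Zygmund stopping time -/

/-- The half-open square with lower left corner `Q.1` and side length `Q.2`. -/
def box (Q : ℂ × ℝ) : Set ℂ :=
  {z | z.re ∈ Set.Ico Q.1.re (Q.1.re + Q.2) ∧ z.im ∈ Set.Ico Q.1.im (Q.1.im + Q.2)}

lemma measurableSet_box (Q : ℂ × ℝ) : MeasurableSet (box Q) :=
  (Complex.measurable_re measurableSet_Ico).inter (Complex.measurable_im measurableSet_Ico)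

lemma volume_box (Q : ℂ × ℝ) : volume (box Q) = ENNReal.ofReal Q.2 * ENNReal.ofReal Q.2 := by
  have h : box Q = Complex.measurableEquivRealProd ⁻¹'
      (Set.Ico Q.1.re (Q.1.re + Q.2) ×ˢ Set.Ico Q.1.im (Q.1.im + Q.2)) := by
    ext z; simp [box, Complex.measurableEquivRealProd]
  rw [h, Complex.volume_preserving_equiv_real_prod.measure_preimage_equiv,
    Measure.volume_eq_prod, Measure.prod_prod]
  simp

lemma volume_real_box {Q : ℂ × ℝ} (hQ : 0 < Q.2) : volume.real (box Q) = Q.2 ^ 2 := by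
  rw [measureReal_def, volume_box, ← ENNReal.ofReal_mul hQ.le,
    ENNReal.toReal_ofReal (by positivity), sq]

lemma volume_box_ne_top (Q : ℂ × ℝ) : volume (box Q) ≠ ∞ := by
  rw [volume_box]; finiteness

lemma corner_mem_box {Q : ℂ × ℝ} (hQ : 0 < Q.2) : Q.1 ∈ box Q := by
  simp [box, hQ]

lemma norm_sub_le_of_mem_box {Q : ℂ × ℝ} {z w : ℂ} (hz : z ∈ box Q) (hw : w ∈ box Q) :
    ‖z - w‖ ≤ 2 * Q.2 := by
  obtain ⟨⟨h1, h2⟩, h3, h4⟩ := hz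
  obtain ⟨⟨h5, h6⟩, h7, h8⟩ := hw
  refine (Complex.norm_le_abs_re_add_abs_im _).trans ?_
  rw [Complex.sub_re, Complex.sub_im, two_mul]
  exact add_le_add (abs_le.2 ⟨by linarith, by linarith⟩) (abs_le.2 ⟨by linarith, by linarith⟩)

/-- The four dyadic children of a square. -/
noncomputable def child (Q : ℂ × ℝ) (s : Bool × Bool) : ℂ × ℝ :=
  (⟨Q.1.re + if s.1 then Q.2 / 2 else 0, Q.1.im + if s.2 then Q.2 / 2 else 0⟩, Q.2 / 2)

lemma box_child_subset {Q : ℂ × ℝ} (hQ : 0 < Q.2) (s : Bool × Bool) :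
    box (child Q s) ⊆ box Q := by
  rintro z ⟨⟨h1, h2⟩, h3, h4⟩
  obtain ⟨s1, s2⟩ := s
  cases s1 <;> cases s2 <;> simp only [child, if_true, if_false, Bool.false_eq_true] at h1 h2 h3 h4 <;>
    exact ⟨⟨by linarith, by linarith⟩, by linarith, by linarith⟩

lemma exists_mem_box_child {Q : ℂ × ℝ} {z : ℂ} (hz : z ∈ box Q) : ∃ s, z ∈ box (child Q s) := by
  obtain ⟨⟨h1, h2⟩, h3, h4⟩ := hz
  rcases le_or_gt (Q.1.re + Q.2 / 2) z.re with h5 | h5 <;>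
    rcases le_or_gt (Q.1.im + Q.2 / 2) z.im with h6 | h6
  on_goal 1 => refine ⟨(true, true), ⟨?_, ?_⟩, ?_, ?_⟩
  on_goal 5 => refine ⟨(true, false), ⟨?_, ?_⟩, ?_, ?_⟩
  on_goal 9 => refine ⟨(false, true), ⟨?_, ?_⟩, ?_, ?_⟩
  on_goal 13 => refine ⟨(false, false), ⟨?_, ?_⟩, ?_, ?_⟩
  all_goals simp only [child, if_true, if_false, Bool.false_eq_true]; linarith

lemma disjoint_box_child {Q : ℂ × ℝ} {s t : Bool × Bool} (hst : s ≠ t) :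
    Disjoint (box (child Q s)) (box (child Q t)) := by
  rw [Set.disjoint_left]
  rintro z ⟨⟨h1, h2⟩, h3, h4⟩ ⟨⟨h5, h6⟩, h7, h8⟩
  obtain ⟨s1, s2⟩ := s
  obtain ⟨t1, t2⟩ := t
  revert hst
  cases s1 <;> cases s2 <;> cases t1 <;> cases t2 <;>
    simp only [child, if_true, if_false, Bool.false_eq_true] at h1 h2 h3 h4 h5 h6 h7 h8 <;>
    intro hst <;> first | exact hst rfl | linarith

/-- A finite family `F` of squares obtained by stopping the dyadic subdivision of `Q` as soon as
the average of `g` exceeds `lam`. The parent of a stopping square has four times its area and an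
average of at most `lam`, whence the factor in `integral_le`. -/
structure IsStoppingFamily (g : ℂ → ℝ) (lam : ℝ) (Q : ℂ × ℝ) (F : Finset (ℂ × ℝ)) : Prop where
  pos : ∀ P ∈ F, 0 < P.2
  subset : ∀ P ∈ F, box P ⊆ box Q
  lt_integral : ∀ P ∈ F, lam * P.2 ^ 2 < ∫ x in box P, g x
  integral_le : ∀ P ∈ F, ∫ x in box P, g x ≤ 4 * lam * P.2 ^ 2
  disjoint : (F : Set (ℂ × ℝ)).PairwiseDisjoint box

/-- The stopping time, run for `N` generations: every point of `Q` outside the stopping squares lies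
in a square of generation `N` over which the average of `g` is at most `lam`. -/
lemma exists_stoppingFamily {g : ℂ → ℝ} (hg : LocallyIntegrable g volume) (hg0 : ∀ x, 0 ≤ g x)
    (lam : ℝ) (N : ℕ) : ∀ Q : ℂ × ℝ, 0 < Q.2 → ∫ x in box Q, g x ≤ lam * Q.2 ^ 2 →
      ∃ F : Finset (ℂ × ℝ), IsStoppingFamily g lam Q F ∧
        ∀ x ∈ box Q, (∀ P ∈ F, x ∉ box P) → ∃ P : ℂ × ℝ, x ∈ box P ∧ P.2 = Q.2 / 2 ^ N ∧
          ∫ y in box P, g y ≤ lam * P.2 ^ 2 := by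
  classical
  have hint : ∀ P : ℂ × ℝ, IntegrableOn g (box P) volume := fun P => by
    refine (hg.integrableOn_isCompact (isCompact_closedBall P.1 (2 * P.2))).mono_set fun z hz => ?_
    rcases le_or_gt P.2 0 with h | h
    · exact absurd hz.1.1 (not_le.2 (by linarith [hz.1.2]))
    · rw [mem_closedBall_iff_norm]
      exact norm_sub_le_of_mem_box hz (corner_mem_box h)
  induction N with
  | zero =>
    intro Q hQ hle
    exact ⟨∅, ⟨by simp, by simp, by simp, by simp, by simp⟩, fun x hx _ => ⟨Q, hx, by simp, hle⟩⟩
  | succ N ih =>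
    intro Q hQ hle
    have hpos : ∀ s, 0 < (child Q s).2 := fun s => by simp only [child]; positivity
    have key : ∀ s, ∃ F : Finset (ℂ × ℝ), IsStoppingFamily g lam (child Q s) F ∧
        ∀ x ∈ box (child Q s), (∀ P ∈ F, x ∉ box P) → ∃ P : ℂ × ℝ, x ∈ box P ∧
          P.2 = Q.2 / 2 ^ (N + 1) ∧ ∫ y in box P, g y ≤ lam * P.2 ^ 2 := by
      intro s
      by_cases h : lam * (child Q s).2 ^ 2 < ∫ x in box (child Q s), g x
      · refine ⟨{child Q s}, ⟨?_, ?_, ?_, ?_, ?_⟩, fun x hx hx' => ?_⟩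
        · simpa using hpos s
        · simp
        · simpa using h
        · simp only [Finset.mem_singleton, forall_eq]
          have h1 : ∫ x in box (child Q s), g x ≤ ∫ x in box Q, g x :=
            setIntegral_mono_set (hint Q) (ae_of_all _ hg0)
              (box_child_subset hQ s).eventuallyLE
          have h2 : (child Q s).2 = Q.2 / 2 := rfl
          rw [h2]
          calc _ ≤ lam * Q.2 ^ 2 := h1.trans hle
            _ = _ := by ring
        · simp
        · exact absurd hx (hx' _ (by simp))
      · obtain ⟨F, hF, hF'⟩ := ih (child Q s) (hpos s) (not_lt.1 h)
        refine ⟨F, hF, fun x hx hx' => ?_⟩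
        obtain ⟨P, hP1, hP2, hP3⟩ := hF' x hx hx'
        refine ⟨P, hP1, ?_, hP3⟩
        rw [hP2]; simp only [child]; rw [pow_succ']; field_simp
    choose F hF hF' using key
    refine ⟨Finset.univ.biUnion F, ⟨?_, ?_, ?_, ?_, ?_⟩, fun x hx hx' => ?_⟩
    · intro P hP
      obtain ⟨s, -, hs⟩ := Finset.mem_biUnion.1 hP
      exact (hF s).pos P hs
    · intro P hP
      obtain ⟨s, -, hs⟩ := Finset.mem_biUnion.1 hP
      exact ((hF s).subset P hs).trans (box_child_subset hQ s)
    · intro P hP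
      obtain ⟨s, -, hs⟩ := Finset.mem_biUnion.1 hP
      exact (hF s).lt_integral P hs
    · intro P hP
      obtain ⟨s, -, hs⟩ := Finset.mem_biUnion.1 hP
      exact (hF s).integral_le P hs
    · intro P hP P' hP' hne
      obtain ⟨s, -, hs⟩ := Finset.mem_biUnion.1 (Finset.mem_coe.1 hP)
      obtain ⟨t, -, ht⟩ := Finset.mem_biUnion.1 (Finset.mem_coe.1 hP')
      rcases eq_or_ne s t with rfl | hst
      · exact (hF s).disjoint hs ht hne
      · exact (disjoint_box_child hst).mono ((hF s).subset P hs) ((hF t).subset P' ht)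
    · obtain ⟨s, hs⟩ := exists_mem_box_child hx
      exact hF' s x hs fun P hP => hx' P (Finset.mem_biUnion.2 ⟨s, Finset.mem_univ _, hP⟩)

lemma integrableOn_box {f : ℂ → ℂ} (hf : Continuous f) (Q : ℂ × ℝ) :
    IntegrableOn f (box Q) volume := by
  refine (hf.locallyIntegrable.integrableOn_isCompact
    (isCompact_closedBall Q.1 (2 * Q.2))).mono_set fun z hz => ?_
  rcases le_or_gt Q.2 0 with h | h
  · exact absurd hz.1.1 (not_le.2 (by linarith [hz.1.2]))
  · rw [mem_closedBall_iff_norm]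
    exact norm_sub_le_of_mem_box hz (corner_mem_box h)

/-- For a continuous function of compact support, finitely many stopping squares suffice: once the
oscillation of `f` over the remaining small squares is at most `lam`, it is at most `2 * lam` on
them. -/
lemma exists_stoppingFamily_of_continuous {f : ℂ → ℂ} (hf : Continuous f)
    (hfc : HasCompactSupport f) {lam : ℝ} (hlam : 0 < lam) {Q : ℂ × ℝ} (hQ : 0 < Q.2)
    (hle : ∫ x in box Q, ‖f x‖ ≤ lam * Q.2 ^ 2) :
    ∃ F : Finset (ℂ × ℝ), IsStoppingFamily (fun x => ‖f x‖) lam Q F ∧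
      ∀ x ∈ box Q, (∀ P ∈ F, x ∉ box P) → ‖f x‖ ≤ 2 * lam := by
  have huc : UniformContinuous f := hfc.uniformContinuous_of_continuous hf
  obtain ⟨δ, hδ, hδ'⟩ := Metric.uniformContinuous_iff.1 huc lam hlam
  obtain ⟨N, hN⟩ : ∃ N : ℕ, 2 * (Q.2 / 2 ^ N) < δ := by
    obtain ⟨N, hN⟩ := pow_unbounded_of_one_lt (2 * Q.2 / δ) (one_lt_two)
    refine ⟨N, ?_⟩
    rw [div_lt_iff₀ hδ] at hN
    rw [← mul_div_assoc, div_lt_iff₀ (by positivity), mul_comm δ]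
    exact hN
  obtain ⟨F, hF, hF'⟩ := exists_stoppingFamily (g := fun x => ‖f x‖)
    hf.norm.locallyIntegrable (fun x => norm_nonneg _) lam N Q hQ hle
  refine ⟨F, hF, fun x hx hx' => ?_⟩
  obtain ⟨P, hxP, hP2, hP3⟩ := hF' x hx hx'
  have hP0 : 0 < P.2 := by rw [hP2]; positivity
  have h1 : ∫ y in box P, (‖f x‖ - lam) ≤ ∫ y in box P, ‖f y‖ := by
    refine setIntegral_mono_on (integrableOn_const (volume_box_ne_top P))
      (integrableOn_box hf P).norm (measurableSet_box P) fun y hy => ?_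
    have h2 := hδ' (a := x) (b := y) (by
      rw [dist_eq_norm]
      refine (norm_sub_le_of_mem_box hxP hy).trans_lt ?_
      rwa [hP2])
    rw [dist_eq_norm] at h2
    have := norm_sub_norm_le (f x) (f y)
    linarith
  rw [setIntegral_const, volume_real_box hP0, smul_eq_mul] at h1
  have h3 : P.2 ^ 2 * (‖f x‖ - lam) ≤ P.2 ^ 2 * lam := by linarith
  have := le_of_mul_le_mul_left h3 (by positivity)
  linarith

/-- The mean of `f` over a square. -/
noncomputable def mean (f : ℂ → ℂ) (Q : ℂ × ℝ) : ℂ := (∫ x in box Q, f x) / (Q.2 ^ 2 : ℝ)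

/-- The part of `f` carried by a square, normalized to have mean zero. -/
noncomputable def osc (f : ℂ → ℂ) (Q : ℂ × ℝ) (x : ℂ) : ℂ :=
  (box Q).indicator (fun x => f x - mean f Q) x

lemma norm_mean_le {f : ℂ → ℂ} {Q : ℂ × ℝ} (hQ : 0 < Q.2) {lam : ℝ}
    (h : ∫ x in box Q, ‖f x‖ ≤ lam * Q.2 ^ 2) : ‖mean f Q‖ ≤ lam := by
  rw [mean, norm_div, Complex.norm_real, Real.norm_of_nonneg (by positivity),
    div_le_iff₀ (by positivity)]
  exact (norm_integral_le_integral_norm _).trans h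

lemma integrable_osc {f : ℂ → ℂ} {Q : ℂ × ℝ} (hf : IntegrableOn f (box Q) volume) :
    Integrable (osc f Q) volume :=
  (hf.sub (integrableOn_const (volume_box_ne_top Q))).integrable_indicator (measurableSet_box Q)

lemma integral_osc {f : ℂ → ℂ} {Q : ℂ × ℝ} (hQ : 0 < Q.2) (hf : IntegrableOn f (box Q) volume) :
    ∫ x, osc f Q x = 0 := by
  simp only [osc]
  rw [integral_indicator (measurableSet_box Q), integral_sub hf
    (integrableOn_const (volume_box_ne_top Q)), setIntegral_const, volume_real_box hQ, mean]
  have : ((Q.2 ^ 2 : ℝ) : ℂ) ≠ 0 := by exact_mod_cast (by positivity : Q.2 ^ 2 ≠ 0)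
  rw [Complex.real_smul, mul_div_cancel₀ _ this, sub_self]

lemma osc_of_mem {f : ℂ → ℂ} {Q : ℂ × ℝ} {x : ℂ} (hx : x ∈ box Q) :
    osc f Q x = f x - mean f Q := Set.indicator_of_mem hx _

lemma osc_of_notMem {f : ℂ → ℂ} {Q : ℂ × ℝ} {x : ℂ} (hx : x ∉ box Q) :
    osc f Q x = 0 := Set.indicator_of_notMem hx _

/-- Chebyshev's inequality on the union of the stopping squares. -/
lemma IsStoppingFamily.sum_sq_le {f : ℂ → ℂ} (hf : Continuous f) (hfc : HasCompactSupport f)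
    {lam : ℝ} (hlam : 0 < lam) {F : Finset (ℂ × ℝ)} (hpos : ∀ P ∈ F, 0 < P.2)
    (hlt : ∀ P ∈ F, lam * P.2 ^ 2 < ∫ x in box P, ‖f x‖)
    (hdisj : (F : Set (ℂ × ℝ)).PairwiseDisjoint box) :
    ∑ P ∈ F, P.2 ^ 2 ≤ 2 / lam * ∫ x in {x | lam / 2 < ‖f x‖}, ‖f x‖ := by
  have hfi : Integrable f volume := hf.integrable_of_hasCompactSupport hfc
  set E := {x | lam / 2 < ‖f x‖}
  have hE : MeasurableSet E := measurableSet_lt measurable_const hf.norm.measurable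
  have h1 : ∀ P ∈ F, lam / 2 * P.2 ^ 2 ≤ ∫ x in box P, E.indicator (fun x => ‖f x‖) x := by
    intro P hP
    have h2 : ∫ x in box P, (‖f x‖ - lam / 2) ≤ ∫ x in box P, E.indicator (fun x => ‖f x‖) x := by
      refine setIntegral_mono ((integrableOn_box hf P).norm.sub
        (integrableOn_const (volume_box_ne_top P)))
        ((hfi.norm.indicator hE).integrableOn) fun x => ?_
      by_cases hx : x ∈ E
      · rw [Set.indicator_of_mem hx]; simp only; linarith
      · rw [Set.indicator_of_notMem hx]
        simp only [E, Set.mem_ofPred_eq, not_lt] at hx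
        simp only; linarith
    rw [integral_sub (integrableOn_box hf P).norm (integrableOn_const (volume_box_ne_top P)),
      setIntegral_const, volume_real_box (hpos P hP), smul_eq_mul] at h2
    linarith [hlt P hP]
  have h3 : lam / 2 * ∑ P ∈ F, P.2 ^ 2 ≤ ∫ x in E, ‖f x‖ := by
    rw [Finset.mul_sum]
    refine (Finset.sum_le_sum h1).trans ?_
    rw [← integral_biUnion_finset F (fun P _ => measurableSet_box P) hdisj
      (fun P _ => (hfi.norm.indicator hE).integrableOn), ← integral_indicator hE]
    exact setIntegral_le_integral (hfi.norm.indicator hE)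
      (ae_of_all _ fun x => Set.indicator_nonneg (fun _ _ => norm_nonneg _) _)
  rw [div_mul_eq_mul_div, le_div_iff₀ hlam]
  linarith

/-! ### Sums of oscillations: signs and mollification -/

/-- Choosing signs one after the other, the diagonal sum of a bilinear form is dominated by a single
value of the form. -/
lemma exists_norm_sum_commForm_le {b : ℂ → ℂ} (hb : LocallyIntegrable b volume) {ι : Type*}
    {v φ : ι → ℂ → ℂ} (s : Finset ι) : (∀ i ∈ s, IsTestFunction (v i)) →
    (∀ i ∈ s, IsTestFunction (φ i)) → ∀ V Φ : ℂ → ℂ, IsTestFunction V → IsTestFunction Φ →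
    ∃ W Ψ : ℂ → ℂ, IsTestFunction W ∧ IsTestFunction Ψ ∧
      (∀ x, ‖W x‖ ≤ ‖V x‖ + ∑ i ∈ s, ‖v i x‖) ∧ (∀ x, ‖Ψ x‖ ≤ ‖Φ x‖ + ∑ i ∈ s, ‖φ i x‖) ∧
      ‖commForm b V Φ + ∑ i ∈ s, commForm b (v i) (φ i)‖ ≤ ‖commForm b W Ψ‖ := by
  classical
  induction s using Finset.induction_on with
  | empty => exact fun _ _ V Φ hV hΦ => ⟨V, Φ, hV, hΦ, by simp, by simp, by simp⟩
  | insert a s ha ih =>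
    intro hv hφ V Φ hV hΦ
    have hva := hv a (by simp)
    have hφa := hφ a (by simp)
    have step : ∀ σ : ℂ, σ * σ = 1 → ‖σ‖ = 1 → ∃ W Ψ : ℂ → ℂ, IsTestFunction W ∧
        IsTestFunction Ψ ∧ (∀ x, ‖W x‖ ≤ ‖V x‖ + ∑ i ∈ insert a s, ‖v i x‖) ∧
        (∀ x, ‖Ψ x‖ ≤ ‖Φ x‖ + ∑ i ∈ insert a s, ‖φ i x‖) ∧
        ‖(commForm b V Φ + ∑ i ∈ insert a s, commForm b (v i) (φ i)) +
          σ * (commForm b V (φ a) + commForm b (v a) Φ)‖ ≤ ‖commForm b W Ψ‖ := by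
      intro σ hσ hσ1
      obtain ⟨W, Ψ, hW, hΨ, hW1, hΨ1, hle⟩ := ih (fun i hi => hv i (by simp [hi]))
        (fun i hi => hφ i (by simp [hi])) (fun x => V x + σ * v a x) (fun x => Φ x + σ * φ a x)
        (hV.add (hva.const_mul σ)) (hΦ.add (hφa.const_mul σ))
      refine ⟨W, Ψ, hW, hΨ, fun x => ?_, fun x => ?_, ?_⟩
      · rw [Finset.sum_insert ha, ← add_assoc]
        refine (hW1 x).trans (by
          gcongr
          refine (norm_add_le _ _).trans ?_
          rw [norm_mul, hσ1, one_mul])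
      · rw [Finset.sum_insert ha, ← add_assoc]
        refine (hΨ1 x).trans (by
          gcongr
          refine (norm_add_le _ _).trans ?_
          rw [norm_mul, hσ1, one_mul])
      · refine le_of_eq_of_le ?_ hle
        rw [commForm_add_left hb hV (hva.const_mul σ) (hΦ.add (hφa.const_mul σ)),
          commForm_add_right hb hV hΦ (hφa.const_mul σ),
          commForm_add_right hb (hva.const_mul σ) hΦ (hφa.const_mul σ),
          commForm_const_mul_left, commForm_const_mul_left, commForm_const_mul_right,
          commForm_const_mul_right, Finset.sum_insert ha]
        congr 1
        linear_combination (-commForm b (v a) (φ a)) * hσ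
    -- the two signs add cross terms `± Y` to the desired sum `X`, and one of them does not decrease
    -- its norm
    set X := commForm b V Φ + ∑ i ∈ insert a s, commForm b (v i) (φ i)
    set Y := commForm b V (φ a) + commForm b (v a) Φ
    have hXY : ‖X‖ ≤ ‖X + 1 * Y‖ ∨ ‖X‖ ≤ ‖X + -1 * Y‖ := by
      by_contra! h
      have h2 : ‖(X + 1 * Y) + (X + -1 * Y)‖ ≤ ‖X + 1 * Y‖ + ‖X + -1 * Y‖ := norm_add_le _ _
      have h3 : (X + 1 * Y) + (X + -1 * Y) = 2 * X := by ring
      rw [h3, norm_mul, Complex.norm_ofNat] at h2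
      linarith
    rcases hXY with h | h
    · obtain ⟨W, Ψ, hW, hΨ, hW1, hΨ1, hle⟩ := step 1 (by simp) (by simp)
      exact ⟨W, Ψ, hW, hΨ, hW1, hΨ1, h.trans hle⟩
    · obtain ⟨W, Ψ, hW, hΨ, hW1, hΨ1, hle⟩ := step (-1) (by simp) (by simp)
      exact ⟨W, Ψ, hW, hΨ, hW1, hΨ1, h.trans hle⟩

lemma enorm_sum_commForm_le {b : ℂ → ℂ} (hb : LocallyIntegrable b volume) {p q q' : ℝ≥0∞}
    [q.HolderConjugate q'] {C : ℝ≥0} (hC : BeurlingCommutatorBound b p q C) {ι : Type*}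
    {v φ : ι → ℂ → ℂ} (s : Finset ι) (hv : ∀ i ∈ s, IsTestFunction (v i))
    (hφ : ∀ i ∈ s, IsTestFunction (φ i)) :
    ‖∑ i ∈ s, commForm b (v i) (φ i)‖ₑ ≤
      C * eLpNorm (fun x => ∑ i ∈ s, ‖v i x‖) p volume *
        eLpNorm (fun x => ∑ i ∈ s, ‖φ i x‖) q' volume := by
  obtain ⟨W, Ψ, hW, hΨ, hW1, hΨ1, hle⟩ := exists_norm_sum_commForm_le hb s hv hφ
    (fun _ => 0) (fun _ => 0) isTestFunction_zero isTestFunction_zero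
  have h0 : commForm b (fun _ => 0) (fun _ => 0) = 0 := by simp [commForm]
  rw [h0, zero_add] at hle
  have h1 : ‖∑ i ∈ s, commForm b (v i) (φ i)‖ₑ ≤ ‖commForm b W Ψ‖ₑ := by
    rw [← ofReal_norm, ← ofReal_norm]
    exact ENNReal.ofReal_le_ofReal hle
  refine h1.trans ((enorm_commForm_le (q' := q') hb hC hW hΨ).trans ?_)
  gcongr
  · exact eLpNorm_mono_real fun x => by simpa using hW1 x
  · exact eLpNorm_mono_real fun x => by simpa using hΨ1 x

lemma memLp_of_bounded {χ : ℂ → ℂ} (hχ : AEStronglyMeasurable χ volume) {M R : ℝ}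
    (hM : ∀ x, ‖χ x‖ ≤ M) (hR : ∀ x, R < ‖x‖ → χ x = 0) (p : ℝ≥0∞) : MemLp χ p volume := by
  refine HasCompactSupport.memLp_of_bound
    (HasCompactSupport.intro (isCompact_closedBall (0 : ℂ) R) fun x hx => hR x ?_) hχ M
    (ae_of_all _ hM)
  rwa [mem_closedBall_zero_iff, not_le] at hx

/-- Bounded functions of compact support are boundedly almost everywhere limits of test
functions. -/
lemma exists_mollification {χ : ℂ → ℂ} (hχ : AEStronglyMeasurable χ volume) {M R : ℝ}
    (hM : ∀ x, ‖χ x‖ ≤ M) (hR : ∀ x, R < ‖x‖ → χ x = 0) :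
    ∃ χn : ℕ → ℂ → ℂ, (∀ n, IsTestFunction (χn n)) ∧ (∀ n x, ‖χn n x‖ ≤ M) ∧
      (∀ n x, R + 1 < ‖x‖ → χn n x = 0) ∧
      ∀ᵐ x ∂volume, Tendsto (fun n => χn n x) atTop (𝓝 (χ x)) := by
  have hχi : Integrable χ volume := memLp_one_iff_integrable.1 (memLp_of_bounded hχ hM hR 1)
  let ρ : ℕ → ContDiffBump (0 : ℂ) := fun n =>
    ⟨1 / (2 * ((n : ℝ) + 1)), 1 / ((n : ℝ) + 1), by positivity, by
      apply one_div_lt_one_div_of_lt <;> [positivity; linarith [(Nat.cast_nonneg n : (0 : ℝ) ≤ n)]]⟩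
  have hρ1 : ∀ n, (ρ n).rOut ≤ 1 := fun n => by
    simp only [ρ]
    rw [div_le_one (by positivity)]
    linarith [(Nat.cast_nonneg n : (0 : ℝ) ≤ n)]
  have hsupp : ∀ n x, R + 1 < ‖x‖ →
      (convolution ((ρ n).normed volume) χ (ContinuousLinearMap.lsmul ℝ ℝ) volume) x = 0 := by
    intro n x hx
    rw [convolution_def]
    refine integral_eq_zero_of_ae (ae_of_all _ fun t => ?_)
    simp only [ContinuousLinearMap.lsmul_apply, Pi.zero_apply]
    by_cases ht : t ∈ Function.support ((ρ n).normed volume)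
    · rw [ContDiffBump.support_normed_eq, mem_ball_zero_iff] at ht
      rw [hR, smul_zero]
      have := norm_sub_norm_le x t
      linarith [hρ1 n]
    · rw [Function.notMem_support.1 ht, zero_smul]
  refine ⟨fun n => convolution ((ρ n).normed volume) χ (ContinuousLinearMap.lsmul ℝ ℝ) volume,
    fun n => ⟨?_, ?_⟩, fun n x => ?_, hsupp, ?_⟩
  · exact HasCompactSupport.contDiff_convolution_left _ (ρ n).hasCompactSupport_normed
      (ρ n).contDiff_normed hχi.locallyIntegrable
  · refine HasCompactSupport.intro (isCompact_closedBall (0 : ℂ) (R + 1)) fun x hx => hsupp n x ?_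
    rwa [mem_closedBall_zero_iff, not_le] at hx
  · simp only [convolution_def]
    have h1 : Integrable (fun t => (ρ n).normed volume t * M) volume :=
      ((ρ n).integrable_normed).mul_const M
    refine (norm_integral_le_of_norm_le h1 (ae_of_all _ fun t => ?_)).trans_eq ?_
    · simp only [ContinuousLinearMap.lsmul_apply]
      rw [norm_smul, Real.norm_of_nonneg ((ρ n).nonneg_normed t)]
      exact mul_le_mul_of_nonneg_left (hM _) ((ρ n).nonneg_normed t)
    · rw [integral_mul_const, (ρ n).integral_normed, one_mul]
  · refine ContDiffBump.ae_convolution_tendsto_right_of_locallyIntegrable (K := 2) ?_ ?_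
      hχi.locallyIntegrable
    · exact tendsto_one_div_add_atTop_nhds_zero_nat
    · refine Eventually.of_forall fun n => le_of_eq ?_
      simp only [ρ]
      field_simp

lemma tendsto_eLpNorm_of_dominated {p : ℝ≥0∞} (hp0 : p ≠ 0) (hp : p ≠ ∞) {F : ℕ → ℂ → ℝ}
    {f G : ℂ → ℝ} (hF : ∀ n, AEStronglyMeasurable (F n) volume) (hG : MemLp G p volume)
    (hle : ∀ n x, ‖F n x‖ ≤ ‖G x‖) (hlim : ∀ᵐ x, Tendsto (fun n => F n x) atTop (𝓝 (f x))) :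
    Tendsto (fun n => eLpNorm (F n) p volume) atTop (𝓝 (eLpNorm f p volume)) := by
  simp only [eLpNorm_eq_lintegral_rpow_enorm_toReal hp0 hp]
  refine (ENNReal.continuous_rpow_const.tendsto _).comp ?_
  refine tendsto_lintegral_of_dominated_convergence' (fun x => ‖G x‖ₑ ^ p.toReal)
    (fun n => (hF n).enorm.pow_const _) (fun n => ae_of_all _ fun x => ?_) ?_ ?_
  · exact ENNReal.rpow_le_rpow (enorm_le_iff_norm_le.2 (hle n x)) ENNReal.toReal_nonneg
  · exact (lintegral_rpow_enorm_lt_top_of_eLpNorm_lt_top hp0 hp hG.2).ne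
  · filter_upwards [hlim] with x hx
    exact (ENNReal.continuous_rpow_const.tendsto _).comp
      ((continuous_enorm.tendsto _).comp hx)

lemma tendsto_integral_mul_of_bounded {b : ℂ → ℂ} (hb : LocallyIntegrable b volume)
    {χn : ℕ → ℂ → ℂ} {χ : ℂ → ℂ} {M R : ℝ} (hm : ∀ n, AEStronglyMeasurable (χn n) volume)
    (hM : ∀ n x, ‖χn n x‖ ≤ M) (hR : ∀ n x, R < ‖x‖ → χn n x = 0)
    (hlim : ∀ᵐ x, Tendsto (fun n => χn n x) atTop (𝓝 (χ x))) :
    Tendsto (fun n => ∫ x, b x * χn n x) atTop (𝓝 (∫ x, b x * χ x)) := by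
  have hi : IntegrableOn (fun x => ‖b x‖ * M) (Metric.closedBall 0 R) volume :=
    Integrable.mul_const (hb.integrableOn_isCompact (isCompact_closedBall 0 R)).norm M
  refine tendsto_integral_of_dominated_convergence _
    (fun n => hb.aestronglyMeasurable.mul (hm n))
    (hi.integrable_indicator Metric.isClosed_closedBall.measurableSet)
    (fun n => ae_of_all _ fun x => ?_) ?_
  · by_cases hx : x ∈ Metric.closedBall (0 : ℂ) R
    · rw [Set.indicator_of_mem hx, norm_mul]
      gcongr
      exact hM n x
    · rw [Set.indicator_of_notMem hx, hR n x (by simpa using hx)]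
      simp
  · filter_upwards [hlim] with x hx using hx.const_mul _

/-- `commForm_moments` with the monomials normalized to a square of side `ℓ`. -/
lemma commForm_moments_scaled {b χ ψ : ℂ → ℂ} (hb : LocallyIntegrable b volume)
    (hχ : IsTestFunction χ) (hψ : IsTestFunction ψ) (w : ℂ) {ℓ : ℝ} (hℓ : 0 < ℓ) :
    ((∫ z, b z * ψ z) * (∫ y, χ y) - (∫ z, b z * χ z) * (∫ y, ψ y)) / (ℓ : ℂ) ^ 2 =
      -(Real.pi : ℂ) * (commForm b χ (fun z => ((z - w) / ℓ) ^ 2 * ψ z)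
        - 2 * commForm b (fun y => (y - w) / ℓ * χ y) (fun z => (z - w) / ℓ * ψ z)
        + commForm b (fun y => ((y - w) / ℓ) ^ 2 * χ y) ψ) := by
  have hℓ' : (ℓ : ℂ) ≠ 0 := by exact_mod_cast hℓ.ne'
  have e2 : ∀ g : ℂ → ℂ, (fun z => ((z - w) / ℓ) ^ 2 * g z) =
      fun z => ((ℓ : ℂ) ^ 2)⁻¹ * ((z - w) ^ 2 * g z) := fun g => by
    funext z; field_simp
  have e1 : ∀ g : ℂ → ℂ, (fun z => (z - w) / ℓ * g z) =
      fun z => (ℓ : ℂ)⁻¹ * ((z - w) * g z) := fun g => by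
    funext z; field_simp
  rw [commForm_moments hb hχ hψ w, e1, e1, e2, e2, commForm_const_mul_left,
    commForm_const_mul_left, commForm_const_mul_right, commForm_const_mul_right]
  field_simp

/-- A weight dominating the normalized monomials of degree at most two. -/
noncomputable def wt (Q : ℂ × ℝ) (x : ℂ) : ℝ := (1 + ‖x - Q.1‖ / Q.2) ^ 2

lemma one_le_wt {Q : ℂ × ℝ} (hQ : 0 < Q.2) (x : ℂ) : 1 ≤ wt Q x := by
  have : 0 ≤ ‖x - Q.1‖ / Q.2 := by positivity
  rw [wt]; nlinarith

lemma norm_div_le_wt {Q : ℂ × ℝ} (hQ : 0 < Q.2) (x : ℂ) : ‖(x - Q.1) / (Q.2 : ℂ)‖ ≤ wt Q x := by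
  have : 0 ≤ ‖x - Q.1‖ / Q.2 := by positivity
  rw [norm_div, Complex.norm_real, Real.norm_of_nonneg hQ.le, wt]; nlinarith

lemma norm_div_sq_le_wt {Q : ℂ × ℝ} (hQ : 0 < Q.2) (x : ℂ) :
    ‖((x - Q.1) / (Q.2 : ℂ)) ^ 2‖ ≤ wt Q x := by
  have : 0 ≤ ‖x - Q.1‖ / Q.2 := by positivity
  rw [norm_pow, norm_div, Complex.norm_real, Real.norm_of_nonneg hQ.le, wt]; nlinarith

lemma wt_le_of_mem_box {Q : ℂ × ℝ} (hQ : 0 < Q.2) {x : ℂ} (hx : x ∈ box Q) : wt Q x ≤ 9 := by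
  have h1 := norm_sub_le_of_mem_box hx (corner_mem_box hQ)
  have h2 : ‖x - Q.1‖ / Q.2 ≤ 2 := by rwa [div_le_iff₀ hQ]
  have : 0 ≤ ‖x - Q.1‖ / Q.2 := by positivity
  rw [wt]; nlinarith

/-- The estimate for a finite sum of oscillations of `b`, for smooth functions. -/
lemma enorm_sum_oscillation_le_of_isTestFunction {b : ℂ → ℂ} (hb : LocallyIntegrable b volume)
    {p q q' : ℝ≥0∞} [q.HolderConjugate q'] {C : ℝ≥0} (hC : BeurlingCommutatorBound b p q C)
    {ι : Type*} (I : Finset ι) {Q : ι → ℂ × ℝ} (hQ : ∀ i ∈ I, 0 < (Q i).2) {χ ψ : ι → ℂ → ℂ}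
    (hχ : ∀ i ∈ I, IsTestFunction (χ i)) (hψ : ∀ i ∈ I, IsTestFunction (ψ i)) :
    ‖∑ i ∈ I, ((∫ z, b z * ψ i z) * (∫ y, χ i y) - (∫ z, b z * χ i z) * (∫ y, ψ i y)) /
      ((Q i).2 : ℂ) ^ 2‖ₑ ≤ 16 * (C * eLpNorm (fun x => ∑ i ∈ I, wt (Q i) x * ‖χ i x‖) p volume *
        eLpNorm (fun x => ∑ i ∈ I, wt (Q i) x * ‖ψ i x‖) q' volume) := by
  set D := C * eLpNorm (fun x => ∑ i ∈ I, wt (Q i) x * ‖χ i x‖) p volume *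
        eLpNorm (fun x => ∑ i ∈ I, wt (Q i) x * ‖ψ i x‖) q' volume with hD
  have key : ∀ m m' : ι → ℂ → ℂ, (∀ i, ContDiff ℝ (⊤ : ℕ∞) (m i)) →
      (∀ i, ContDiff ℝ (⊤ : ℕ∞) (m' i)) → (∀ i ∈ I, ∀ x, ‖m i x‖ ≤ wt (Q i) x) →
      (∀ i ∈ I, ∀ x, ‖m' i x‖ ≤ wt (Q i) x) →
      ‖∑ i ∈ I, commForm b (fun y => m i y * χ i y) (fun y => m' i y * ψ i y)‖ₑ ≤ D := by
    intro m m' hm hm' hmw hmw'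
    refine (enorm_sum_commForm_le (q' := q') hb hC I (fun i hi => (hχ i hi).mul_left (hm i))
      (fun i hi => (hψ i hi).mul_left (hm' i))).trans ?_
    have hmono : ∀ (m χ : ι → ℂ → ℂ) (t : ℝ≥0∞), (∀ i ∈ I, ∀ x, ‖m i x‖ ≤ wt (Q i) x) →
        eLpNorm (fun x => ∑ i ∈ I, ‖m i x * χ i x‖) t volume ≤
          eLpNorm (fun x => ∑ i ∈ I, wt (Q i) x * ‖χ i x‖) t volume := by
      intro m χ t hmw
      refine eLpNorm_mono_real fun x => ?_
      rw [Real.norm_of_nonneg (Finset.sum_nonneg fun i _ => norm_nonneg _)]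
      refine Finset.sum_le_sum fun i hi => ?_
      rw [norm_mul]
      gcongr
      exact hmw i hi x
    rw [hD]
    gcongr
    · exact hmono m χ p hmw
    · exact hmono m' ψ q' hmw'
  have k0 := key (fun _ _ => 1) (fun i z => ((z - (Q i).1) / ((Q i).2 : ℂ)) ^ 2)
    (fun i => by fun_prop) (fun i => by fun_prop)
    (fun i hi x => by simpa using one_le_wt (hQ i hi) x)
    (fun i hi x => norm_div_sq_le_wt (hQ i hi) x)
  have k1 := key (fun i z => (z - (Q i).1) / ((Q i).2 : ℂ))
    (fun i z => (z - (Q i).1) / ((Q i).2 : ℂ))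
    (fun i => by fun_prop) (fun i => by fun_prop)
    (fun i hi x => norm_div_le_wt (hQ i hi) x) (fun i hi x => norm_div_le_wt (hQ i hi) x)
  have k2 := key (fun i z => ((z - (Q i).1) / ((Q i).2 : ℂ)) ^ 2) (fun _ _ => 1)
    (fun i => by fun_prop) (fun i => by fun_prop)
    (fun i hi x => norm_div_sq_le_wt (hQ i hi) x)
    (fun i hi x => by simpa using one_le_wt (hQ i hi) x)
  simp only [one_mul] at k0 k2
  rw [Finset.sum_congr rfl fun i hi =>
    commForm_moments_scaled hb (hχ i hi) (hψ i hi) (Q i).1 (hQ i hi), ← Finset.mul_sum,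
    Finset.sum_add_distrib, Finset.sum_sub_distrib, ← Finset.mul_sum, enorm_mul]
  have hpi : ‖-(Real.pi : ℂ)‖ₑ ≤ 4 := by
    rw [enorm_neg, ← ofReal_norm, Complex.norm_real, Real.norm_of_nonneg Real.pi_pos.le,
      show (4 : ℝ≥0∞) = ENNReal.ofReal 4 by simp]
    exact ENNReal.ofReal_le_ofReal Real.pi_le_four
  have h2 : ‖(2 : ℂ)‖ₑ = 2 := by
    rw [← ofReal_norm]; simp
  calc _ ≤ 4 * ((D + 2 * D) + D) := by
        gcongr
        refine (enorm_add_le _ _).trans (add_le_add ((enorm_sub_le).trans (add_le_add k0 ?_)) k2)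
        rw [enorm_mul, h2]
        gcongr
    _ = 16 * D := by ring

lemma memLp_sum_indicator {ι : Type*} (I : Finset ι) {S : ι → Set ℂ}
    (hS : ∀ i, MeasurableSet (S i)) (hS' : ∀ i, volume (S i) ≠ ∞) (a : ι → ℝ) (t : ℝ≥0∞) :
    MemLp (fun x => ∑ i ∈ I, (S i).indicator (fun _ => a i) x) t volume := by
  refine memLp_finsetSum (f := fun i x => (S i).indicator (fun _ => a i) x) _ fun i _ => ?_
  exact memLp_indicator_const t (hS i) (a i) (Or.inr (hS' i))

lemma eLpNorm_wt_sum_le {ι : Type*} (I : Finset ι) {Q : ι → ℂ × ℝ} (hQ : ∀ i ∈ I, 0 < (Q i).2)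
    {χ : ι → ℂ → ℂ} {a : ι → ℝ}
    (hχ : ∀ i ∈ I, ∀ x, ‖χ i x‖ ≤ (box (Q i)).indicator (fun _ => a i) x) (t : ℝ≥0∞) :
    eLpNorm (fun x => ∑ i ∈ I, wt (Q i) x * ‖χ i x‖) t volume ≤
        9 * eLpNorm (fun x => ∑ i ∈ I, (box (Q i)).indicator (fun _ => a i) x) t volume := by
  have h : ∀ x, ‖∑ i ∈ I, wt (Q i) x * ‖χ i x‖‖ ≤
      9 * ‖∑ i ∈ I, (box (Q i)).indicator (fun _ => a i) x‖ := fun x => by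
    rw [Real.norm_of_nonneg (Finset.sum_nonneg fun i _ => by rw [wt]; positivity)]
    refine le_trans ?_ (mul_le_mul_of_nonneg_left (le_abs_self _) (by norm_num))
    rw [Finset.mul_sum]
    refine Finset.sum_le_sum fun i hi => ?_
    by_cases hx : x ∈ box (Q i)
    · have := hχ i hi x
      rw [Set.indicator_of_mem hx] at this ⊢
      have := wt_le_of_mem_box (hQ i hi) hx
      gcongr
    · have := hχ i hi x
      rw [Set.indicator_of_notMem hx] at this ⊢
      rw [norm_le_zero_iff.1 this]; simp
  have := eLpNorm_le_mul_eLpNorm_of_ae_le_mul (μ := volume) (ae_of_all _ h) t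
  simpa using this

lemma tendsto_eLpNorm_wt_sum {ι : Type*} (I : Finset ι) {Q : ι → ℂ × ℝ}
    (hQ : ∀ i ∈ I, 0 < (Q i).2) {χ : ι → ℂ → ℂ} {χn : ι → ℕ → ℂ → ℂ} {a R : ι → ℝ} {t : ℝ≥0∞}
    (ht0 : t ≠ 0) (ht : t ≠ ∞) (h1 : ∀ i ∈ I, ∀ n, IsTestFunction (χn i n))
    (h2 : ∀ i ∈ I, ∀ n x, ‖χn i n x‖ ≤ a i)
    (h3 : ∀ i ∈ I, ∀ n x, R i < ‖x‖ → χn i n x = 0)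
    (h4 : ∀ i ∈ I, ∀ᵐ x ∂volume, Tendsto (fun n => χn i n x) atTop (𝓝 (χ i x))) :
    Tendsto (fun n => eLpNorm (fun x => ∑ i ∈ I, wt (Q i) x * ‖χn i n x‖) t volume) atTop
        (𝓝 (eLpNorm (fun x => ∑ i ∈ I, wt (Q i) x * ‖χ i x‖) t volume)) := by
  refine tendsto_eLpNorm_of_dominated ht0 ht (fun n => ?_)
    (memLp_sum_indicator I (S := fun i => Metric.closedBall (0 : ℂ) (R i))
      (fun i => Metric.isClosed_closedBall.measurableSet) (fun i => measure_closedBall_lt_top.ne)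
      (fun i => (1 + (R i + ‖(Q i).1‖) / (Q i).2) ^ 2 * a i) t) (fun n x => ?_) ?_
  · refine (continuous_finsetSum _ fun i hi => ?_).aestronglyMeasurable
    have := (h1 i hi n).continuous
    simp only [wt]
    fun_prop
  · rw [Real.norm_of_nonneg (Finset.sum_nonneg fun i _ => by rw [wt]; positivity)]
    refine le_trans (Finset.sum_le_sum fun i hi => ?_) (le_abs_self _)
    by_cases hx : x ∈ Metric.closedBall (0 : ℂ) (R i)
    · rw [Set.indicator_of_mem hx, wt]
      rw [mem_closedBall_zero_iff] at hx
      have hQi := hQ i hi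
      gcongr
      · exact (norm_sub_le _ _).trans (by gcongr)
      · exact h2 i hi n x
    · rw [Set.indicator_of_notMem hx, h3 i hi n x (by simpa using hx)]
      simp
  · filter_upwards [(ae_ball_iff I.countable_toSet).2 h4] with x hx
    exact tendsto_finsetSum _ fun i hi => (hx i hi).norm.const_mul _

/-- The estimate for a finite sum of oscillations of `b`, for bounded functions carried by
squares. -/
lemma enorm_sum_oscillation_le {b : ℂ → ℂ} (hb : LocallyIntegrable b volume)
    {p q q' : ℝ≥0∞} [q.HolderConjugate q'] (hp0 : p ≠ 0) (hp : p ≠ ∞) (hq' : q' ≠ ∞) {C : ℝ≥0}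
    (hC : BeurlingCommutatorBound b p q C)
    {ι : Type*} (I : Finset ι) {Q : ι → ℂ × ℝ} (hQ : ∀ i ∈ I, 0 < (Q i).2) {χ ψ : ι → ℂ → ℂ}
    {a c : ι → ℝ} (hχm : ∀ i ∈ I, AEStronglyMeasurable (χ i) volume)
    (hψm : ∀ i ∈ I, AEStronglyMeasurable (ψ i) volume)
    (hχ : ∀ i ∈ I, ∀ x, ‖χ i x‖ ≤ (box (Q i)).indicator (fun _ => a i) x)
    (hψ : ∀ i ∈ I, ∀ x, ‖ψ i x‖ ≤ (box (Q i)).indicator (fun _ => c i) x) :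
    ‖∑ i ∈ I, ((∫ z, b z * ψ i z) * (∫ y, χ i y) - (∫ z, b z * χ i z) * (∫ y, ψ i y)) /
      ((Q i).2 : ℂ) ^ 2‖ₑ ≤ 1296 * (C *
        eLpNorm (fun x => ∑ i ∈ I, (box (Q i)).indicator (fun _ => a i) x) p volume *
        eLpNorm (fun x => ∑ i ∈ I, (box (Q i)).indicator (fun _ => c i) x) q' volume) := by
  have hq'0 : q' ≠ 0 := ENNReal.HolderConjugate.ne_zero q' q
  set R : ι → ℝ := fun i => ‖(Q i).1‖ + 2 * (Q i).2 with hRdef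
  have hR : ∀ i ∈ I, ∀ x, R i < ‖x‖ → x ∉ box (Q i) := by
    intro i hi x hx hmem
    have := norm_sub_le_of_mem_box hmem (corner_mem_box (hQ i hi))
    have := norm_sub_norm_le x (Q i).1
    simp only [hRdef] at hx
    linarith
  have moll : ∀ (χ : ι → ℂ → ℂ) (a : ι → ℝ), (∀ i ∈ I, AEStronglyMeasurable (χ i) volume) →
      (∀ i ∈ I, ∀ x, ‖χ i x‖ ≤ (box (Q i)).indicator (fun _ => a i) x) → ∀ i ∈ I,
      ∃ χn : ℕ → ℂ → ℂ, (∀ n, IsTestFunction (χn n)) ∧ (∀ n x, ‖χn n x‖ ≤ a i) ∧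
      (∀ n x, R i + 1 < ‖x‖ → χn n x = 0) ∧
      ∀ᵐ x ∂volume, Tendsto (fun n => χn n x) atTop (𝓝 (χ i x)) := by
    intro χ a hm hle i hi
    have ha : 0 ≤ a i := by
      have := (norm_nonneg _).trans (hle i hi (Q i).1)
      rwa [Set.indicator_of_mem (corner_mem_box (hQ i hi))] at this
    refine exists_mollification (hm i hi) (fun x => (hle i hi x).trans
      (Set.indicator_le_self' (fun _ _ => ha) x)) fun x hx => ?_
    have := hle i hi x
    rwa [Set.indicator_of_notMem (hR i hi x hx), norm_le_zero_iff] at this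
  choose! χn hχn1 hχn2 hχn3 hχn4 using moll χ a hχm hχ
  choose! ψn hψn1 hψn2 hψn3 hψn4 using moll ψ c hψm hψ
  have A1 := tendsto_eLpNorm_wt_sum I hQ hp0 hp hχn1 hχn2 hχn3 hχn4
  have A2 := eLpNorm_wt_sum_le I hQ hχ p
  have A3 := (memLp_sum_indicator I (fun i => measurableSet_box (Q i))
    (fun i => volume_box_ne_top (Q i)) a p).2.ne
  have B1 := tendsto_eLpNorm_wt_sum I hQ hq'0 hq' hψn1 hψn2 hψn3 hψn4
  have B2 := eLpNorm_wt_sum_le I hQ hψ q'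
  have B3 := (memLp_sum_indicator I (fun i => measurableSet_box (Q i))
    (fun i => volume_box_ne_top (Q i)) c q').2.ne
  have hone : LocallyIntegrable (fun _ : ℂ => (1 : ℂ)) volume := continuous_const.locallyIntegrable
  have L1 : ∀ i ∈ I, Tendsto (fun n => ∫ z, b z * ψn i n z) atTop (𝓝 (∫ z, b z * ψ i z)) :=
    fun i hi => tendsto_integral_mul_of_bounded hb
      (fun n => (hψn1 i hi n).continuous.aestronglyMeasurable) (hψn2 i hi) (hψn3 i hi) (hψn4 i hi)
  have L2 : ∀ i ∈ I, Tendsto (fun n => ∫ z, b z * χn i n z) atTop (𝓝 (∫ z, b z * χ i z)) :=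
    fun i hi => tendsto_integral_mul_of_bounded hb
      (fun n => (hχn1 i hi n).continuous.aestronglyMeasurable) (hχn2 i hi) (hχn3 i hi) (hχn4 i hi)
  have L3 : ∀ i ∈ I, Tendsto (fun n => ∫ z, ψn i n z) atTop (𝓝 (∫ z, ψ i z)) := fun i hi => by
    simpa using tendsto_integral_mul_of_bounded hone
      (fun n => (hψn1 i hi n).continuous.aestronglyMeasurable) (hψn2 i hi) (hψn3 i hi) (hψn4 i hi)
  have L4 : ∀ i ∈ I, Tendsto (fun n => ∫ z, χn i n z) atTop (𝓝 (∫ z, χ i z)) := fun i hi => by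
    simpa using tendsto_integral_mul_of_bounded hone
      (fun n => (hχn1 i hi n).continuous.aestronglyMeasurable) (hχn2 i hi) (hχn3 i hi) (hχn4 i hi)
  have L := (continuous_enorm.tendsto _).comp (tendsto_finsetSum I fun i hi =>
    (((L1 i hi).mul (L4 i hi)).sub ((L2 i hi).mul (L3 i hi))).div_const (((Q i).2 : ℂ) ^ 2))
  have A3' := ENNReal.mul_ne_top (by simp : (9 : ℝ≥0∞) ≠ ∞) A3
  have B3' := ENNReal.mul_ne_top (by simp : (9 : ℝ≥0∞) ≠ ∞) B3
  have hA := ne_top_of_le_ne_top A3' A2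
  have hB := ne_top_of_le_ne_top B3' B2
  have U := ENNReal.Tendsto.const_mul (a := 16) (ENNReal.Tendsto.mul
    (ENNReal.Tendsto.const_mul (a := (C : ℝ≥0∞)) A1 (Or.inr (by simp)))
    (Or.inr hB) B1 (Or.inr (by finiteness))) (Or.inr (by simp))
  refine (le_of_tendsto_of_tendsto' L U fun n => ?_).trans ?_
  · exact enorm_sum_oscillation_le_of_isTestFunction hb hC I hQ (fun i hi => hχn1 i hi n)
      (fun i hi => hψn1 i hi n)
  · refine (mul_le_mul_right (mul_le_mul' (mul_le_mul_right A2 _) B2) _).trans_eq ?_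
    ring

/-! ### Atomic decomposition -/

lemma sum_pow_le {a : ℝ} (ha : 1 < a) {J : Finset ℕ} {M : ℕ} (hM : ∀ j ∈ J, j ≤ M) :
    ∑ j ∈ J, a ^ j ≤ a / (a - 1) * a ^ M := by
  have h1 : ∑ j ∈ J, a ^ j ≤ ∑ j ∈ Finset.range (M + 1), a ^ j :=
    Finset.sum_le_sum_of_subset_of_nonneg
      (fun j hj => Finset.mem_range.2 (Nat.lt_succ_of_le (hM j hj))) fun _ _ _ => by positivity
  have h2 : 0 < a - 1 := by linarith
  rw [geom_sum_eq ha.ne'] at h1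
  refine h1.trans ?_
  rw [div_mul_eq_mul_div]
  gcongr
  rw [pow_succ']; linarith

/-- A sum of distinct powers is comparable to its largest term, so that a power of the sum is
controlled by the sum of the powers. -/
lemma rpow_sum_pow_le {a t : ℝ} (ha : 1 < a) (ht : 0 < t) (J : Finset ℕ) :
    (∑ j ∈ J, a ^ j) ^ t ≤ (a / (a - 1)) ^ t * ∑ j ∈ J, (a ^ j) ^ t := by
  have h2 : 0 < a - 1 := by linarith
  rcases J.eq_empty_or_nonempty with rfl | hJ
  · simp [Real.zero_rpow ht.ne']
  · have h1 := sum_pow_le ha (J := J) (M := J.max' hJ) (fun j hj => Finset.le_max' J j hj)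
    calc _ ≤ (a / (a - 1) * a ^ (J.max' hJ)) ^ t :=
          Real.rpow_le_rpow (Finset.sum_nonneg fun _ _ => by positivity) h1 ht.le
      _ = (a / (a - 1)) ^ t * (a ^ (J.max' hJ)) ^ t := Real.mul_rpow (by positivity) (by positivity)
      _ ≤ _ := by
        gcongr
        exact Finset.single_le_sum (f := fun j => (a ^ j) ^ t) (fun _ _ => by positivity)
          (J.max'_mem hJ)

lemma rpow_pow_mul (a : ℝ) (ha : 0 < a) {c : ℝ} (hc : 0 ≤ c) (t : ℝ) (j : ℕ) :
    (a ^ j * c) ^ t = (a ^ t) ^ j * c ^ t := by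
  rw [Real.mul_rpow (by positivity) hc, ← Real.rpow_natCast, ← Real.rpow_natCast,
    ← Real.rpow_mul ha.le, ← Real.rpow_mul ha.le, mul_comm t]

/-- Iterating the stopping time at the levels `4 ^ j * lam`. `F j` is the family of squares of
generation `j` and `G j Q` consists of those squares of generation `j + 1` that lie in `Q`. -/
lemma exists_stopping_tree {f : ℂ → ℂ} (hf : Continuous f) (hfc : HasCompactSupport f) {lam : ℝ}
    (hlam : 0 < lam) {Q₀ : ℂ × ℝ} (hQ₀ : 0 < Q₀.2)
    (hle : ∫ x in box Q₀, ‖f x‖ ≤ lam * Q₀.2 ^ 2) :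
    ∃ (F : ℕ → Finset (ℂ × ℝ)) (G : ℕ → ℂ × ℝ → Finset (ℂ × ℝ)) (J : ℕ),
      F 0 = {Q₀} ∧ F J = ∅ ∧
      (∀ j (g : ℂ × ℝ → ℂ), ∑ P ∈ F (j + 1), g P = ∑ Q ∈ F j, ∑ P ∈ G j Q, g P) ∧
      (∀ j, ∀ Q ∈ F j, 0 < Q.2 ∧ ∫ x in box Q, ‖f x‖ ≤ 4 ^ j * lam * Q.2 ^ 2) ∧
      (∀ j, ∀ Q ∈ F (j + 1), 4 ^ j * lam * Q.2 ^ 2 < ∫ x in box Q, ‖f x‖) ∧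
      (∀ j, (F j : Set (ℂ × ℝ)).PairwiseDisjoint box) ∧
      ∀ j, ∀ Q ∈ F j, IsStoppingFamily (fun x => ‖f x‖) (4 ^ j * lam) Q (G j Q) ∧
        ∀ x ∈ box Q, (∀ P ∈ G j Q, x ∉ box P) → ‖f x‖ ≤ 2 * (4 ^ j * lam) := by
  classical
  have ex : ∀ (j : ℕ) (Q : ℂ × ℝ), ∃ F : Finset (ℂ × ℝ),
      (0 < Q.2 ∧ ∫ x in box Q, ‖f x‖ ≤ 4 ^ j * lam * Q.2 ^ 2) →
      IsStoppingFamily (fun x => ‖f x‖) (4 ^ j * lam) Q F ∧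
        ∀ x ∈ box Q, (∀ P ∈ F, x ∉ box P) → ‖f x‖ ≤ 2 * (4 ^ j * lam) := by
    intro j Q
    by_cases h : 0 < Q.2 ∧ ∫ x in box Q, ‖f x‖ ≤ 4 ^ j * lam * Q.2 ^ 2
    · obtain ⟨F, hF⟩ := exists_stoppingFamily_of_continuous hf hfc
        (by positivity : 0 < 4 ^ j * lam) h.1 h.2
      exact ⟨F, fun _ => hF⟩
    · exact ⟨∅, fun h' => absurd h' h⟩
  choose G hG using ex
  obtain ⟨F, hF0, hFs⟩ : ∃ F : ℕ → Finset (ℂ × ℝ), F 0 = {Q₀} ∧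
      ∀ j, F (j + 1) = (F j).biUnion (G j) :=
    ⟨fun n => Nat.rec {Q₀} (fun j Fj => Fj.biUnion (G j)) n, rfl, fun _ => rfl⟩
  have h1 : ∀ j, ∀ Q ∈ F j, 0 < Q.2 ∧ ∫ x in box Q, ‖f x‖ ≤ 4 ^ j * lam * Q.2 ^ 2 := by
    intro j
    induction j with
    | zero => intro Q hQ; rw [hF0] at hQ; rw [Finset.mem_singleton.1 hQ]; simpa using ⟨hQ₀, hle⟩
    | succ j ih =>
      intro P hP
      rw [hFs] at hP
      obtain ⟨Q, hQ, hPQ⟩ := Finset.mem_biUnion.1 hP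
      have h := (hG j Q (ih Q hQ)).1
      refine ⟨h.pos P hPQ, (h.integral_le P hPQ).trans_eq ?_⟩
      rw [pow_succ']; ring
  have h2 : ∀ j, ∀ Q ∈ F (j + 1), 4 ^ j * lam * Q.2 ^ 2 < ∫ x in box Q, ‖f x‖ := by
    intro j P hP
    rw [hFs] at hP
    obtain ⟨Q, hQ, hPQ⟩ := Finset.mem_biUnion.1 hP
    exact (hG j Q (h1 j Q hQ)).1.lt_integral P hPQ
  have h3 : ∀ j, (F j : Set (ℂ × ℝ)).PairwiseDisjoint box := by
    intro j
    induction j with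
    | zero =>
      rw [hF0]; simp
    | succ j ih =>
      intro P hP P' hP' hne
      rw [hFs] at hP hP'
      obtain ⟨Q, hQ, hPQ⟩ := Finset.mem_biUnion.1 (Finset.mem_coe.1 hP)
      obtain ⟨Q', hQ', hPQ'⟩ := Finset.mem_biUnion.1 (Finset.mem_coe.1 hP')
      have g := (hG j Q (h1 j Q hQ)).1
      have g' := (hG j Q' (h1 j Q' hQ')).1
      rcases eq_or_ne Q Q' with rfl | hQQ
      · exact g.disjoint hPQ hPQ' hne
      · exact (ih hQ hQ' hQQ).mono (g.subset P hPQ) (g'.subset P' hPQ')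
  obtain ⟨M, hM⟩ := hfc.exists_bound_of_continuous hf
  obtain ⟨J, hJ⟩ := pow_unbounded_of_one_lt (M / lam) (by norm_num : (1 : ℝ) < 4)
  refine ⟨F, G, J + 1, hF0, ?_, fun j g => ?_, h1, h2, h3, fun j Q hQ => hG j Q (h1 j Q hQ)⟩
  · refine Finset.eq_empty_of_forall_notMem fun P hP => ?_
    have hP0 := (h1 _ P hP).1
    have := h2 J P hP
    have h4 : ∫ x in box P, ‖f x‖ ≤ ∫ x in box P, M :=
      setIntegral_mono (integrableOn_box hf P).norm (integrableOn_const (volume_box_ne_top P)) hM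
    rw [setIntegral_const, volume_real_box hP0, smul_eq_mul] at h4
    rw [div_lt_iff₀ hlam] at hJ
    have h5 : P.2 ^ 2 * M < P.2 ^ 2 * (4 ^ J * lam) := by gcongr
    linarith
  · rw [hFs, Finset.sum_biUnion]
    intro Q hQ Q' hQ' hne
    rw [Function.onFun, Finset.disjoint_left]
    intro P hP hP'
    have g := (hG j Q (h1 j Q hQ)).1
    have g' := (hG j Q' (h1 j Q' hQ')).1
    have hd := (h3 j hQ hQ' hne).mono (g.subset P hP) (g'.subset P hP')
    exact Set.disjoint_left.1 hd (corner_mem_box (g.pos P hP)) (corner_mem_box (g.pos P hP))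

/-- The total area of the stopping squares, weighted by the `s`-th powers of their levels. By
Chebyshev's inequality, level `j` contributes only where `4 ^ j * lam < 2 * ‖f‖`, and over these
levels the geometric sum is comparable to its largest term. -/
lemma sum_levels_le {f : ℂ → ℂ} (hf : Continuous f) (hfc : HasCompactSupport f) {lam s : ℝ}
    (hlam : 0 < lam) (hs : 1 < s) {F : ℕ → Finset (ℂ × ℝ)} (J : ℕ)
    (hpos : ∀ j, ∀ P ∈ F j, 0 < P.2)
    (hlt : ∀ j, ∀ P ∈ F j, 4 ^ j * lam * P.2 ^ 2 < ∫ x in box P, ‖f x‖)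
    (hdisj : ∀ j, (F j : Set (ℂ × ℝ)).PairwiseDisjoint box) :
    ∑ j ∈ Finset.range J, (4 ^ j * lam) ^ s * ∑ P ∈ F j, P.2 ^ 2 ≤
      2 ^ s * (4 ^ (s - 1) / (4 ^ (s - 1) - 1)) * ∫ x, ‖f x‖ ^ s := by
  have hfi : Integrable f volume := hf.integrable_of_hasCompactSupport hfc
  have hfs : Integrable (fun x => ‖f x‖ ^ s) volume := by
    refine Continuous.integrable_of_hasCompactSupport ?_ ?_
    · exact hf.norm.rpow_const fun x => Or.inr (by linarith)
    · exact hfc.norm.comp_left (g := fun x : ℝ => x ^ s) (Real.zero_rpow (by linarith))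
  have ha : (1 : ℝ) < 4 ^ (s - 1) := Real.one_lt_rpow (by norm_num) (by linarith)
  have ha' : (0 : ℝ) < 4 ^ (s - 1) - 1 := by linarith
  set E : ℕ → Set ℂ := fun j => {x | 4 ^ j * lam / 2 < ‖f x‖}
  have hE : ∀ j, MeasurableSet (E j) := fun j =>
    measurableSet_lt measurable_const hf.norm.measurable
  have h1 : ∀ j ∈ Finset.range J, (4 ^ j * lam) ^ s * ∑ P ∈ F j, P.2 ^ 2 ≤
      ∫ x, 2 * (4 ^ j * lam) ^ (s - 1) * (E j).indicator (fun x => ‖f x‖) x := by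
    intro j _
    have hl : (0 : ℝ) < 4 ^ j * lam := by positivity
    rw [integral_const_mul, integral_indicator (hE j)]
    calc _ ≤ (4 ^ j * lam) ^ s * (2 / (4 ^ j * lam) * ∫ x in E j, ‖f x‖) := by
          gcongr
          exact IsStoppingFamily.sum_sq_le hf hfc hl (hpos j) (hlt j) (hdisj j)
      _ = _ := by
          rw [Real.rpow_sub_one hl.ne']; field_simp
  have hi : ∀ j ∈ Finset.range J, Integrable (fun x =>
      2 * (4 ^ j * lam) ^ (s - 1) * (E j).indicator (fun x => ‖f x‖) x) volume :=
    fun j _ => (hfi.norm.indicator (hE j)).const_mul _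
  refine (Finset.sum_le_sum h1).trans ?_
  rw [← integral_finsetSum _ hi, ← integral_const_mul]
  refine integral_mono (integrable_finsetSum _ hi) (hfs.const_mul _) fun x => ?_
  classical
  set K := (Finset.range J).filter fun j => x ∈ E j with hK
  have h2 : ∑ j ∈ Finset.range J, 2 * (4 ^ j * lam) ^ (s - 1) * (E j).indicator (fun x => ‖f x‖) x
      = 2 * ‖f x‖ * ∑ j ∈ K, (4 ^ j * lam) ^ (s - 1) := by
    rw [hK, Finset.sum_filter, Finset.mul_sum]
    refine Finset.sum_congr rfl fun j _ => ?_
    by_cases hx : x ∈ E j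
    · rw [Set.indicator_of_mem hx, if_pos hx]; ring
    · rw [Set.indicator_of_notMem hx, if_neg hx]; ring
  simp only
  rw [h2]
  rcases K.eq_empty_or_nonempty with h0 | hne
  · rw [h0]; simp only [Finset.sum_empty, mul_zero]; positivity
  · set M := K.max' hne
    have hM : 4 ^ M * lam / 2 < ‖f x‖ := (Finset.mem_filter.1 (K.max'_mem hne)).2
    have hfx : 0 < ‖f x‖ := lt_trans (by positivity) hM
    have h3 : ∑ j ∈ K, (4 ^ j * lam) ^ (s - 1) ≤
        4 ^ (s - 1) / (4 ^ (s - 1) - 1) * (2 * ‖f x‖) ^ (s - 1) := by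
      calc _ = (∑ j ∈ K, ((4 : ℝ) ^ (s - 1)) ^ j) * lam ^ (s - 1) := by
            rw [Finset.sum_mul]
            exact Finset.sum_congr rfl fun j _ => rpow_pow_mul 4 (by norm_num) hlam.le _ j
        _ ≤ (4 ^ (s - 1) / (4 ^ (s - 1) - 1) * ((4 : ℝ) ^ (s - 1)) ^ M) * lam ^ (s - 1) := by
            gcongr
            exact sum_pow_le ha fun j hj => Finset.le_max' K j hj
        _ = 4 ^ (s - 1) / (4 ^ (s - 1) - 1) * (4 ^ M * lam) ^ (s - 1) := by
            rw [rpow_pow_mul 4 (by norm_num) hlam.le, mul_assoc]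
        _ ≤ _ := by
            have hs' : 0 ≤ s - 1 := by linarith
            have hM' : 4 ^ M * lam ≤ 2 * ‖f x‖ := by linarith
            exact mul_le_mul_of_nonneg_left (Real.rpow_le_rpow (by positivity) hM' hs')
              (by positivity)
    calc _ ≤ 2 * ‖f x‖ * (4 ^ (s - 1) / (4 ^ (s - 1) - 1) * (2 * ‖f x‖) ^ (s - 1)) := by gcongr
      _ = 4 ^ (s - 1) / (4 ^ (s - 1) - 1) * (2 * ‖f x‖) ^ s := by
          have e : (2 * ‖f x‖) ^ s = 2 * ‖f x‖ * (2 * ‖f x‖) ^ (s - 1) := by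
            rw [Real.rpow_sub_one (by positivity)]; field_simp
          rw [e]; ring
      _ = _ := by rw [Real.mul_rpow (by norm_num) (norm_nonneg _)]; ring

/-- The index of an atom: the generation `i.1` of the stopping time and a square `i.2`. -/
abbrev AtomIndex : Type := (_ : ℕ) × (ℂ × ℝ)

/-- A decomposition of the mean-zero part of `f` on `Q₀` into finitely many mean-zero atoms `A i`,
of height `4 ^ i.1 * lam`, each living on a square. The squares of one generation are disjoint. -/
structure IsAtomicDecomposition (f : ℂ → ℂ) (Q₀ : ℂ × ℝ) (lam : ℝ) (I : Finset AtomIndex)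
    (A : AtomIndex → ℂ → ℂ) : Prop where
  pos : ∀ i ∈ I, 0 < i.2.2
  integrable : ∀ i ∈ I, Integrable (A i) volume
  integral_eq_zero : ∀ i ∈ I, ∫ x, A i x = 0
  norm_le : ∀ i ∈ I, ∀ x, ‖A i x‖ ≤ (box i.2).indicator (fun _ => 5 * (4 ^ i.1 * lam)) x
  osc_eq : ∀ x, osc f Q₀ x = ∑ i ∈ I, A i x
  disjoint : ∀ i ∈ I, ∀ k ∈ I, i.1 = k.1 → i ≠ k → Disjoint (box i.2) (box k.2)

/-- The atom of a square `Q` is the difference between the mean-zero part of `f` on `Q` and those on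
the stopping squares inside `Q`; these differences telescope. -/
lemma exists_isAtomicDecomposition {f : ℂ → ℂ} (hf : Continuous f) (hfc : HasCompactSupport f)
    {lam : ℝ} (hlam : 0 < lam) {Q₀ : ℂ × ℝ} (hQ₀ : 0 < Q₀.2)
    (hle : ∫ x in box Q₀, ‖f x‖ ≤ lam * Q₀.2 ^ 2) :
    ∃ I A, IsAtomicDecomposition f Q₀ lam I A ∧ ∀ s : ℝ, 1 < s →
      ∑ i ∈ I, (4 ^ i.1 * lam) ^ s * i.2.2 ^ 2 ≤ lam ^ s * Q₀.2 ^ 2 +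
        4 ^ s * (2 ^ s * (4 ^ (s - 1) / (4 ^ (s - 1) - 1))) * ∫ x, ‖f x‖ ^ s := by
  obtain ⟨F, G, J, hF0, hFJ, hFs, h1, h2, h3, h4⟩ := exists_stopping_tree hf hfc hlam hQ₀ hle
  refine ⟨(Finset.range J).sigma fun j => F j,
    fun i x => osc f i.2 x - ∑ P ∈ G i.1 i.2, osc f P x, ⟨?_, ?_, ?_, ?_, ?_, ?_⟩, ?_⟩
  · intro i hi
    exact (h1 _ _ (Finset.mem_sigma.1 hi).2).1
  · intro i hi
    exact (integrable_osc (integrableOn_box hf _)).sub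
      (integrable_finsetSum _ fun P _ => integrable_osc (integrableOn_box hf P))
  · intro i hi
    have hi' := (Finset.mem_sigma.1 hi).2
    rw [integral_sub (integrable_osc (integrableOn_box hf _))
      (integrable_finsetSum _ fun P _ => integrable_osc (integrableOn_box hf P)),
      integral_finsetSum _ (fun P _ => integrable_osc (integrableOn_box hf P)),
      integral_osc (h1 _ _ hi').1 (integrableOn_box hf _),
      Finset.sum_eq_zero fun P hP => integral_osc ((h4 _ _ hi').1.pos P hP) (integrableOn_box hf P),
      sub_zero]
  · rintro ⟨j, Q⟩ hi x
    have hi' : Q ∈ F j := (Finset.mem_sigma.1 hi).2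
    simp only
    have g := (h4 j Q hi').1
    have hl : (0 : ℝ) < 4 ^ j * lam := by positivity
    by_cases hx : x ∈ box Q
    · rw [Set.indicator_of_mem hx]
      have m1 := norm_mean_le (h1 j Q hi').1 (h1 j Q hi').2
      by_cases hP : ∃ P ∈ G j Q, x ∈ box P
      · obtain ⟨P, hP, hxP⟩ := hP
        rw [Finset.sum_eq_single_of_mem P hP fun P' hP' hne => osc_of_notMem fun hx' =>
          Set.disjoint_left.1 (g.disjoint hP' hP hne) hx' hxP, osc_of_mem hx, osc_of_mem hxP]
        have m2 := norm_mean_le (g.pos P hP) (g.integral_le P hP)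
        have e : f x - mean f Q - (f x - mean f P) = mean f P - mean f Q := by ring
        rw [e]
        refine (norm_sub_le _ _).trans ?_
        linarith
      · push Not at hP
        rw [Finset.sum_eq_zero fun P hP' => osc_of_notMem (hP P hP'), sub_zero, osc_of_mem hx]
        have := (h4 j Q hi').2 x hx hP
        refine (norm_sub_le _ _).trans ?_
        linarith
    · rw [Set.indicator_of_notMem hx, osc_of_notMem hx, Finset.sum_eq_zero fun P hP =>
        osc_of_notMem fun h => hx (g.subset P hP h)]
      simp
  · intro x
    rw [Finset.sum_sigma]
    simp only [Finset.sum_sub_distrib]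
    have : ∀ j, ∑ Q ∈ F j, ∑ P ∈ G j Q, osc f P x = ∑ P ∈ F (j + 1), osc f P x :=
      fun j => (hFs j _).symm
    simp only [this]
    rw [← Finset.sum_sub_distrib, Finset.sum_range_sub' (fun j => ∑ P ∈ F j, osc f P x), hF0, hFJ]
    simp
  · rintro ⟨j, Q⟩ hi ⟨k, P⟩ hk hjk hne
    simp only at hjk
    subst hjk
    exact h3 j (Finset.mem_sigma.1 hi).2 (Finset.mem_sigma.1 hk).2
      fun h => hne (by rw [show Q = P from h])
  · intro s hs
    rw [Finset.sum_sigma]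
    simp only [← Finset.mul_sum]
    rcases J with _ | J
    · have : 0 ≤ ∫ x, ‖f x‖ ^ s := integral_nonneg fun x => by positivity
      have ha : (1 : ℝ) < 4 ^ (s - 1) := Real.one_lt_rpow (by norm_num) (by linarith)
      have ha' : (0 : ℝ) < 4 ^ (s - 1) - 1 := by linarith
      simp only [Finset.range_zero, Finset.sum_empty]
      positivity
    · have h5 := sum_levels_le hf hfc hlam hs (F := fun j => F (j + 1)) J
        (fun j P hP => (h1 _ P hP).1) h2 (fun j => h3 _)
      rw [Finset.sum_range_succ', hF0, add_comm]
      refine add_le_add (by simp) ?_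
      rw [mul_assoc]
      refine le_trans (le_of_eq ?_) (mul_le_mul_of_nonneg_left h5 (by positivity))
      rw [Finset.mul_sum]
      refine Finset.sum_congr rfl fun j _ => ?_
      rw [pow_succ', mul_assoc, Real.mul_rpow (by norm_num) (by positivity), mul_assoc]

/-- At every point at most one atom of each generation is alive. -/
lemma IsAtomicDecomposition.sum_indicator_eq {f : ℂ → ℂ} {Q₀ : ℂ × ℝ} {lam : ℝ}
    {I : Finset AtomIndex} {A : AtomIndex → ℂ → ℂ} (h : IsAtomicDecomposition f Q₀ lam I A)
    (x : ℂ) : ∃ K : Finset ℕ, ∀ g : ℕ → ℝ,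
      ∑ i ∈ I, (box i.2).indicator (fun _ => g i.1) x = ∑ j ∈ K, g j := by
  classical
  refine ⟨(I.filter fun i => x ∈ box i.2).image Sigma.fst, fun g => ?_⟩
  rw [Finset.sum_image, Finset.sum_filter]
  · exact Finset.sum_congr rfl fun i _ => rfl
  · intro i hi k hk hik
    rw [Finset.mem_coe, Finset.mem_filter] at hi hk
    by_contra hne
    exact Set.disjoint_left.1 (h.disjoint i hi.1 k hk.1 hik hne) hi.2 hk.2

/-- Since the heights of the atoms above a point grow geometrically, the `L^t` norm of the sum of
their powers is controlled by the sum of their `L^t` norms. -/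
lemma IsAtomicDecomposition.eLpNorm_sum_le {f : ℂ → ℂ} {Q₀ : ℂ × ℝ} {lam : ℝ} (hlam : 0 < lam)
    {I : Finset AtomIndex} {A : AtomIndex → ℂ → ℂ} (h : IsAtomicDecomposition f Q₀ lam I A)
    {α t s : ℝ} (hα : 0 < α) (ht : 0 < t) (hs : α * t = s) :
    eLpNorm (fun x => ∑ i ∈ I, (box i.2).indicator (fun _ => (4 ^ i.1 * lam) ^ α) x)
      (ENNReal.ofReal t) volume ≤
      ENNReal.ofReal (4 ^ α / (4 ^ α - 1) *
        (∑ i ∈ I, (4 ^ i.1 * lam) ^ s * i.2.2 ^ 2) ^ (1 / t)) := by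
  have ha : (1 : ℝ) < 4 ^ α := Real.one_lt_rpow (by norm_num) hα
  have ha' : (0 : ℝ) < 4 ^ α - 1 := by linarith
  set B : ℝ := 4 ^ α / (4 ^ α - 1) with hB
  have hB0 : 0 ≤ B := by positivity
  have hpt : ∀ x, (∑ i ∈ I, (box i.2).indicator (fun _ => (4 ^ i.1 * lam) ^ α) x) ^ t ≤
      B ^ t * ∑ i ∈ I, (box i.2).indicator (fun _ => (4 ^ i.1 * lam) ^ s) x := by
    intro x
    obtain ⟨K, hK⟩ := h.sum_indicator_eq x
    rw [hK (fun j => (4 ^ j * lam) ^ α), hK (fun j => (4 ^ j * lam) ^ s)]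
    have e1 : ∀ j : ℕ, ((4 : ℝ) ^ j * lam) ^ α = (4 ^ α) ^ j * lam ^ α :=
      fun j => rpow_pow_mul 4 (by norm_num) hlam.le α j
    have e2 : ∀ j : ℕ, ((4 : ℝ) ^ j * lam) ^ s = ((4 ^ α) ^ j) ^ t * (lam ^ α) ^ t := fun j => by
      rw [← Real.mul_rpow (by positivity) (by positivity), ← e1,
        ← Real.rpow_mul (by positivity), hs]
    simp only [e1, e2]
    rw [← Finset.sum_mul, ← Finset.sum_mul, Real.mul_rpow
      (Finset.sum_nonneg fun _ _ => by positivity) (by positivity), ← mul_assoc]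
    gcongr
    exact rpow_sum_pow_le ha ht K
  have hnn : ∀ x, 0 ≤ ∑ i ∈ I, (box i.2).indicator (fun _ => (4 ^ i.1 * lam) ^ α) x := fun x =>
    Finset.sum_nonneg fun i _ => Set.indicator_nonneg (fun _ _ => by positivity) _
  rw [eLpNorm_eq_lintegral_rpow_enorm_toReal (by simpa using ht) (by simp),
    ENNReal.toReal_ofReal ht.le]
  have h0 : ∀ i ∈ I, 0 ≤ (4 ^ i.1 * lam) ^ s * i.2.2 ^ 2 := fun i _ => by positivity
  have hint : Integrable (fun x => B ^ t *
      ∑ i ∈ I, (box i.2).indicator (fun _ => (4 ^ i.1 * lam) ^ s) x) volume :=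
    (memLp_one_iff_integrable.1 (memLp_sum_indicator I (fun i => measurableSet_box i.2)
      (fun i => volume_box_ne_top _) _ 1)).const_mul _
  have hle : ∫⁻ x, ‖∑ i ∈ I, (box i.2).indicator (fun _ => (4 ^ i.1 * lam) ^ α) x‖ₑ ^ t ≤
      ENNReal.ofReal (B ^ t * ∑ i ∈ I, (4 ^ i.1 * lam) ^ s * i.2.2 ^ 2) := by
    calc _ ≤ ∫⁻ x, ENNReal.ofReal (B ^ t *
          ∑ i ∈ I, (box i.2).indicator (fun _ => (4 ^ i.1 * lam) ^ s) x) := by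
          refine lintegral_mono fun x => ?_
          simp only
          rw [Real.enorm_of_nonneg (hnn x), ENNReal.ofReal_rpow_of_nonneg (hnn x) ht.le]
          exact ENNReal.ofReal_le_ofReal (hpt x)
      _ = ENNReal.ofReal (∫ x, B ^ t *
          ∑ i ∈ I, (box i.2).indicator (fun _ => (4 ^ i.1 * lam) ^ s) x) := by
          rw [ofReal_integral_eq_lintegral_ofReal hint]
          exact ae_of_all _ fun x => mul_nonneg (by positivity) (Finset.sum_nonneg fun i _ =>
            Set.indicator_nonneg (fun _ _ => by positivity) _)
      _ = _ := by
          rw [integral_const_mul, integral_finsetSum _ fun i _ => ?_]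
          · congr 2
            refine Finset.sum_congr rfl fun i hi => ?_
            rw [integral_indicator (measurableSet_box _), setIntegral_const,
              volume_real_box (h.pos i hi), smul_eq_mul, mul_comm]
          · exact (integrableOn_const (volume_box_ne_top _)).integrable_indicator
              (measurableSet_box _)
  calc _ ≤ ENNReal.ofReal (B ^ t * ∑ i ∈ I, (4 ^ i.1 * lam) ^ s * i.2.2 ^ 2) ^ (1 / t) := by
        gcongr
    _ = _ := by
        rw [ENNReal.ofReal_rpow_of_nonneg (mul_nonneg (by positivity) (Finset.sum_nonneg h0))
          (by positivity), Real.mul_rpow (by positivity) (Finset.sum_nonneg h0),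
          ← Real.rpow_mul hB0, mul_one_div_cancel ht.ne', Real.rpow_one]

/-! ### Duality in `L^r` -/

/-- The function `conj g * ‖g‖ ^ (r - 2)`, which norms `g` in `L^r`. -/
noncomputable def normingFun (r : ℝ) (g : ℂ → ℂ) (z : ℂ) : ℂ :=
  (starRingEnd ℂ) (g z) * ((‖g z‖ ^ (r - 2) : ℝ) : ℂ)

lemma mul_normingFun {r : ℝ} (hr : 0 < r) (g : ℂ → ℂ) (z : ℂ) :
    g z * normingFun r g z = ((‖g z‖ ^ r : ℝ) : ℂ) := by
  rcases eq_or_ne (g z) 0 with h | h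
  · simp [h, Real.zero_rpow hr.ne']
  · have : 0 < ‖g z‖ := norm_pos_iff.2 h
    rw [normingFun, ← mul_assoc, Complex.mul_conj, Complex.normSq_eq_norm_sq, ← Complex.ofReal_mul,
      ← Real.rpow_natCast, ← Real.rpow_add this]
    congr 2; push_cast; ring

lemma norm_normingFun {r : ℝ} (hr : 1 < r) (g : ℂ → ℂ) (z : ℂ) :
    ‖normingFun r g z‖ = ‖g z‖ ^ (r - 1) := by
  rcases eq_or_ne (g z) 0 with h | h
  · simp [normingFun, h, Real.zero_rpow (by linarith : r - 1 ≠ 0)]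
  · have : 0 < ‖g z‖ := norm_pos_iff.2 h
    rw [normingFun, norm_mul, RCLike.norm_conj, Complex.norm_real,
      Real.norm_of_nonneg (by positivity)]
    nth_rewrite 1 [← Real.rpow_one ‖g z‖]
    rw [← Real.rpow_add this]
    congr 1; ring

lemma aestronglyMeasurable_normingFun {r : ℝ} {g : ℂ → ℂ} (hg : AEStronglyMeasurable g volume) :
    AEStronglyMeasurable (normingFun r g) volume := by
  have h1 : AEMeasurable g volume := hg.aemeasurable
  have h2 : AEMeasurable (fun z => ((‖g z‖ ^ (r - 2) : ℝ) : ℂ)) volume :=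
    Complex.measurable_ofReal.comp_aemeasurable (h1.norm.pow_const _)
  exact ((Complex.continuous_conj.measurable.comp_aemeasurable h1).mul h2).aestronglyMeasurable

lemma lintegral_normingFun {r s : ℝ} (hrs : r.HolderConjugate s) (g : ℂ → ℂ) :
    eLpNorm (normingFun r g) (ENNReal.ofReal s) volume = (∫⁻ z, ‖g z‖ₑ ^ r) ^ (1 / s) := by
  have hs : 0 < s := hrs.symm.pos
  rw [eLpNorm_eq_lintegral_rpow_enorm_toReal (by simpa using hs) (by simp),
    ENNReal.toReal_ofReal hs.le]
  congr 1
  refine lintegral_congr fun z => ?_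
  rw [← ofReal_norm, norm_normingFun hrs.lt, ← ofReal_norm,
    ENNReal.ofReal_rpow_of_nonneg (by positivity) hs.le,
    ENNReal.ofReal_rpow_of_nonneg (by positivity) hrs.pos.le, ← Real.rpow_mul (norm_nonneg _)]
  congr 2
  rw [sub_mul, one_mul, hrs.mul_eq_add]; ring

lemma memLp_normingFun {r s : ℝ} (hrs : r.HolderConjugate s) {g : ℂ → ℂ}
    (hg : MemLp g (ENNReal.ofReal r) volume) :
    MemLp (normingFun r g) (ENNReal.ofReal s) volume := by
  refine ⟨aestronglyMeasurable_normingFun hg.1, ?_⟩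
  rw [lintegral_normingFun hrs]
  have h2 : ∫⁻ z, ‖g z‖ₑ ^ r < ∞ := by
    have := lintegral_rpow_enorm_lt_top_of_eLpNorm_lt_top (by simpa using hrs.pos) (by simp) hg.2
    rwa [ENNReal.toReal_ofReal hrs.pos.le] at this
  have := hrs.symm.pos
  finiteness

/-- To bound the `L^r` norm of `g` it suffices to test against the function norming it. -/
lemma eLpNorm_le_of_enorm_integral_normingFun_le {r s : ℝ} (hrs : r.HolderConjugate s) {g : ℂ → ℂ}
    (hg : MemLp g (ENNReal.ofReal r) volume) {A : ℝ≥0∞}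
    (h : ‖∫ z, g z * normingFun r g z‖ₑ ≤ A * eLpNorm (normingFun r g) (ENNReal.ofReal s) volume) :
    eLpNorm g (ENNReal.ofReal r) volume ≤ A := by
  have hr := hrs.pos
  have hs := hrs.symm.pos
  set T := ∫⁻ z, ‖g z‖ₑ ^ r with hT
  have hTtop : T ≠ ∞ := by
    have := lintegral_rpow_enorm_lt_top_of_eLpNorm_lt_top (by simpa using hr) (by simp) hg.2
    rw [ENNReal.toReal_ofReal hr.le] at this
    exact this.ne
  have e1 : ‖∫ z, g z * normingFun r g z‖ₑ = T := by
    simp only [mul_normingFun hr]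
    rw [integral_complex_ofReal, ← ofReal_norm, Complex.norm_real, Real.norm_of_nonneg
      (integral_nonneg fun z => by positivity), ofReal_integral_eq_lintegral_ofReal
      ?_ (ae_of_all _ fun z => by positivity)]
    · refine lintegral_congr fun z => ?_
      rw [← ofReal_norm, ENNReal.ofReal_rpow_of_nonneg (norm_nonneg _) hr.le]
    · have := hg.integrable_norm_rpow (by simpa using hr) (by simp)
      rwa [ENNReal.toReal_ofReal hr.le] at this
  rw [e1, lintegral_normingFun hrs, ← hT] at h
  rw [eLpNorm_eq_lintegral_rpow_enorm_toReal (by simpa using hr) (by simp),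
    ENNReal.toReal_ofReal hr.le, ← hT]
  rcases eq_or_ne T 0 with h0 | h0
  · rw [h0, ENNReal.zero_rpow_of_pos (by positivity)]; simp
  · have h3 : T ^ (1 / r) * T ^ (1 / s) = T := by
      rw [← ENNReal.rpow_add _ _ h0 hTtop]
      simp [hrs.inv_add_inv_eq_one]
    have h4 : T ^ (1 / s) ≠ 0 := by
      rw [Ne, ENNReal.rpow_eq_zero_iff]
      rintro (⟨h5, -⟩ | ⟨h5, -⟩)
      · exact h0 h5
      · exact hTtop h5
    have h5 : T ^ (1 / s) ≠ ∞ := by finiteness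
    rw [← h3] at h
    nth_rewrite 2 [h3] at h
    exact (ENNReal.mul_le_mul_iff_left h4 h5).1 h

/-! ### The lower bound for the norm of the commutator -/

lemma integral_norm_box_le {f : ℂ → ℂ} (hf : Continuous f) (hfc : HasCompactSupport f)
    {s : ℝ} (hs : 1 < s) {Q : ℂ × ℝ} (hQ : 0 < Q.2) :
    ∫ x in box Q, ‖f x‖ ≤ ((∫ x, ‖f x‖ ^ s) / Q.2 ^ 2) ^ (1 / s) * Q.2 ^ 2 := by
  have hconj := Real.HolderConjugate.conjExponent hs
  set s' := s.conjExponent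
  have hfL : MemLp f (ENNReal.ofReal s) volume := hf.memLp_of_hasCompactSupport hfc
  have : IsFiniteMeasure (volume.restrict (box Q)) :=
    isFiniteMeasure_restrict.2 (volume_box_ne_top Q)
  have h1 := integral_mul_le_Lp_mul_Lq_of_nonneg (μ := volume.restrict (box Q)) hconj
    (f := fun x => ‖f x‖) (g := fun _ => 1) (ae_of_all _ fun x => norm_nonneg _)
    (ae_of_all _ fun x => zero_le_one) (hfL.restrict _).norm (memLp_const _)
  simp only [mul_one, Real.one_rpow] at h1
  rw [setIntegral_const, volume_real_box hQ, smul_eq_mul, mul_one] at h1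
  have hfs : Integrable (fun x => ‖f x‖ ^ s) volume := by
    have := hfL.integrable_norm_rpow (by simpa using hconj.pos) (by simp)
    rwa [ENNReal.toReal_ofReal hconj.pos.le] at this
  have h2 : ∫ x in box Q, ‖f x‖ ^ s ≤ ∫ x, ‖f x‖ ^ s :=
    setIntegral_le_integral hfs (ae_of_all _ fun x => by positivity)
  have h3 : 0 ≤ ∫ x in box Q, ‖f x‖ ^ s := integral_nonneg fun x => by positivity
  have hspos := hconj.pos
  have hL : (0 : ℝ) < Q.2 ^ 2 := by positivity
  refine h1.trans ?_
  calc _ ≤ (∫ x, ‖f x‖ ^ s) ^ (1 / s) * (Q.2 ^ 2) ^ (1 / s') := by gcongr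
    _ = _ := by
      rw [Real.div_rpow (h3.trans h2) hL.le, div_mul_eq_mul_div, mul_div_assoc]
      congr 1
      rw [eq_div_iff (by positivity), ← Real.rpow_add hL]
      simp only [one_div, hconj.symm.inv_add_inv_eq_one, Real.rpow_one]

/-- The atomic decomposition of `f` turns the bound for sums of oscillations into an `L^s` bound for
the functional `f ↦ ∫ b (f - mean f)`. -/
lemma exists_enorm_integral_mul_osc_le {p q q' s : ℝ} (hp : 0 < p) (hq : q.HolderConjugate q')
    (hs : 1 < s) (hps : 1 / s = 1 / p + 1 / q') :
    ∃ K : ℝ≥0, ∀ {b : ℂ → ℂ}, LocallyIntegrable b volume → ∀ {C : ℝ≥0},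
      BeurlingCommutatorBound b (ENNReal.ofReal p) (ENNReal.ofReal q) C →
      ∀ {f : ℂ → ℂ}, Continuous f → HasCompactSupport f → ∀ {Q : ℂ × ℝ}, 0 < Q.2 →
      ‖∫ x, b x * osc f Q x‖ₑ ≤ K * C * eLpNorm f (ENNReal.ofReal s) volume := by
  have hq' := hq.symm.pos
  have hs0 : 0 < s := by linarith
  -- the heights of the atoms are split with exponents that turn the `L^p` and `L^q'` norms into
  -- powers of the `L^s` norm
  set α := s / p with hα
  set β := s / q' with hβ
  have hα0 : 0 < α := by positivity
  have hβ0 : 0 < β := by positivity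
  have hαβ : α + β = 1 := by
    rw [hα, hβ, div_eq_mul_one_div, div_eq_mul_one_div s q', ← mul_add, ← hps]
    field_simp
  have := hq.ennrealOfReal
  set D : ℝ := 1 + 4 ^ s * (2 ^ s * (4 ^ (s - 1) / (4 ^ (s - 1) - 1))) with hD
  have ha1 : ∀ t : ℝ, 0 < t → (0 : ℝ) < 4 ^ t - 1 := fun t ht => by
    have := Real.one_lt_rpow (by norm_num : (1 : ℝ) < 4) ht
    linarith
  have hD0 : 0 < D := by
    have := ha1 (s - 1) (by linarith)
    positivity
  set B : ℝ → ℝ := fun t => 4 ^ t / (4 ^ t - 1) with hB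
  have hBα : 0 < B α := by have := ha1 α hα0; simp only [hB]; positivity
  have hBβ : 0 < B β := by have := ha1 β hβ0; simp only [hB]; positivity
  refine ⟨Real.toNNReal (1296 * 5 * B α * B β * D ^ (1 / s)), ?_⟩
  intro b hb C hC f hf hfc Q hQ
  have hfL : MemLp f (ENNReal.ofReal s) volume := hf.memLp_of_hasCompactSupport hfc
  have hfs : Integrable (fun x => ‖f x‖ ^ s) volume := by
    have := hfL.integrable_norm_rpow (by simpa using hs0) (by simp)
    rwa [ENNReal.toReal_ofReal hs0.le] at this
  set T := ∫ x, ‖f x‖ ^ s with hT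
  have hT0 : 0 ≤ T := integral_nonneg fun x => by positivity
  have hnorm : eLpNorm f (ENNReal.ofReal s) volume = ENNReal.ofReal (T ^ (1 / s)) := by
    rw [eLpNorm_eq_lintegral_rpow_enorm_toReal (by simpa using hs0) (by simp),
      ENNReal.toReal_ofReal hs0.le, ← ENNReal.ofReal_rpow_of_nonneg hT0 (by positivity), hT,
      ofReal_integral_eq_lintegral_ofReal hfs (ae_of_all _ fun x => by positivity)]
    congr 1
    refine lintegral_congr fun z => ?_
    rw [← ofReal_norm, ENNReal.ofReal_rpow_of_nonneg (norm_nonneg _) hs0.le]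
  rcases hT0.eq_or_lt with hT0' | hTpos
  · have hf0 : f = 0 := by
      have h1 : eLpNorm f (ENNReal.ofReal s) volume = 0 := by
        rw [hnorm, ← hT0', Real.zero_rpow (by positivity)]; simp
      rw [eLpNorm_eq_zero_iff hf.aestronglyMeasurable (by simpa using hs0)] at h1
      exact Continuous.ae_eq_iff_eq volume hf continuous_const |>.1 h1
    have : ∀ x, osc f Q x = 0 := fun x => by
      simp [osc, mean, hf0, Set.indicator]
    simp [this]
  -- by Hölder's inequality, the average of `‖f‖` over `Q` is at most its `L^s` average
  set lam : ℝ := (T / Q.2 ^ 2) ^ (1 / s) with hlam_def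
  have hlam : 0 < lam := by positivity
  obtain ⟨I, A, hA, hsize⟩ := exists_isAtomicDecomposition hf hfc hlam hQ
    (integral_norm_box_le hf hfc hs hQ)
  have hS : ∑ i ∈ I, (4 ^ i.1 * lam) ^ s * i.2.2 ^ 2 ≤ D * T := by
    have h1 := hsize s hs
    rw [← hT] at h1
    refine h1.trans_eq ?_
    rw [hlam_def, ← Real.rpow_mul (by positivity), one_div_mul_cancel hs0.ne', Real.rpow_one, hD]
    field_simp
  have hS0 : 0 ≤ ∑ i ∈ I, (4 ^ i.1 * lam) ^ s * i.2.2 ^ 2 :=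
    Finset.sum_nonneg fun i _ => by positivity
  have key := enorm_sum_oscillation_le hb (p := ENNReal.ofReal p) (q' := ENNReal.ofReal q')
    (by simpa using hp) (by simp) (by simp) hC I
    (Q := fun i => i.2) hA.pos
    (χ := fun i => (box i.2).indicator fun _ => (((4 ^ i.1 * lam) ^ α : ℝ) : ℂ))
    (ψ := fun i x => (((4 ^ i.1 * lam) ^ (-α) : ℝ) : ℂ) * A i x)
    (a := fun i => (4 ^ i.1 * lam) ^ α) (c := fun i => 5 * (4 ^ i.1 * lam) ^ β)
    (fun i _ => aestronglyMeasurable_const.indicator (measurableSet_box _))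
    (fun i hi => (hA.integrable i hi).aestronglyMeasurable.const_mul _)
    (fun i _ x => by
      rw [norm_indicator_eq_indicator_norm, Complex.norm_real,
        Real.norm_of_nonneg (by positivity)])
    (fun i hi x => by
      have h1 := hA.norm_le i hi x
      rw [norm_mul, Complex.norm_real, Real.norm_of_nonneg (by positivity)]
      have h2 : (4 ^ i.1 * lam) ^ β = (4 ^ i.1 * lam) ^ (-α) * (4 ^ i.1 * lam) := by
        nth_rewrite 3 [← Real.rpow_one (4 ^ i.1 * lam)]
        rw [← Real.rpow_add (by positivity)]
        congr 1; linarith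
      by_cases hx : x ∈ box i.2
      · rw [Set.indicator_of_mem hx] at h1 ⊢
        rw [h2, mul_left_comm]
        gcongr
      · rw [Set.indicator_of_notMem hx] at h1 ⊢
        rw [norm_le_zero_iff.1 h1]; simp)
  have e1 : ∫ x, b x * osc f Q x = ∑ i ∈ I, ((∫ z, b z * ((((4 ^ i.1 * lam) ^ (-α) : ℝ) : ℂ) *
      A i z)) * (∫ y, (box i.2).indicator (fun _ => (((4 ^ i.1 * lam) ^ α : ℝ) : ℂ)) y) -
      (∫ z, b z * (box i.2).indicator (fun _ => (((4 ^ i.1 * lam) ^ α : ℝ) : ℂ)) z) *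
        (∫ y, (((4 ^ i.1 * lam) ^ (-α) : ℝ) : ℂ) * A i y)) / (i.2.2 : ℂ) ^ 2 := by
    have h1 : ∀ i ∈ I, Integrable (fun x => b x * A i x) volume := by
      intro i hi
      have h2 : IntegrableOn b (box i.2) volume :=
        (hb.integrableOn_isCompact (isCompact_closedBall i.2.1 (2 * i.2.2))).mono_set fun z hz => by
          rw [mem_closedBall_iff_norm]
          exact norm_sub_le_of_mem_box hz (corner_mem_box (hA.pos i hi))
      refine Integrable.mono' (g := fun x => (5 * (4 ^ i.1 * lam)) * (box i.2).indicator
        (fun x => ‖b x‖) x) ((IntegrableOn.integrable_indicator h2.norm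
          (measurableSet_box _)).const_mul _)
        (hb.aestronglyMeasurable.mul (hA.integrable i hi).aestronglyMeasurable)
        (ae_of_all _ fun x => ?_)
      have h3 := hA.norm_le i hi x
      rw [norm_mul]
      by_cases hx : x ∈ box i.2
      · rw [Set.indicator_of_mem hx] at h3 ⊢
        rw [mul_comm]
        gcongr
      · rw [Set.indicator_of_notMem hx] at h3 ⊢
        rw [norm_le_zero_iff.1 h3]; simp
    have h2 : ∫ x, b x * osc f Q x = ∑ i ∈ I, ∫ x, b x * A i x := by
      rw [← integral_finsetSum _ h1]
      congr 1
      funext x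
      rw [hA.osc_eq x, Finset.mul_sum]
    rw [h2]
    refine Finset.sum_congr rfl fun i hi => ?_
    have hl : (0 : ℝ) < 4 ^ i.1 * lam := by positivity
    have hi2 := hA.pos i hi
    rw [integral_const_mul, hA.integral_eq_zero i hi, mul_zero, mul_zero, sub_zero,
      integral_indicator (measurableSet_box _), setIntegral_const, volume_real_box hi2,
      Complex.real_smul]
    simp only [mul_left_comm (b _)]
    rw [integral_const_mul, Real.rpow_neg hl.le]
    have h3 : (((4 ^ i.1 * lam) ^ α : ℝ) : ℂ) ≠ 0 := by
      exact_mod_cast (by positivity : (4 ^ i.1 * lam) ^ α ≠ 0)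
    have h4 : (i.2.2 : ℂ) ≠ 0 := by exact_mod_cast hi2.ne'
    push_cast at h3 ⊢
    field_simp
  rw [e1]
  refine key.trans ?_
  have n1 := hA.eLpNorm_sum_le hlam hα0 hp (s := s) (by rw [hα]; field_simp)
  have n2 := hA.eLpNorm_sum_le hlam hβ0 hq' (s := s) (by rw [hβ]; field_simp)
  have n3 : eLpNorm (fun x => ∑ i ∈ I, (box i.2).indicator
      (fun _ => 5 * (4 ^ i.1 * lam) ^ β) x) (ENNReal.ofReal q') volume =
      5 * eLpNorm (fun x => ∑ i ∈ I, (box i.2).indicator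
        (fun _ => (4 ^ i.1 * lam) ^ β) x) (ENNReal.ofReal q') volume := by
    have h5 : (fun x => ∑ i ∈ I, (box i.2).indicator (fun _ => 5 * (4 ^ i.1 * lam) ^ β) x) =
        (5 : ℝ) • (fun x => ∑ i ∈ I, (box i.2).indicator (fun _ => (4 ^ i.1 * lam) ^ β) x) := by
      funext x
      rw [Pi.smul_apply, smul_eq_mul, Finset.mul_sum]
      refine Finset.sum_congr rfl fun i _ => ?_
      simp only [Set.indicator]
      split_ifs <;> simp
    rw [h5, eLpNorm_const_smul, ← ofReal_norm]
    simp
  rw [n3, hnorm]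
  have m1 := n1.trans (ENNReal.ofReal_le_ofReal (mul_le_mul_of_nonneg_left
    (Real.rpow_le_rpow hS0 hS (by positivity : 0 ≤ 1 / p)) hBα.le))
  have m2 := n2.trans (ENNReal.ofReal_le_ofReal (mul_le_mul_of_nonneg_left
    (Real.rpow_le_rpow hS0 hS (by positivity : 0 ≤ 1 / q')) hBβ.le))
  have e2 : (D * T) ^ (1 / p) * (D * T) ^ (1 / q') = D ^ (1 / s) * T ^ (1 / s) := by
    rw [← Real.rpow_add (by positivity), ← hps, Real.mul_rpow hD0.le hT0]
  calc _ ≤ 1296 * (C * ENNReal.ofReal (B α * (D * T) ^ (1 / p)) *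
        (5 * ENNReal.ofReal (B β * (D * T) ^ (1 / q')))) := by gcongr
    _ = C * (ENNReal.ofReal (1296 * 5) * ENNReal.ofReal (B α * (D * T) ^ (1 / p)) *
        ENNReal.ofReal (B β * (D * T) ^ (1 / q'))) := by
        rw [ENNReal.ofReal_mul (p := 1296) (by norm_num)]
        simp only [ENNReal.ofReal_ofNat]
        ring
    _ = C * ENNReal.ofReal (1296 * 5 * B α * B β * D ^ (1 / s) * T ^ (1 / s)) := by
        rw [← ENNReal.ofReal_mul (p := 1296 * 5) (by norm_num), ← ENNReal.ofReal_mul (by positivity)]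
        congr 2
        linear_combination (1296 * 5 * B α * B β) * e2
    _ = _ := by
        rw [ENNReal.ofReal_mul (by positivity)]
        change _ = ENNReal.ofReal _ * _ * _
        ring

lemma _root_.MeasureTheory.LocallyIntegrable.integrableOn_box {b : ℂ → ℂ}
    (hb : LocallyIntegrable b volume) (Q : ℂ × ℝ) : IntegrableOn b (box Q) volume := by
  refine (hb.integrableOn_isCompact (isCompact_closedBall Q.1 (2 * Q.2))).mono_set fun z hz => ?_
  rcases le_or_gt Q.2 0 with h | h
  · exact absurd hz.1.1 (not_le.2 (by linarith [hz.1.2]))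
  · rw [mem_closedBall_iff_norm]
    exact norm_sub_le_of_mem_box hz (corner_mem_box h)

/-- The functional `f ↦ ∫ b (f - mean f)` is symmetric. -/
lemma integral_mul_osc_comm {b f : ℂ → ℂ} {Q : ℂ × ℝ} (hb : IntegrableOn b (box Q) volume)
    (hf : IntegrableOn f (box Q) volume)
    (hbf : IntegrableOn (fun x => b x * f x) (box Q) volume) :
    ∫ x, b x * osc f Q x = ∫ x, osc b Q x * f x := by
  have e1 : ∀ x, b x * osc f Q x = (box Q).indicator (fun x => b x * f x - b x * mean f Q) x := by
    intro x
    by_cases hx : x ∈ box Q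
    · rw [osc_of_mem hx, Set.indicator_of_mem hx]; ring
    · rw [osc_of_notMem hx, Set.indicator_of_notMem hx]; ring
  have e2 : ∀ x, osc b Q x * f x = (box Q).indicator (fun x => b x * f x - mean b Q * f x) x := by
    intro x
    by_cases hx : x ∈ box Q
    · rw [osc_of_mem hx, Set.indicator_of_mem hx]; ring
    · rw [osc_of_notMem hx, Set.indicator_of_notMem hx]; ring
  simp only [e1, e2]
  rw [integral_indicator (measurableSet_box Q), integral_indicator (measurableSet_box Q),
    integral_sub hbf (hb.mul_const _), integral_sub hbf (hf.const_mul _), integral_mul_const,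
    integral_const_mul, mean, mean]
  ring

/-- A bound for the functional `f ↦ ∫ b (f - mean f)` on continuous functions extends to bounded
functions. -/
lemma enorm_integral_mul_osc_le_of_bounded {b : ℂ → ℂ} (hb : LocallyIntegrable b volume) {s : ℝ}
    (hs : 0 < s) {Q : ℂ × ℝ} (hQ : 0 < Q.2) {A : ℝ≥0}
    (hA : ∀ f : ℂ → ℂ, Continuous f → HasCompactSupport f →
      ‖∫ x, b x * osc f Q x‖ₑ ≤ A * eLpNorm f (ENNReal.ofReal s) volume)
    {f : ℂ → ℂ} (hf : AEStronglyMeasurable f volume) {M R : ℝ} (hM : ∀ x, ‖f x‖ ≤ M)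
    (hR : ∀ x, R < ‖x‖ → f x = 0) :
    ‖∫ x, b x * osc f Q x‖ₑ ≤ A * eLpNorm f (ENNReal.ofReal s) volume := by
  obtain ⟨fn, h1, h2, h3, h4⟩ := exists_mollification hf hM hR
  have hM0 : 0 ≤ M := (norm_nonneg _).trans (hM 0)
  have hmean : Tendsto (fun n => mean (fn n) Q) atTop (𝓝 (mean f Q)) := by
    refine Tendsto.div_const ?_ _
    refine tendsto_integral_of_dominated_convergence (fun _ => M)
      (fun n => (h1 n).continuous.aestronglyMeasurable)
      (integrableOn_const (volume_box_ne_top Q)) (fun n => ae_of_all _ (h2 n))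
      (ae_restrict_of_ae h4)
  have hmb : ∀ n, ‖mean (fn n) Q‖ ≤ M := fun n => by
    refine norm_mean_le hQ ?_
    have : ∫ x in box Q, ‖fn n x‖ ≤ ∫ x in box Q, M :=
      setIntegral_mono (integrableOn_box (h1 n).continuous Q).norm
        (integrableOn_const (volume_box_ne_top Q)) (h2 n)
    rw [setIntegral_const, volume_real_box hQ, smul_eq_mul] at this
    linarith
  have L1 : Tendsto (fun n => ∫ x, b x * osc (fn n) Q x) atTop (𝓝 (∫ x, b x * osc f Q x)) := by
    refine tendsto_integral_mul_of_bounded hb (M := 2 * M) (R := ‖Q.1‖ + 2 * Q.2)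
      (fun n => (integrable_osc (integrableOn_box (h1 n).continuous Q)).aestronglyMeasurable)
      (fun n x => ?_) (fun n x hx => ?_) ?_
    · by_cases hx : x ∈ box Q
      · rw [osc_of_mem hx]
        exact (norm_sub_le _ _).trans (by linarith [h2 n x, hmb n])
      · rw [osc_of_notMem hx]; simpa using hM0
    · refine osc_of_notMem fun hmem => ?_
      have := norm_sub_le_of_mem_box hmem (corner_mem_box hQ)
      have := norm_sub_norm_le x Q.1
      linarith
    · filter_upwards [h4] with x hx4
      by_cases hx : x ∈ box Q
      · simp only [osc_of_mem hx]
        exact hx4.sub hmean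
      · simp only [osc_of_notMem hx]
        exact tendsto_const_nhds
  have L2 : Tendsto (fun n => eLpNorm (fn n) (ENNReal.ofReal s) volume) atTop
      (𝓝 (eLpNorm f (ENNReal.ofReal s) volume)) := by
    have h5 := tendsto_eLpNorm_of_dominated (p := ENNReal.ofReal s) (by simpa using hs) (by simp)
      (F := fun n x => ‖fn n x‖) (f := fun x => ‖f x‖)
      (G := (Metric.closedBall (0 : ℂ) (R + 1)).indicator fun _ => M)
      (fun n => (h1 n).continuous.norm.aestronglyMeasurable)
      (memLp_indicator_const _ Metric.isClosed_closedBall.measurableSet _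
        (Or.inr measure_closedBall_lt_top.ne)) (fun n x => ?_)
      (by filter_upwards [h4] with x hx using hx.norm)
    · simpa only [eLpNorm_norm] using h5
    · rw [norm_norm]
      refine le_trans ?_ (le_abs_self _)
      by_cases hx : x ∈ Metric.closedBall (0 : ℂ) (R + 1)
      · rw [Set.indicator_of_mem hx]; exact h2 n x
      · rw [Set.indicator_of_notMem hx, h3 n x (by simpa using hx)]; simp
  exact le_of_tendsto_of_tendsto' ((continuous_enorm.tendsto _).comp L1)
    (ENNReal.Tendsto.const_mul L2 (Or.inr (by simp)))
    fun n => hA _ (h1 n).continuous (h1 n).2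

/-- The `L^r` norm of `b` minus its mean over a square, by duality. As it is not known beforehand to
be finite, it is approached through truncations. -/
lemma eLpNorm_osc_le {b : ℂ → ℂ} (hb : LocallyIntegrable b volume) {r s : ℝ}
    (hrs : r.HolderConjugate s) {Q : ℂ × ℝ} (hQ : 0 < Q.2) {A : ℝ≥0}
    (hA : ∀ f : ℂ → ℂ, Continuous f → HasCompactSupport f →
      ‖∫ x, b x * osc f Q x‖ₑ ≤ A * eLpNorm f (ENNReal.ofReal s) volume) :
    eLpNorm (osc b Q) (ENNReal.ofReal r) volume ≤ A := by
  have hg : AEStronglyMeasurable (osc b Q) volume :=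
    (integrable_osc (hb.integrableOn_box Q)).aestronglyMeasurable
  set g : ℂ → ℂ := hg.mk (osc b Q) with hgdef
  have hgm : StronglyMeasurable g := hg.stronglyMeasurable_mk
  have hbg : osc b Q =ᵐ[volume] g := hg.ae_eq_mk
  set R := ‖Q.1‖ + 2 * Q.2
  have hR : ∀ x, R < ‖x‖ → x ∉ box Q := fun x hx hmem => by
    have := norm_sub_le_of_mem_box hmem (corner_mem_box hQ)
    have := norm_sub_norm_le x Q.1
    simp only [R] at hx
    linarith
  set gn : ℕ → ℂ → ℂ := fun n => (box Q ∩ {x | ‖g x‖ ≤ n}).indicator g with hgn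
  have hS : ∀ n : ℕ, MeasurableSet (box Q ∩ {x | ‖g x‖ ≤ n}) := fun n =>
    (measurableSet_box Q).inter (measurableSet_le hgm.measurable.norm measurable_const)
  have hgnm : ∀ n, AEStronglyMeasurable (gn n) volume := fun n =>
    (hgm.indicator (hS n)).aestronglyMeasurable
  have hgnb : ∀ (n : ℕ) x, ‖gn n x‖ ≤ n := fun n x => by
    by_cases hx : x ∈ box Q ∩ {x | ‖g x‖ ≤ n}
    · simp only [hgn]; rw [Set.indicator_of_mem hx]; exact hx.2
    · simp only [hgn]; rw [Set.indicator_of_notMem hx]; simp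
  have hgnR : ∀ n x, R < ‖x‖ → gn n x = 0 := fun n x hx =>
    Set.indicator_of_notMem (fun h => hR x hx h.1) _
  have hgnL : ∀ n, MemLp (gn n) (ENNReal.ofReal r) volume := fun n =>
    memLp_of_bounded (hgnm n) (hgnb n) (hgnR n) _
  have hbound : ∀ n, eLpNorm (gn n) (ENNReal.ofReal r) volume ≤ A := by
    intro n
    refine eLpNorm_le_of_enorm_integral_normingFun_le hrs (hgnL n) ?_
    set f := normingFun r (gn n) with hf
    have hfm : AEStronglyMeasurable f volume := aestronglyMeasurable_normingFun (hgnm n)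
    have hfb : ∀ x, ‖f x‖ ≤ (n : ℝ) ^ (r - 1) := fun x => by
      rw [hf, norm_normingFun hrs.lt]
      exact Real.rpow_le_rpow (norm_nonneg _) (hgnb n x) (by linarith [hrs.lt])
    have hf0 : ∀ x, gn n x = 0 → f x = 0 := fun x hx => by
      rw [hf, normingFun, hx]; simp
    have h1 := enorm_integral_mul_osc_le_of_bounded hb hrs.symm.pos hQ hA hfm hfb
      fun x hx => hf0 x (hgnR n x hx)
    have hbi := hb.integrableOn_box Q
    have hfi : Integrable f volume := memLp_one_iff_integrable.1
      (memLp_of_bounded hfm hfb (fun x hx => hf0 x (hgnR n x hx)) 1)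
    rw [integral_mul_osc_comm hbi hfi.integrableOn
      (hbi.mul_bdd (c := (n : ℝ) ^ (r - 1)) hfm.restrict (ae_of_all _ hfb))] at h1
    refine le_of_eq_of_le ?_ h1
    congr 1
    refine integral_congr_ae ?_
    filter_upwards [hbg] with x hx
    rw [hx]
    by_cases hx' : x ∈ box Q ∩ {x | ‖g x‖ ≤ n}
    · simp only [hgn]; rw [Set.indicator_of_mem hx']
    · have : gn n x = 0 := Set.indicator_of_notMem hx' _
      rw [hf0 x this]; simp
  have hlim : ∀ᵐ x, Tendsto (fun n => gn n x) atTop (𝓝 (osc b Q x)) := by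
    filter_upwards [hbg] with x hx
    by_cases hxQ : x ∈ box Q
    · rw [hx]
      refine tendsto_const_nhds.congr' ?_
      filter_upwards [eventually_ge_atTop ⌈‖g x‖⌉₊] with n hn
      have : x ∈ box Q ∩ {x | ‖g x‖ ≤ n} := by
        refine ⟨hxQ, ?_⟩
        have h1 : ‖g x‖ ≤ (⌈‖g x‖⌉₊ : ℝ) := Nat.le_ceil _
        exact h1.trans (Nat.cast_le.2 hn)
      simp only [hgn]; rw [Set.indicator_of_mem this]
    · rw [osc_of_notMem hxQ]
      refine tendsto_const_nhds.congr fun n => ?_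
      simp only [hgn]; rw [Set.indicator_of_notMem fun h => hxQ h.1]
  refine (Lp.eLpNorm_lim_le_liminf_eLpNorm hgnm _ hlim).trans ?_
  exact liminf_le_of_le (by isBoundedDefault) fun c hc => by
    obtain ⟨n, hn⟩ := hc.exists
    exact hn.trans (hbound n)

/-- The squares `[-2ⁿ, 2ⁿ)²`. -/
noncomputable def bigBox (n : ℕ) : ℂ × ℝ := (⟨-2 ^ n, -2 ^ n⟩, 2 * 2 ^ n)

lemma bigBox_pos (n : ℕ) : 0 < (bigBox n).2 := by simp [bigBox]

lemma mem_bigBox {n : ℕ} {z : ℂ} (hz : ‖z‖ < 2 ^ n) : z ∈ box (bigBox n) := by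
  have h1 := abs_lt.1 ((Complex.abs_re_le_norm z).trans_lt hz)
  have h2 := abs_lt.1 ((Complex.abs_im_le_norm z).trans_lt hz)
  exact ⟨⟨h1.1.le, by simp only [bigBox]; linarith⟩, h2.1.le, by simp only [bigBox]; linarith⟩

lemma box_bigBox_subset (n : ℕ) : box (bigBox n) ⊆ box (bigBox (n + 1)) := by
  rintro z ⟨⟨h1, h2⟩, h3, h4⟩
  have h5 : (0 : ℝ) < 2 ^ n := by positivity
  simp only [bigBox] at h1 h2 h3 h4
  refine ⟨⟨?_, ?_⟩, ?_, ?_⟩ <;> simp only [bigBox, pow_succ] <;> linarith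

lemma eventually_mem_bigBox (z : ℂ) : ∀ᶠ n in atTop, z ∈ box (bigBox n) := by
  obtain ⟨N, hN⟩ := pow_unbounded_of_one_lt ‖z‖ (by norm_num : (1 : ℝ) < 2)
  filter_upwards [eventually_ge_atTop N] with n hn
  exact mem_bigBox (hN.trans_le (pow_le_pow_right₀ (by norm_num) hn))

/-- A uniform bound for the oscillation of `b` in `L^r` of large squares forces `b` to be a constant
plus an `L^r` function: the means over the squares converge. -/
lemma exists_const_eLpNorm_sub_le {b : ℂ → ℂ} (hb : LocallyIntegrable b volume) {r : ℝ}
    (hr : 1 < r) {A : ℝ≥0}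
    (hA : ∀ n, eLpNorm (osc b (bigBox n)) (ENNReal.ofReal r) volume ≤ A) :
    ∃ c : ℂ, AEStronglyMeasurable (fun z => b z - c) volume ∧
      eLpNorm (fun z => b z - c) (ENNReal.ofReal r) volume ≤ A := by
  have hr0 : 0 < r := by linarith
  set c : ℕ → ℂ := fun n => mean b (bigBox n) with hc
  have hm : ∀ n, AEStronglyMeasurable (osc b (bigBox n)) volume := fun n =>
    (integrable_osc (hb.integrableOn_box _)).aestronglyMeasurable
  have hstep : ∀ n, dist (c n) (c (n + 1)) ≤ 2 * A * ((2 : ℝ) ^ (-(1 / r))) ^ n := by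
    intro n
    have h1 : eLpNorm ((box (bigBox n)).indicator fun _ => c (n + 1) - c n)
        (ENNReal.ofReal r) volume ≤ A + A := by
      refine (eLpNorm_mono (g := fun x => osc b (bigBox n) x - osc b (bigBox (n + 1)) x)
        fun x => ?_).trans ((eLpNorm_sub_le (hm n) (hm (n + 1)) ?_).trans
          (add_le_add (hA n) (hA (n + 1))))
      · by_cases hx : x ∈ box (bigBox n)
        · rw [Set.indicator_of_mem hx, osc_of_mem hx, osc_of_mem (box_bigBox_subset n hx)]
          refine le_of_eq ?_
          congr 1
          simp only [hc]; ring
        · rw [Set.indicator_of_notMem hx]; simp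
      · rw [← ENNReal.ofReal_one]; exact ENNReal.ofReal_le_ofReal hr.le
    rw [eLpNorm_indicator_const (measurableSet_box _) (by simpa using hr0) (by simp),
      ENNReal.toReal_ofReal hr0.le, volume_box] at h1
    have h2 : ((2 : ℝ) ^ (1 / r)) ^ n ≤ (((2 : ℝ) * 2 ^ n) * (2 * 2 ^ n)) ^ (1 / r) := by
      rw [← Real.rpow_natCast, ← Real.rpow_mul (by norm_num), mul_comm (1 / r),
        Real.rpow_mul (by norm_num), Real.rpow_natCast]
      refine Real.rpow_le_rpow (by positivity) ?_ (by positivity)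
      have : (1 : ℝ) ≤ 2 ^ n := one_le_pow₀ (by norm_num)
      nlinarith
    have h3 : ‖c (n + 1) - c n‖ * ((2 : ℝ) ^ (1 / r)) ^ n ≤ 2 * A := by
      have h4 : ENNReal.ofReal (‖c (n + 1) - c n‖ *
          (((2 : ℝ) * 2 ^ n) * (2 * 2 ^ n)) ^ (1 / r)) ≤ ENNReal.ofReal (2 * A) := by
        rw [ENNReal.ofReal_mul (norm_nonneg _), ofReal_norm,
          ← ENNReal.ofReal_rpow_of_nonneg (by positivity) (by positivity),
          ENNReal.ofReal_mul (p := 2 * 2 ^ n) (by positivity), two_mul (A : ℝ),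
          ENNReal.ofReal_add (by positivity) (by positivity), ENNReal.ofReal_coe_nnreal]
        exact h1
      rw [ENNReal.ofReal_le_ofReal_iff (by positivity)] at h4
      refine le_trans ?_ h4
      gcongr
    rw [dist_comm, dist_eq_norm, Real.rpow_neg (by norm_num), inv_pow, ← div_eq_mul_inv,
      le_div_iff₀ (by positivity)]
    exact h3
  have hcs : CauchySeq c := cauchySeq_of_le_geometric _ _
    (Real.rpow_lt_one_of_one_lt_of_neg (by norm_num) (by
      have : 0 < 1 / r := by positivity
      linarith)) hstep
  obtain ⟨c₀, hc₀⟩ := cauchySeq_tendsto_of_complete hcs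
  have hlim : ∀ x, Tendsto (fun n => osc b (bigBox n) x) atTop (𝓝 (b x - c₀)) := by
    intro x
    refine (tendsto_const_nhds.sub hc₀).congr' ?_
    filter_upwards [eventually_mem_bigBox x] with n hn
    rw [osc_of_mem hn]
  refine ⟨c₀, hb.aestronglyMeasurable.sub aestronglyMeasurable_const,
    (Lp.eLpNorm_lim_le_liminf_eLpNorm hm _ (ae_of_all _ hlim)).trans ?_⟩
  exact liminf_le_of_le (by isBoundedDefault) fun c hc => by
    obtain ⟨n, hn⟩ := hc.exists
    exact hn.trans (hA n)

/-- The lower bound: a bounded commutator forces `b` to be a constant plus an `L^r` function. -/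
lemma exists_const_eLpNorm_sub_le_mul {p q r : ℝ} (hq : 1 < q) (hqp : q < p)
    (hr : 1 / r = 1 / q - 1 / p) :
    ∃ K : ℝ≥0, ∀ {b : ℂ → ℂ}, LocallyIntegrable b volume → ∀ {C : ℝ≥0},
      BeurlingCommutatorBound b (ENNReal.ofReal p) (ENNReal.ofReal q) C →
      ∃ c : ℂ, AEStronglyMeasurable (fun z => b z - c) volume ∧
        eLpNorm (fun z => b z - c) (ENNReal.ofReal r) volume ≤ K * C := by
  have hq0 : 0 < q := by linarith
  have hp0 : 0 < p := by linarith
  have hpq : 1 / p < 1 / q := one_div_lt_one_div_of_lt hq0 hqp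
  have hp1 : 0 < 1 / p := by positivity
  have hq1 : 1 / q < 1 := by rw [div_lt_one hq0]; exact hq
  have hr0 : 0 < r := by
    have : 0 < 1 / r := by rw [hr]; linarith
    exact one_div_pos.1 this
  have hr1 : 1 < r := by
    rw [← one_div_lt_one_div (by positivity) (by norm_num), hr]; linarith
  have hqq := Real.HolderConjugate.conjExponent hq
  have hrs := Real.HolderConjugate.conjExponent hr1
  have e1 := hqq.inv_add_inv_eq_one
  have e2 := hrs.inv_add_inv_eq_one
  obtain ⟨K, hK⟩ := exists_enorm_integral_mul_osc_le hp0 hqq hrs.symm.lt (by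
    simp only [one_div] at hr ⊢; linarith)
  refine ⟨K, fun {b} hb {C} hC => ?_⟩
  obtain ⟨c, hc1, hc2⟩ := exists_const_eLpNorm_sub_le hb hr1 (A := K * C) fun n =>
    eLpNorm_osc_le hb hrs (bigBox_pos n) fun f hf hfc => by
      push_cast
      exact hK hb hC hf hfc (bigBox_pos n)
  exact ⟨c, hc1, by simpa using hc2⟩

/-! ### The `L²` bound -/

/-- Convolution of complex-valued functions on the plane. -/
noncomputable def conv (g φ : ℂ → ℂ) (z : ℂ) : ℂ := ∫ h, g h * φ (z - h)

lemma conv_eq_convolution (g φ : ℂ → ℂ) :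
    conv g φ = convolution g φ (ContinuousLinearMap.mul ℝ ℂ) volume := rfl

lemma _root_.IsTestFunction.fderiv_apply {φ : ℂ → ℂ} (hφ : IsTestFunction φ) (v : ℂ) :
    IsTestFunction (fun y => fderiv ℝ φ y v) := by
  refine ⟨?_, hφ.2.fderiv_apply (𝕜 := ℝ) v⟩
  exact (hφ.1.fderiv_right (m := (⊤ : ℕ∞)) (by simp)).clm_apply contDiff_const

lemma hasFDerivAt_conv {g φ : ℂ → ℂ} (hg : LocallyIntegrable g volume) (hφ : IsTestFunction φ)
    (z : ℂ) : DifferentiableAt ℝ (conv g φ) z ∧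
      ∀ v, fderiv ℝ (conv g φ) z v = conv g (fun y => fderiv ℝ φ y v) z := by
  have h1 : ContDiff ℝ 1 φ := hφ.1.of_le (by exact_mod_cast le_top)
  have h := hφ.2.hasFDerivAt_convolution_right (ContinuousLinearMap.mul ℝ ℂ) hg h1 z
  rw [← conv_eq_convolution] at h
  refine ⟨h.differentiableAt, fun v => ?_⟩
  rw [h.fderiv, convolution_precompR_apply _ hg (hφ.2.fderiv ℝ)
    (h1.continuous_fderiv one_ne_zero)]
  rfl

lemma conv_fderiv_eq {g φ : ℂ → ℂ} (hg : ContDiff ℝ 1 g) (hφ : IsTestFunction φ) (z v : ℂ) :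
    conv g (fun y => fderiv ℝ φ y v) z = conv (fun y => fderiv ℝ g y v) φ z := by
  have hψ : ∀ h, HasFDerivAt (fun h => φ (z - h)) (-fderiv ℝ φ (z - h)) h := by
    intro h
    have h1 : HasFDerivAt φ (fderiv ℝ φ (z - h)) (z - h) :=
      (hφ.1.differentiable (by simp) (z - h)).hasFDerivAt
    have h2 : HasFDerivAt (fun h : ℂ => z - h) (-ContinuousLinearMap.id ℝ ℂ) h :=
      (hasFDerivAt_id h).const_sub z
    have := h1.comp h h2
    convert! this using 1
    ext; simp
  have hfd : ∀ h, fderiv ℝ (fun h => φ (z - h)) h v = -fderiv ℝ φ (z - h) v := fun h => by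
    rw [(hψ h).fderiv]; rfl
  have hcs : ∀ {χ : ℂ → ℂ}, IsTestFunction χ → HasCompactSupport fun h => χ (z - h) := fun hχ =>
    hχ.2.comp_homeomorph (Homeomorph.subLeft z)
  have hint : ∀ {G χ : ℂ → ℂ}, Continuous G → IsTestFunction χ →
      Integrable (fun h => G h * χ (z - h)) volume := fun {G χ} hG hχ => by
    have := hχ.continuous
    exact Continuous.integrable_of_hasCompactSupport (by fun_prop) (hcs hχ).mul_left
  have hgd : Continuous fun y => fderiv ℝ g y v :=
    (hg.continuous_fderiv one_ne_zero).clm_apply continuous_const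
  have key := integral_mul_fderiv_eq_neg_fderiv_mul_of_integrable (μ := volume) (f := g)
    (g := fun h => φ (z - h)) (v := v) (hint hgd hφ)
    (by simp only [hfd, mul_neg]; exact (hint hg.continuous (hφ.fderiv_apply v)).neg)
    (hint hg.continuous hφ) (fun x _ => hg.differentiable one_ne_zero x)
    (fun x _ => (hψ x).differentiableAt)
  simp only [hfd, mul_neg, integral_neg, neg_inj] at key
  exact key

lemma exists_conv_bound {g φ : ℂ → ℂ} {B : ℝ} {k : ℕ} (hg : ∀ h, ‖g h‖ ≤ B * ((1 + ‖h‖) ^ k)⁻¹)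
    (hφ : IsTestFunction φ) : ∃ C, ∀ z, ‖conv g φ z‖ ≤ C * ((1 + ‖z‖) ^ k)⁻¹ := by
  obtain ⟨R, hR1, hR⟩ := exists_support_radius hφ
  have hB : 0 ≤ B := by simpa using (norm_nonneg _).trans (hg 0)
  refine ⟨B * (1 + R) ^ k * ∫ y, ‖φ y‖, fun z => ?_⟩
  have h1 : Integrable (fun h => B * (1 + R) ^ k * ((1 + ‖z‖) ^ k)⁻¹ * ‖φ (z - h)‖) volume :=
    ((hφ.integrable.comp_sub_left z).norm).const_mul _
  refine (norm_integral_le_of_norm_le h1 (ae_of_all _ fun h => ?_)).trans_eq ?_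
  · rw [norm_mul]
    rcases lt_or_ge R ‖z - h‖ with hh | hh
    · simp [hR _ hh]
    · gcongr
      refine (hg h).trans ?_
      rw [mul_assoc]
      gcongr
      rw [← div_eq_mul_inv, le_div_iff₀ (by positivity), inv_mul_le_iff₀ (by positivity),
        ← mul_pow]
      gcongr
      have := norm_sub_norm_le z h
      nlinarith [norm_nonneg h]
  · rw [integral_const_mul, integral_sub_left_eq_self (fun y => ‖φ y‖) volume z]
    ring

/-- `∫ ∂ᵥF ∂ᵤG = ∫ ∂ᵤF ∂ᵥG` for functions with the decay of a Cauchy transform: both sides equal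
`-∫ F ∂ᵥ∂ᵤG`. -/
lemma integral_fderiv_mul_fderiv_comm {F G : ℂ → ℂ} {B : ℝ} (v u : ℂ)
    (hF : ContDiff ℝ 1 F) (hG : ContDiff ℝ 2 G)
    (bF : ∀ z, ‖F z‖ ≤ B * ((1 + ‖z‖) ^ 1)⁻¹)
    (bFv : ∀ z, ‖fderiv ℝ F z v‖ ≤ B * ((1 + ‖z‖) ^ 2)⁻¹)
    (bFu : ∀ z, ‖fderiv ℝ F z u‖ ≤ B * ((1 + ‖z‖) ^ 2)⁻¹)
    (bGv : ∀ z, ‖fderiv ℝ G z v‖ ≤ B * ((1 + ‖z‖) ^ 2)⁻¹)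
    (bGu : ∀ z, ‖fderiv ℝ G z u‖ ≤ B * ((1 + ‖z‖) ^ 2)⁻¹)
    (bGvu : ∀ z, ‖fderiv ℝ (fun z => fderiv ℝ G z v) z u‖ ≤ B * ((1 + ‖z‖) ^ 2)⁻¹) :
    ∫ z, fderiv ℝ F z v * fderiv ℝ G z u = ∫ z, fderiv ℝ F z u * fderiv ℝ G z v := by
  have hB : 0 ≤ B := by simpa using (norm_nonneg _).trans (bF 0)
  have hG1 : ContDiff ℝ 1 (fderiv ℝ G) := hG.fderiv_right (by norm_num)
  have hGd : ∀ w : ℂ, ContDiff ℝ 1 (fun z => fderiv ℝ G z w) := fun w =>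
    hG1.clm_apply contDiff_const
  have hFd : ∀ w : ℂ, Continuous fun z => fderiv ℝ F z w := fun w =>
    (hF.continuous_fderiv one_ne_zero).clm_apply continuous_const
  have hGdd : ∀ w w' : ℂ, Continuous fun z => fderiv ℝ (fun z => fderiv ℝ G z w) z w' :=
    fun w w' => ((hGd w).continuous_fderiv one_ne_zero).clm_apply continuous_const
  have hint : ∀ {f g : ℂ → ℂ}, Continuous f → Continuous g →
      (∀ z, ‖f z‖ ≤ B * ((1 + ‖z‖) ^ 1)⁻¹) → (∀ z, ‖g z‖ ≤ B * ((1 + ‖z‖) ^ 2)⁻¹) →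
      Integrable (fun z => f z * g z) volume := by
    intro f g hf hg bf bg
    have h3 := integrable_one_add_norm (E := ℂ) (μ := volume) (r := 3)
      (by rw [Complex.finrank_real_complex]; norm_num)
    refine (h3.const_mul (B * B)).mono' (hf.mul hg).aestronglyMeasurable (ae_of_all _ fun z => ?_)
    rw [norm_mul]
    have h0 : (0 : ℝ) < 1 + ‖z‖ := by positivity
    calc _ ≤ (B * ((1 + ‖z‖) ^ 1)⁻¹) * (B * ((1 + ‖z‖) ^ 2)⁻¹) := by
          gcongr
          · exact bf z
          · exact bg z
      _ = _ := by
          rw [Real.rpow_neg h0.le]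
          norm_cast
          field_simp
  have weak : ∀ {f : ℂ → ℂ}, (∀ z, ‖f z‖ ≤ B * ((1 + ‖z‖) ^ 2)⁻¹) →
      ∀ z, ‖f z‖ ≤ B * ((1 + ‖z‖) ^ 1)⁻¹ := by
    intro f bf z
    refine (bf z).trans ?_
    gcongr
    · linarith [norm_nonneg z]
    · norm_num
  have symm : ∀ z, fderiv ℝ (fun z => fderiv ℝ G z u) z v =
      fderiv ℝ (fun z => fderiv ℝ G z v) z u := by
    intro z
    have h1 : ∀ w w' : ℂ, fderiv ℝ (fun z => fderiv ℝ G z w) z w' =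
        fderiv ℝ (fderiv ℝ G) z w' w := fun w w' => by
      rw [fderiv_clm_apply (hG1.differentiable one_ne_zero z) (differentiableAt_const _)]
      simp
    rw [h1, h1]
    exact (hG.contDiffAt.isSymmSndFDerivAt (by simp)) v u
  have i1 := integral_mul_fderiv_eq_neg_fderiv_mul_of_integrable (μ := volume) (f := F)
    (g := fun z => fderiv ℝ G z u) (v := v)
    (hint (hFd v) (hGd u).continuous (weak bFv) bGu)
    (by simp only [symm]; exact hint hF.continuous (hGdd v u) bF bGvu)
    (hint hF.continuous (hGd u).continuous bF bGu)
    (fun x _ => hF.differentiable one_ne_zero x) (fun x _ => (hGd u).differentiable one_ne_zero x)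
  have i2 := integral_mul_fderiv_eq_neg_fderiv_mul_of_integrable (μ := volume) (f := F)
    (g := fun z => fderiv ℝ G z v) (v := u)
    (hint (hFd u) (hGd v).continuous (weak bFu) bGv)
    (hint hF.continuous (hGdd v u) bF bGvu)
    (hint hF.continuous (hGd v).continuous bF bGv)
    (fun x _ => hF.differentiable one_ne_zero x) (fun x _ => (hGd v).differentiable one_ne_zero x)
  simp only [symm] at i1
  rw [i1] at i2
  exact neg_inj.1 i2

/-- A smooth approximation of the Cauchy kernel `1 / h`. -/
noncomputable def cauchyKernel (δ : ℝ) (h : ℂ) : ℂ :=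
  (starRingEnd ℂ) h * (((‖h‖ ^ 2 + δ ^ 2)⁻¹ : ℝ) : ℂ)

lemma hasFDerivAt_cauchyKernel {δ : ℝ} (hδ : 0 < δ) (h : ℂ) :
    ∃ L : ℂ →L[ℝ] ℂ, HasFDerivAt (cauchyKernel δ) L h ∧ ∀ v, L v =
      (starRingEnd ℂ) v * (((‖h‖ ^ 2 + δ ^ 2)⁻¹ : ℝ) : ℂ) - (starRingEnd ℂ) h *
        ((2 * (v * (starRingEnd ℂ) h).re * ((‖h‖ ^ 2 + δ ^ 2) ^ 2)⁻¹ : ℝ) : ℂ) := by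
  have h1 : HasFDerivAt (fun h : ℂ => (starRingEnd ℂ) h) (Complex.conjCLE : ℂ →L[ℝ] ℂ) h :=
    Complex.conjCLE.hasFDerivAt
  have hN : ‖h‖ ^ 2 + δ ^ 2 ≠ 0 := by positivity
  have h2 : HasFDerivAt (fun h : ℂ => ‖h‖ ^ 2 + δ ^ 2) (2 • (innerSL ℝ h)) h :=
    (hasStrictFDerivAt_norm_sq h).hasFDerivAt.add_const _
  have h3 := (hasDerivAt_inv hN).comp_hasFDerivAt h h2
  have h4 : HasFDerivAt (fun h : ℂ => (((‖h‖ ^ 2 + δ ^ 2)⁻¹ : ℝ) : ℂ)) _ h :=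
    Complex.ofRealCLM.hasFDerivAt.comp h h3
  refine ⟨_, h1.mul h4, fun v => ?_⟩
  simp [Complex.inner]
  ring

lemma contDiff_cauchyKernel {δ : ℝ} (hδ : 0 < δ) {n : ℕ∞} : ContDiff ℝ n (cauchyKernel δ) := by
  have h1 : ContDiff ℝ n (fun h : ℂ => (‖h‖ ^ 2 + δ ^ 2)⁻¹) :=
    ContDiff.inv ((contDiff_norm_sq ℝ).add contDiff_const) fun h => by positivity
  exact Complex.conjCLE.contDiff.mul (Complex.ofRealCLM.contDiff.comp h1)

lemma fderiv_cauchyKernel {δ : ℝ} (hδ : 0 < δ) (h v : ℂ) : fderiv ℝ (cauchyKernel δ) h v =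
      (starRingEnd ℂ) v * (((‖h‖ ^ 2 + δ ^ 2)⁻¹ : ℝ) : ℂ) - (starRingEnd ℂ) h *
        ((2 * (v * (starRingEnd ℂ) h).re * ((‖h‖ ^ 2 + δ ^ 2) ^ 2)⁻¹ : ℝ) : ℂ) := by
  obtain ⟨L, hL, hLv⟩ := hasFDerivAt_cauchyKernel hδ h
  rw [hL.fderiv, hLv]

lemma inv_sq_add_sq_le {δ : ℝ} (hδ : 0 < δ) (h : ℂ) :
    (‖h‖ ^ 2 + δ ^ 2)⁻¹ ≤ 2 * (1 + (δ ^ 2)⁻¹) * ((1 + ‖h‖) ^ 2)⁻¹ := by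
  rw [← div_eq_mul_inv, le_div_iff₀ (by positivity), inv_mul_le_iff₀ (by positivity)]
  have h1 : (‖h‖ ^ 2 + δ ^ 2) * (2 * (1 + (δ ^ 2)⁻¹)) =
      2 * ‖h‖ ^ 2 + 2 * (‖h‖ ^ 2 * (δ ^ 2)⁻¹) + 2 * δ ^ 2 + 2 := by
    field_simp; ring
  rw [h1]
  have : 0 ≤ ‖h‖ ^ 2 * (δ ^ 2)⁻¹ := by positivity
  nlinarith [sq_nonneg (‖h‖ - 1), sq_nonneg δ]

lemma norm_cauchyKernel_le {δ : ℝ} (hδ : 0 < δ) (h : ℂ) :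
    ‖cauchyKernel δ h‖ ≤ 2 * (1 + (δ ^ 2)⁻¹) * ((1 + ‖h‖) ^ 1)⁻¹ := by
  rw [cauchyKernel, norm_mul, RCLike.norm_conj, Complex.norm_real,
    Real.norm_of_nonneg (by positivity)]
  calc _ ≤ ‖h‖ * (2 * (1 + (δ ^ 2)⁻¹) * ((1 + ‖h‖) ^ 2)⁻¹) := by
        gcongr; exact inv_sq_add_sq_le hδ h
    _ ≤ (1 + ‖h‖) * (2 * (1 + (δ ^ 2)⁻¹) * ((1 + ‖h‖) ^ 2)⁻¹) := by gcongr; linarith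
    _ = _ := by
        have : 1 + ‖h‖ ≠ 0 := by positivity
        field_simp

lemma norm_fderiv_cauchyKernel_le {δ : ℝ} (hδ : 0 < δ) (h : ℂ) {v : ℂ} (hv : ‖v‖ = 1) :
    ‖fderiv ℝ (cauchyKernel δ) h v‖ ≤ 3 * (2 * (1 + (δ ^ 2)⁻¹)) * ((1 + ‖h‖) ^ 2)⁻¹ := by
  rw [fderiv_cauchyKernel hδ]
  set N := ‖h‖ ^ 2 + δ ^ 2 with hN
  have hNpos : 0 < N := by positivity
  have h1 : |(v * (starRingEnd ℂ) h).re| ≤ ‖h‖ := by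
    refine (Complex.abs_re_le_norm _).trans ?_
    rw [norm_mul, hv, RCLike.norm_conj, one_mul]
  calc _ ≤ N⁻¹ + ‖h‖ * (2 * ‖h‖ * (N ^ 2)⁻¹) := by
        refine (norm_sub_le _ _).trans (add_le_add (le_of_eq ?_) ?_)
        · rw [norm_mul, RCLike.norm_conj, hv, Complex.norm_real,
            Real.norm_of_nonneg (by positivity), one_mul]
        · rw [norm_mul, RCLike.norm_conj, Complex.norm_real, Real.norm_eq_abs, abs_mul, abs_mul,
            abs_of_pos (by norm_num : (0 : ℝ) < 2), abs_of_pos (by positivity : 0 < (N ^ 2)⁻¹)]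
          gcongr
    _ ≤ N⁻¹ + 2 * N * (N ^ 2)⁻¹ := by
        have : ‖h‖ * (2 * ‖h‖ * (N ^ 2)⁻¹) = 2 * ‖h‖ ^ 2 * (N ^ 2)⁻¹ := by ring
        rw [this]
        gcongr
        rw [hN]; nlinarith [sq_nonneg δ]
    _ = 3 * N⁻¹ := by field_simp; ring
    _ ≤ _ := by
        rw [mul_assoc]
        gcongr
        exact inv_sq_add_sq_le hδ h

/-- The Wirtinger derivative `∂` of the regularized Cauchy kernel, an approximation of `-h⁻²`. -/
noncomputable def regKernel (δ : ℝ) (h : ℂ) : ℂ :=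
  -((starRingEnd ℂ) h) ^ 2 * ((((‖h‖ ^ 2 + δ ^ 2) ^ 2)⁻¹ : ℝ) : ℂ)

/-- The Wirtinger derivative `∂̄` of the regularized Cauchy kernel, a positive approximation of a
multiple of the Dirac mass. -/
noncomputable def deltaKernel (δ : ℝ) (h : ℂ) : ℝ := δ ^ 2 * ((‖h‖ ^ 2 + δ ^ 2) ^ 2)⁻¹

lemma regKernel_eq {δ : ℝ} (hδ : 0 < δ) (h : ℂ) : regKernel δ h =
    1 / 2 * (fderiv ℝ (cauchyKernel δ) h 1 -
      Complex.I * fderiv ℝ (cauchyKernel δ) h Complex.I) := by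
  rw [fderiv_cauchyKernel hδ, fderiv_cauchyKernel hδ, regKernel]
  have e : (starRingEnd ℂ) h = (h.re : ℂ) - h.im * Complex.I := by
    apply Complex.ext <;> simp
  simp only [map_one, one_mul, Complex.conj_re, Complex.conj_I, Complex.mul_re, Complex.I_re,
    Complex.I_im, Complex.conj_im]
  rw [e]
  push_cast
  ring_nf
  simp only [Complex.I_sq]
  ring

lemma deltaKernel_eq {δ : ℝ} (hδ : 0 < δ) (h : ℂ) : (deltaKernel δ h : ℂ) =
    1 / 2 * (fderiv ℝ (cauchyKernel δ) h 1 +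
      Complex.I * fderiv ℝ (cauchyKernel δ) h Complex.I) := by
  rw [fderiv_cauchyKernel hδ, fderiv_cauchyKernel hδ, deltaKernel]
  have e : (starRingEnd ℂ) h = (h.re : ℂ) - h.im * Complex.I := by
    apply Complex.ext <;> simp
  have e2 : ‖h‖ ^ 2 = h.re ^ 2 + h.im ^ 2 := by
    rw [← Complex.normSq_eq_norm_sq, Complex.normSq_apply]; ring
  have hN : ((h.re : ℂ) ^ 2 + h.im ^ 2 + δ ^ 2) ≠ 0 := by
    have : h.re ^ 2 + h.im ^ 2 + δ ^ 2 ≠ 0 := by positivity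
    exact_mod_cast this
  simp only [map_one, one_mul, Complex.conj_re, Complex.conj_I, Complex.mul_re, Complex.I_re,
    Complex.I_im, Complex.conj_im, e2]
  rw [e]
  push_cast
  field_simp
  ring_nf
  simp only [Complex.I_sq]
  ring

lemma contDiff_conv {g φ : ℂ → ℂ} (hg : LocallyIntegrable g volume) (hφ : IsTestFunction φ)
    (n : ℕ∞) : ContDiff ℝ n (conv g φ) :=
  hφ.2.contDiff_convolution_right (n := n) (ContinuousLinearMap.mul ℝ ℂ) hg
    (hφ.1.of_le (by exact_mod_cast le_top))

lemma integrable_conv_integrand {g φ : ℂ → ℂ} (hg : Continuous g) (hφ : IsTestFunction φ) (z : ℂ) :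
    Integrable (fun h => g h * φ (z - h)) volume := by
  have := hφ.continuous
  exact Continuous.integrable_of_hasCompactSupport (by fun_prop)
    (hφ.2.comp_homeomorph (Homeomorph.subLeft z)).mul_left

lemma continuous_regKernel {δ : ℝ} (hδ : 0 < δ) : Continuous (regKernel δ) := by
  have h1 : Continuous fun h : ℂ => (((‖h‖ ^ 2 + δ ^ 2) ^ 2)⁻¹ : ℝ) :=
    Continuous.inv₀ (by fun_prop) fun h => by positivity
  exact (Complex.continuous_conj.pow 2).neg.mul (Complex.continuous_ofReal.comp h1)

lemma continuous_deltaKernel {δ : ℝ} (hδ : 0 < δ) : Continuous (deltaKernel δ) := by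
  have h1 : Continuous fun h : ℂ => (((‖h‖ ^ 2 + δ ^ 2) ^ 2)⁻¹ : ℝ) :=
    Continuous.inv₀ (by fun_prop) fun h => by positivity
  exact continuous_const.mul h1

lemma deltaKernel_nonneg (δ : ℝ) (h : ℂ) : 0 ≤ deltaKernel δ h := by
  rw [deltaKernel]; positivity

/-- The two Wirtinger derivatives of the convolution of the regularized Cauchy kernel with a test
function have the same `L²` norm. -/
lemma integral_norm_sq_conv_regKernel {δ : ℝ} (hδ : 0 < δ) {φ : ℂ → ℂ} (hφ : IsTestFunction φ) :
    Integrable (fun z => ‖conv (regKernel δ) φ z‖ ^ 2) volume ∧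
    Integrable (fun z => ‖conv (fun h => (deltaKernel δ h : ℂ)) φ z‖ ^ 2) volume ∧
    ∫ z, ‖conv (regKernel δ) φ z‖ ^ 2 =
      ∫ z, ‖conv (fun h => (deltaKernel δ h : ℂ)) φ z‖ ^ 2 := by
  have hc : ContDiff ℝ 1 (cauchyKernel δ) := contDiff_cauchyKernel hδ (n := 1)
  have hcl : LocallyIntegrable (cauchyKernel δ) volume := hc.continuous.locallyIntegrable
  set w : ℂ → ℂ → ℂ := fun v z => conv (fun y => fderiv ℝ (cauchyKernel δ) y v) φ z with hw
  set F := conv (cauchyKernel δ) φ with hF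
  have hDF : ∀ v z, fderiv ℝ F z v = w v z := fun v z => by
    rw [(hasFDerivAt_conv hcl hφ z).2 v, conv_fderiv_eq hc hφ]
  have hDDF : ∀ v u z, fderiv ℝ (fun z => fderiv ℝ F z v) z u =
      conv (fun y => fderiv ℝ (cauchyKernel δ) y u) (fun y => fderiv ℝ φ y v) z := fun v u z => by
    have : (fun z => fderiv ℝ F z v) = conv (cauchyKernel δ) (fun y => fderiv ℝ φ y v) := by
      ext z; exact (hasFDerivAt_conv hcl hφ z).2 v
    rw [this, (hasFDerivAt_conv hcl (hφ.fderiv_apply v) z).2 u,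
      conv_fderiv_eq hc (hφ.fderiv_apply v)]
  have hFs : ∀ n : ℕ∞, ContDiff ℝ n F := fun n => contDiff_conv hcl hφ n
  have hFd : Differentiable ℝ F := (hFs 1).differentiable (by simp)
  have hDc : ∀ v, Continuous fun y => fderiv ℝ (cauchyKernel δ) y v := fun v =>
    (hc.continuous_fderiv one_ne_zero).clm_apply continuous_const
  have hwc : ∀ v, Continuous (w v) := fun v =>
    (contDiff_conv (hDc v).locallyIntegrable hφ 0).continuous
  obtain ⟨B0, h0⟩ := exists_conv_bound (k := 1) (fun h => norm_cauchyKernel_le hδ h) hφ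
  have hb : ∀ v : ℂ, ‖v‖ = 1 → ∃ B, ∀ z, ‖w v z‖ ≤ B * ((1 + ‖z‖) ^ 2)⁻¹ := fun v hv =>
    exists_conv_bound (k := 2) (fun h => norm_fderiv_cauchyKernel_le hδ h hv) hφ
  obtain ⟨B1, h1⟩ := hb 1 norm_one
  obtain ⟨B2, h2⟩ := hb Complex.I Complex.norm_I
  obtain ⟨B3, h3⟩ := exists_conv_bound (k := 2)
    (fun h => norm_fderiv_cauchyKernel_le hδ h Complex.norm_I) (hφ.fderiv_apply 1)
  obtain ⟨B, hB0, hB1, hB2, hB3⟩ : ∃ B, B0 ≤ B ∧ B1 ≤ B ∧ B2 ≤ B ∧ B3 ≤ B :=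
    ⟨max (max B0 B1) (max B2 B3), by simp, by simp, by simp, by simp⟩
  have k1 : ∀ z, ‖w 1 z‖ ≤ B * ((1 + ‖z‖) ^ 2)⁻¹ := fun z => (h1 z).trans (by gcongr)
  have k2 : ∀ z, ‖w Complex.I z‖ ≤ B * ((1 + ‖z‖) ^ 2)⁻¹ := fun z => (h2 z).trans (by gcongr)
  set G : ℂ → ℂ := fun z => (starRingEnd ℂ) (F z) with hG
  have hDG : ∀ v z, fderiv ℝ G z v = (starRingEnd ℂ) (w v z) := fun v z => by
    have : HasFDerivAt G ((Complex.conjCLE : ℂ →L[ℝ] ℂ).comp (fderiv ℝ F z)) z :=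
      (Complex.conjCLE : ℂ →L[ℝ] ℂ).hasFDerivAt.comp z (hFd z).hasFDerivAt
    rw [this.fderiv]
    simp [hDF]
  have hGs : ContDiff ℝ 2 G := Complex.conjCLE.contDiff.comp (hFs 2)
  have key := integral_fderiv_mul_fderiv_comm (F := F) (G := G) (B := B) 1 Complex.I (hFs 1) hGs
    (fun z => (h0 z).trans (by gcongr)) (fun z => by rw [hDF]; exact k1 z)
    (fun z => by rw [hDF]; exact k2 z)
    (fun z => by rw [hDG, RCLike.norm_conj]; exact k1 z)
    (fun z => by rw [hDG, RCLike.norm_conj]; exact k2 z)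
    (fun z => by
      have hdd : HasFDerivAt (fun z => fderiv ℝ G z 1)
          ((Complex.conjCLE : ℂ →L[ℝ] ℂ).comp (fderiv ℝ (fun z => fderiv ℝ F z 1) z)) z := by
        have e : (fun z => fderiv ℝ G z 1) = fun z => (starRingEnd ℂ) (fderiv ℝ F z 1) := by
          ext z; rw [hDG, hDF]
        rw [e]
        have hd : Differentiable ℝ fun z => fderiv ℝ F z 1 :=
          (((hFs 2).fderiv_right (m := 1) (by norm_num)).clm_apply contDiff_const).differentiable
            one_ne_zero
        exact (Complex.conjCLE : ℂ →L[ℝ] ℂ).hasFDerivAt.comp z (hd z).hasFDerivAt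
      rw [hdd.fderiv]
      simp only [ContinuousLinearMap.comp_apply, ContinuousLinearEquiv.coe_coe,
        Complex.conjCLE_apply, RCLike.norm_conj]
      rw [hDDF]
      exact (h3 z).trans (by gcongr))
  simp only [hDF, hDG] at key
  -- the cross terms `w 1 * conj (w I)` have a real integral
  have hint : ∀ {f g : ℂ → ℂ}, Continuous f → Continuous g →
      (∀ z, ‖f z‖ ≤ B * ((1 + ‖z‖) ^ 2)⁻¹) → (∀ z, ‖g z‖ ≤ B * ((1 + ‖z‖) ^ 2)⁻¹) →
      Integrable (fun z => f z * g z) volume := by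
    intro f g hf hg bf bg
    have hf2 : MemLp f 2 volume := (memLp_decay (t := 2) (by norm_num)).of_le_mul (c := B)
      hf.aestronglyMeasurable (ae_of_all _ fun z => by
        rw [Real.norm_of_nonneg (by positivity)]; exact bf z)
    have hg2 : MemLp g 2 volume := (memLp_decay (t := 2) (by norm_num)).of_le_mul (c := B)
      hg.aestronglyMeasurable (ae_of_all _ fun z => by
        rw [Real.norm_of_nonneg (by positivity)]; exact bg z)
    exact hf2.integrable_mul hg2
  have kc : ∀ v, Continuous fun z => (starRingEnd ℂ) (w v z) := fun v =>
    Complex.continuous_conj.comp (hwc v)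
  have hI12 : Integrable (fun z => w 1 z * (starRingEnd ℂ) (w Complex.I z)) volume :=
    hint (hwc _) (kc _) k1 (fun z => by rw [RCLike.norm_conj]; exact k2 z)
  have hreal : ∫ z, (w 1 z * (starRingEnd ℂ) (w Complex.I z)).im = 0 := by
    have e1 : ∫ z, w Complex.I z * (starRingEnd ℂ) (w 1 z) =
        (starRingEnd ℂ) (∫ z, w 1 z * (starRingEnd ℂ) (w Complex.I z)) := by
      rw [← integral_conj]
      simp [mul_comm]
    rw [e1] at key
    have h2 := Complex.conj_eq_iff_im.1 key.symm
    have h3 : ∫ z, (w 1 z * (starRingEnd ℂ) (w Complex.I z)).im =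
      (∫ z, w 1 z * (starRingEnd ℂ) (w Complex.I z)).im := integral_im hI12
    rw [h3, h2]
  have eK : ∀ z, conv (regKernel δ) φ z = 1 / 2 * (w 1 z - Complex.I * w Complex.I z) := by
    intro z
    simp only [hw, conv, regKernel_eq hδ]
    rw [← integral_const_mul Complex.I, ← integral_sub (integrable_conv_integrand (hDc 1) hφ z)
      ((integrable_conv_integrand (hDc Complex.I) hφ z).const_mul _), ← integral_const_mul]
    congr 1; ext h; ring
  have eP : ∀ z, conv (fun h => (deltaKernel δ h : ℂ)) φ z =
      1 / 2 * (w 1 z + Complex.I * w Complex.I z) := by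
    intro z
    simp only [hw, conv, deltaKernel_eq hδ]
    rw [← integral_const_mul Complex.I, ← integral_add (integrable_conv_integrand (hDc 1) hφ z)
      ((integrable_conv_integrand (hDc Complex.I) hφ z).const_mul _), ← integral_const_mul]
    congr 1; ext h; ring
  have hsq : ∀ s : ℂ, ‖s‖ ≤ 1 →
      Integrable (fun z => ‖1 / 2 * (w 1 z + s * w Complex.I z)‖ ^ 2) volume := by
    intro s hs
    have hf2 : MemLp (fun z => 1 / 2 * (w 1 z + s * w Complex.I z)) 2 volume := by
      refine (memLp_decay (t := 2) (by norm_num)).of_le_mul (c := B)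
        (continuous_const.mul ((hwc 1).add (continuous_const.mul
          (hwc Complex.I)))).aestronglyMeasurable (ae_of_all _ fun z => ?_)
      rw [Real.norm_of_nonneg (by positivity), norm_mul]
      have : ‖w 1 z + s * w Complex.I z‖ ≤ B * ((1 + ‖z‖) ^ 2)⁻¹ + 1 * (B * ((1 + ‖z‖) ^ 2)⁻¹) := by
        refine (norm_add_le _ _).trans (add_le_add (k1 z) ?_)
        rw [norm_mul]
        exact mul_le_mul hs (k2 z) (norm_nonneg _) zero_le_one
      have e : ‖(1 / 2 : ℂ)‖ = 1 / 2 := by simp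
      rw [e]; linarith
    exact (memLp_two_iff_integrable_sq_norm hf2.1).1 hf2
  have iK : Integrable (fun z => ‖conv (regKernel δ) φ z‖ ^ 2) volume :=
    (hsq (-Complex.I) (by simp)).congr (ae_of_all _ fun z => by simp only [eK]; congr 2; ring)
  have iP : Integrable (fun z => ‖conv (fun h => (deltaKernel δ h : ℂ)) φ z‖ ^ 2) volume :=
    (hsq Complex.I (by simp)).congr (ae_of_all _ fun z => by simp only [eP])
  refine ⟨iK, iP, ?_⟩
  rw [← sub_eq_zero, ← integral_sub iK iP]
  have hpt : ∀ z, ‖conv (regKernel δ) φ z‖ ^ 2 -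
      ‖conv (fun h => (deltaKernel δ h : ℂ)) φ z‖ ^ 2 =
      -(w 1 z * (starRingEnd ℂ) (w Complex.I z)).im := by
    intro z
    rw [eK, eP, ← Complex.normSq_eq_norm_sq, ← Complex.normSq_eq_norm_sq, Complex.normSq_apply,
      Complex.normSq_apply]
    simp
    ring
  simp only [hpt, integral_neg, hreal, neg_zero]

lemma eLpNorm_two_eq (f : ℂ → ℂ) :
    eLpNorm f 2 volume = (∫⁻ z, ‖f z‖ₑ ^ 2) ^ (1 / 2 : ℝ) := by
  rw [eLpNorm_eq_lintegral_rpow_enorm_toReal (by norm_num) (by norm_num)]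
  simp

/-- The mass of the kernel does not depend on the regularization, by scaling. -/
lemma lintegral_deltaKernel {δ : ℝ} (hδ : 0 < δ) :
    ∫⁻ h, ENNReal.ofReal (deltaKernel δ h) = ENNReal.ofReal (∫ h, deltaKernel 1 h) := by
  have hi : ∀ {δ : ℝ}, 0 < δ → Integrable (deltaKernel δ) volume := fun {δ} hδ => by
    have h4 := integrable_one_add_norm (E := ℂ) (μ := volume) (r := 4)
      (by rw [Complex.finrank_real_complex]; norm_num)
    refine (h4.const_mul (δ ^ 2 * (2 * (1 + (δ ^ 2)⁻¹)) ^ 2)).mono'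
      (continuous_deltaKernel hδ).aestronglyMeasurable (ae_of_all _ fun z => ?_)
    rw [Real.norm_of_nonneg (deltaKernel_nonneg _ _), deltaKernel, mul_assoc]
    have h0 : (0 : ℝ) < 1 + ‖z‖ := by positivity
    gcongr
    calc ((‖z‖ ^ 2 + δ ^ 2) ^ 2)⁻¹ = ((‖z‖ ^ 2 + δ ^ 2)⁻¹) ^ 2 := by rw [inv_pow]
      _ ≤ (2 * (1 + (δ ^ 2)⁻¹) * ((1 + ‖z‖) ^ 2)⁻¹) ^ 2 := by
          gcongr; exact inv_sq_add_sq_le hδ z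
      _ = _ := by
          rw [Real.rpow_neg h0.le, mul_pow]
          norm_cast
          rw [inv_pow, ← pow_mul]
  rw [← ofReal_integral_eq_lintegral_ofReal (hi hδ) (ae_of_all _ fun h => deltaKernel_nonneg _ _)]
  congr 1
  have h1 := Measure.integral_comp_smul volume (deltaKernel δ) δ
  have h2 : ∀ h : ℂ, deltaKernel δ (δ • h) = (δ ^ 2)⁻¹ * deltaKernel 1 h := fun h => by
    rw [deltaKernel, deltaKernel, norm_smul, Real.norm_of_nonneg hδ.le]
    have : (‖h‖ ^ 2 + 1 ^ 2) ≠ 0 := by positivity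
    have e : (δ * ‖h‖) ^ 2 + δ ^ 2 = δ ^ 2 * (‖h‖ ^ 2 + 1 ^ 2) := by ring
    rw [e]
    field_simp
  simp only [h2, integral_const_mul, Complex.finrank_real_complex, smul_eq_mul] at h1
  rw [abs_of_nonneg (by positivity)] at h1
  exact (mul_left_cancel₀ (by positivity) h1).symm

/-- Convolution with the positive kernel is bounded on `L²` by the mass of the kernel. -/
lemma lintegral_conv_deltaKernel_le {δ : ℝ} (hδ : 0 < δ) {φ : ℂ → ℂ} (hφ : IsTestFunction φ) :
    ∫⁻ z, ‖conv (fun h => (deltaKernel δ h : ℂ)) φ z‖ₑ ^ 2 ≤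
      ENNReal.ofReal (∫ h, deltaKernel 1 h) ^ 2 * ∫⁻ z, ‖φ z‖ₑ ^ 2 := by
  have hφc := hφ.continuous
  have hPc := continuous_deltaKernel hδ
  set P : ℂ → ℝ≥0∞ := fun h => ENNReal.ofReal (deltaKernel δ h) with hP
  have hPm : Measurable P := hPc.measurable.ennreal_ofReal
  set m := ENNReal.ofReal (∫ h, deltaKernel 1 h)
  have hm : ∫⁻ h, P h = m := lintegral_deltaKernel hδ
  have hφm : Measurable fun z => ‖φ z‖ₑ := hφc.measurable.enorm
  have h1 : ∀ z, ‖conv (fun h => (deltaKernel δ h : ℂ)) φ z‖ₑ ^ 2 ≤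
      m * ∫⁻ h, P h * ‖φ (z - h)‖ₑ ^ 2 := by
    intro z
    have hφz : Measurable fun h => ‖φ (z - h)‖ₑ := hφm.comp (measurable_const.sub measurable_id)
    have hs : ∀ h, P h ^ (1 / 2 : ℝ) * P h ^ (1 / 2 : ℝ) = P h := fun h => by
      rw [← ENNReal.rpow_add_of_nonneg _ _ (by norm_num) (by norm_num)]; norm_num
    have hs2 : ∀ h, (P h ^ (1 / 2 : ℝ)) ^ (2 : ℝ) = P h := fun h => by
      rw [← ENNReal.rpow_mul]; norm_num
    have a := ENNReal.lintegral_mul_le_Lp_mul_Lq volume (Real.HolderConjugate.two_two)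
      (f := fun h => P h ^ (1 / 2 : ℝ)) (g := fun h => P h ^ (1 / 2 : ℝ) * ‖φ (z - h)‖ₑ)
      (by fun_prop) (by fun_prop)
    simp only [Pi.mul_apply, ← mul_assoc, hs, ENNReal.mul_rpow_of_nonneg _ _ zero_le_two, hs2, hm]
      at a
    have b : ‖conv (fun h => (deltaKernel δ h : ℂ)) φ z‖ₑ ≤ ∫⁻ h, P h * ‖φ (z - h)‖ₑ := by
      refine (enorm_integral_le_lintegral_enorm _).trans_eq ?_
      congr 1; ext h
      rw [enorm_mul, hP]
      congr 1
      rw [← ofReal_norm, Complex.norm_real, Real.norm_of_nonneg (deltaKernel_nonneg _ _)]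
    refine (pow_le_pow_left' (b.trans a) 2).trans_eq ?_
    rw [mul_pow, ← ENNReal.rpow_natCast, ← ENNReal.rpow_mul, ← ENNReal.rpow_natCast,
      ← ENNReal.rpow_mul]
    norm_num
  calc _ ≤ ∫⁻ z, m * ∫⁻ h, P h * ‖φ (z - h)‖ₑ ^ 2 := lintegral_mono h1
    _ = m * ∫⁻ z, ∫⁻ h, P h * ‖φ (z - h)‖ₑ ^ 2 :=
        lintegral_const_mul' _ _ ENNReal.ofReal_ne_top
    _ = m * ∫⁻ h, ∫⁻ z, P h * ‖φ (z - h)‖ₑ ^ 2 := by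
        rw [lintegral_lintegral_swap]
        have : Continuous fun x : ℂ × ℂ => φ (x.1 - x.2) := by fun_prop
        exact ((hPm.comp measurable_snd).mul (this.measurable.enorm.pow_const 2)).aemeasurable
    _ = m * ∫⁻ h, P h * ∫⁻ z, ‖φ z‖ₑ ^ 2 := by
        congr 2; ext h
        rw [lintegral_const_mul' _ _ ENNReal.ofReal_ne_top,
          lintegral_sub_right_eq_self (fun z => ‖φ z‖ₑ ^ 2) h]
    _ = _ := by
        rw [lintegral_mul_const _ hPm, hm]; ring

lemma lintegral_enorm_sq_eq {f : ℂ → ℂ} (hf : Integrable (fun z => ‖f z‖ ^ 2) volume) :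
    ∫⁻ z, ‖f z‖ₑ ^ 2 = ENNReal.ofReal (∫ z, ‖f z‖ ^ 2) := by
  rw [ofReal_integral_eq_lintegral_ofReal hf (ae_of_all _ fun z => by positivity)]
  congr 1; ext z
  rw [ENNReal.ofReal_pow (norm_nonneg _), ofReal_norm]

lemma norm_regKernel_le (δ : ℝ) (h : ℂ) : ‖regKernel δ h‖ ≤ (‖h‖ ^ 2)⁻¹ := by
  rcases eq_or_ne h 0 with rfl | h0
  · simp [regKernel]
  have : 0 < ‖h‖ := norm_pos_iff.2 h0
  rw [regKernel, norm_mul, norm_neg, norm_pow, RCLike.norm_conj, Complex.norm_real,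
    Real.norm_of_nonneg (by positivity)]
  calc _ ≤ ‖h‖ ^ 2 * ((‖h‖ ^ 2 + 0) ^ 2)⁻¹ := by gcongr; positivity
    _ = _ := by field_simp; ring

lemma tendsto_conv_regKernel {φ : ℂ → ℂ} (hφ : IsTestFunction φ) (z : ℂ) :
    Tendsto (fun n : ℕ => conv (regKernel (1 / ((n : ℝ) + 1))) φ z) atTop
      (𝓝 (Real.pi * beurling φ z)) := by
  have hφc := hφ.continuous
  have hpos : ∀ n : ℕ, (0 : ℝ) < 1 / ((n : ℝ) + 1) := fun n => by positivity
  have hI : ∀ δ h, regKernel δ (Complex.I * h) = -regKernel δ h := fun δ h => by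
    simp only [regKernel, map_mul, Complex.conj_I, norm_mul, Complex.norm_I, one_mul, mul_pow,
      neg_sq, Complex.I_sq]
    ring
  have hD := integrable_symm_kernel hφ z
  have e : ∀ n : ℕ, conv (regKernel (1 / ((n : ℝ) + 1))) φ z = 1 / 2 *
      ∫ h, regKernel (1 / ((n : ℝ) + 1)) h * (φ (z - h) - φ (z - Complex.I * h)) := by
    intro n
    have i1 := integrable_conv_integrand (continuous_regKernel (hpos n)) hφ z
    have e2 := integral_comp_I_mul fun h => regKernel (1 / ((n : ℝ) + 1)) h * φ (z - h)
    have i2 := (measurePreserving_I_mul.integrable_comp_emb measurableEmbedding_I_mul).2 i1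
    simp only [Function.comp_def, hI] at e2 i2
    have : (fun h => regKernel (1 / ((n : ℝ) + 1)) h * (φ (z - h) - φ (z - Complex.I * h))) =
      fun h => regKernel (1 / ((n : ℝ) + 1)) h * φ (z - h) +
        -regKernel (1 / ((n : ℝ) + 1)) h * φ (z - Complex.I * h) := by ext h; ring
    rw [this, integral_add i1 i2, e2, conv]
    ring
  simp only [e]
  have hlim : (Real.pi : ℂ) * beurling φ z =
      1 / 2 * ∫ h, -((φ (z - h) - φ (z - Complex.I * h)) / h ^ 2) := by
    have : (Real.pi : ℂ) ≠ 0 := by exact_mod_cast Real.pi_ne_zero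
    rw [beurling, integral_neg]
    generalize ∫ h, (φ (z - h) - φ (z - Complex.I * h)) / h ^ 2 = J
    field_simp
  rw [hlim]
  refine Tendsto.const_mul _ (tendsto_integral_of_dominated_convergence
    (fun h => ‖(φ (z - h) - φ (z - Complex.I * h)) / h ^ 2‖) (fun n => ?_) hD.norm
    (fun n => ae_of_all _ fun h => ?_) (ae_of_all _ fun h => ?_))
  · exact ((continuous_regKernel (hpos n)).mul (by fun_prop)).aestronglyMeasurable
  · rw [norm_mul, norm_div, norm_pow, div_eq_mul_inv, mul_comm]
    exact mul_le_mul_of_nonneg_left (norm_regKernel_le _ _) (norm_nonneg _)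
  · rcases eq_or_ne h 0 with rfl | h0
    · simp
    have h1 : Tendsto (fun n : ℕ => (((‖h‖ ^ 2 + (1 / ((n : ℝ) + 1)) ^ 2) ^ 2)⁻¹ : ℝ)) atTop
        (𝓝 (((‖h‖ ^ 2 + 0 ^ 2) ^ 2)⁻¹)) := by
      have : 0 < ‖h‖ := norm_pos_iff.2 h0
      exact (((tendsto_const_nhds.add
        ((tendsto_one_div_add_atTop_nhds_zero_nat (𝕜 := ℝ)).pow 2)).pow 2).inv₀ (by positivity))
    have h2 := ((((Complex.continuous_ofReal.tendsto _).comp h1).const_mul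
      (-((starRingEnd ℂ) h) ^ 2)).mul_const (φ (z - h) - φ (z - Complex.I * h)))
    suffices hv : -((starRingEnd ℂ) h) ^ 2 * ((((‖h‖ ^ 2 + 0 ^ 2) ^ 2)⁻¹ : ℝ) : ℂ) *
        (φ (z - h) - φ (z - Complex.I * h)) =
        -((φ (z - h) - φ (z - Complex.I * h)) / h ^ 2) by
      rw [← hv]; exact h2
    have e3 : ((‖h‖ ^ 2 : ℝ) : ℂ) = h * (starRingEnd ℂ) h := by
      rw [Complex.mul_conj, Complex.normSq_eq_norm_sq]
    have hc0 : (starRingEnd ℂ) h ≠ 0 := by simpa using h0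
    rw [zero_pow two_ne_zero, add_zero, Complex.ofReal_inv, Complex.ofReal_pow, e3]
    field_simp

/-- The Beurling transform is bounded on `L²`. The mass of the kernel, which is `π`, serves as the
bound without being computed. -/
lemma exists_eLpNorm_two_beurling_le : ∃ C : ℝ≥0, ∀ φ : ℂ → ℂ, IsTestFunction φ →
    eLpNorm (beurling φ) 2 volume ≤ C * eLpNorm φ 2 volume := by
  refine ⟨(∫ h, deltaKernel 1 h).toNNReal, fun φ hφ => ?_⟩
  have hpos : ∀ n : ℕ, (0 : ℝ) < 1 / ((n : ℝ) + 1) := fun n => by positivity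
  have h1 : ∀ n : ℕ, eLpNorm (conv (regKernel (1 / ((n : ℝ) + 1))) φ) 2 volume ≤
      ((∫ h, deltaKernel 1 h).toNNReal : ℝ≥0∞) * eLpNorm φ 2 volume := by
    intro n
    obtain ⟨iK, iP, hKP⟩ := integral_norm_sq_conv_regKernel (hpos n) hφ
    rw [eLpNorm_two_eq, eLpNorm_two_eq, lintegral_enorm_sq_eq iK, hKP, ← lintegral_enorm_sq_eq iP]
    refine (ENNReal.rpow_le_rpow (lintegral_conv_deltaKernel_le (hpos n) hφ)
      (by norm_num)).trans_eq ?_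
    rw [ENNReal.mul_rpow_of_nonneg _ _ (by norm_num), ← ENNReal.rpow_natCast, ← ENNReal.rpow_mul]
    norm_num
    rfl
  have h2 := Lp.eLpNorm_lim_le_liminf_eLpNorm (p := 2) (μ := volume)
    (f := fun n : ℕ => conv (regKernel (1 / ((n : ℝ) + 1))) φ)
    (fun n => (contDiff_conv (continuous_regKernel (hpos n)).locallyIntegrable hφ
      0).continuous.aestronglyMeasurable) (fun z => Real.pi * beurling φ z)
    (ae_of_all _ fun z => tendsto_conv_regKernel hφ z)
  have h3 : eLpNorm (beurling φ) 2 volume ≤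
      eLpNorm (fun z => (Real.pi : ℂ) * beurling φ z) 2 volume := by
    refine eLpNorm_mono fun z => ?_
    rw [norm_mul, Complex.norm_real, Real.norm_of_nonneg Real.pi_pos.le]
    exact le_mul_of_one_le_left (norm_nonneg _) (by linarith [Real.pi_gt_three])
  refine h3.trans (h2.trans ?_)
  refine (liminf_le_liminf (Eventually.of_forall h1)).trans_eq ?_
  exact liminf_const _

/-! ### From test functions to `L^s` -/

lemma beurling_sub {v v' : ℂ → ℂ} (hv : IsTestFunction v) (hv' : IsTestFunction v') (z : ℂ) :
    beurling (fun y => v y - v' y) z = beurling v z - beurling v' z := by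
  have h := beurling_add hv (hv'.const_mul (-1)) z
  rw [beurling_const_mul] at h
  simpa [sub_eq_add_neg] using h

/-- The `L^s` bound for the Beurling transform, on test functions. -/
def BoundedOnTests (s : ℝ≥0∞) (C : ℝ≥0) : Prop :=
  ∀ φ : ℂ → ℂ, IsTestFunction φ → eLpNorm (beurling φ) s volume ≤ C * eLpNorm φ s volume

/-- An `L^s` bound on test functions extends the Beurling transform to `L^s`, by density. -/
lemma BoundedOnTests.exists_isTransposeBeurling {s : ℝ≥0∞} {C : ℝ≥0} (h : BoundedOnTests s C)
    (hs : 1 < s) (hs' : s ≠ ∞) {u : ℂ → ℂ} (hu : MemLp u s volume) :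
    ∃ w : ℂ → ℂ, MemLp w s volume ∧ eLpNorm w s volume ≤ C * eLpNorm u s volume ∧
      IsTransposeBeurling u w := by
  have : Fact (1 ≤ s) := ⟨hs.le⟩
  obtain ⟨t, ht⟩ := exists_holderConjugate hs.le
  have ht1 : 1 < t := (ENNReal.HolderConjugate.lt_top_iff_one_lt s t).1 hs'.lt_top
  have hg : ∀ n : ℕ, ∃ g, IsTestFunction g ∧
      eLpNorm (u - g) s volume ≤ ENNReal.ofReal (1 / ((n : ℝ) + 1)) := fun n => by
    obtain ⟨g, g1, g2, g3⟩ := hu.exist_eLpNorm_sub_le hs' hs.le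
      (ε := 1 / ((n : ℝ) + 1)) (by positivity)
    exact ⟨g, ⟨g2, g1⟩, g3⟩
  choose g hgt hgu using hg
  have hgLp : ∀ n, MemLp (g n) s volume := fun n => (hgt n).memLp s
  have hSLp : ∀ n, MemLp (beurling (g n)) s volume := fun n => memLp_beurling (hgt n) hs
  have hlim0 : Tendsto (fun n => eLpNorm (u - g n) s volume) atTop (𝓝 0) := by
    have h1 := ENNReal.tendsto_ofReal (tendsto_one_div_add_atTop_nhds_zero_nat (𝕜 := ℝ))
    rw [ENNReal.ofReal_zero] at h1
    exact tendsto_of_tendsto_of_tendsto_of_le_of_le tendsto_const_nhds h1 (fun _ => zero_le)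
      hgu
  have hglim : Tendsto (fun n => (hgLp n).toLp (g n)) atTop (𝓝 (hu.toLp u)) := by
    rw [Lp.tendsto_Lp_iff_tendsto_eLpNorm'']
    refine hlim0.congr fun n => ?_
    rw [← eLpNorm_neg, neg_sub]
  have hcauchy : CauchySeq fun n => (hSLp n).toLp (beurling (g n)) := by
    have h1 := cauchySeq_iff_tendsto_dist_atTop_0.1 hglim.cauchySeq
    rw [cauchySeq_iff_tendsto_dist_atTop_0]
    have h2 := h1.const_mul (C : ℝ)
    rw [mul_zero] at h2
    refine squeeze_zero (fun _ => dist_nonneg) (fun mn => ?_) h2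
    rw [dist_eq_norm, dist_eq_norm, ← MemLp.toLp_sub, ← MemLp.toLp_sub, Lp.norm_toLp,
      Lp.norm_toLp]
    have h3 : IsTestFunction (fun z => g mn.1 z - g mn.2 z) := by
      have := (hgt mn.1).add ((hgt mn.2).const_mul (-1))
      simpa [sub_eq_add_neg] using this
    have h4 := h _ h3
    have h5 : beurling (fun z => g mn.1 z - g mn.2 z) = beurling (g mn.1) - beurling (g mn.2) := by
      ext z; exact beurling_sub (hgt _) (hgt _) z
    rw [h5] at h4
    have h6 := ENNReal.toReal_mono (ENNReal.mul_ne_top ENNReal.coe_ne_top (h3.memLp s).2.ne) h4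
    rw [ENNReal.toReal_mul, ENNReal.coe_toReal] at h6
    exact h6
  obtain ⟨W, hW⟩ := cauchySeq_tendsto_of_complete hcauchy
  have hWlim : Tendsto (fun n => eLpNorm (beurling (g n) - ⇑W) s volume) atTop (𝓝 0) := by
    have := (Lp.tendsto_Lp_iff_tendsto_eLpNorm' _ _).1 hW
    refine this.congr fun n => ?_
    exact eLpNorm_congr_ae ((hSLp n).coeFn_toLp.sub (ae_eq_refl _))
  have hWm := Lp.memLp W
  refine ⟨⇑W, hWm, ?_, hWm.locallyIntegrable hs.le, fun φ hφ => ?_⟩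
  · have h1 : ∀ n, eLpNorm (⇑W) s volume ≤ eLpNorm (beurling (g n) - ⇑W) s volume +
        C * (eLpNorm (u - g n) s volume + eLpNorm u s volume) := fun n => by
      have e1 : (W : ℂ → ℂ) = beurling (g n) - (beurling (g n) - W) := by simp
      have e2 : g n = u - (u - g n) := by simp
      calc eLpNorm (⇑W) s volume = eLpNorm (beurling (g n) - (beurling (g n) - ⇑W)) s volume := by
            rw [← e1]
        _ ≤ eLpNorm (beurling (g n)) s volume + eLpNorm (beurling (g n) - ⇑W) s volume :=
            eLpNorm_sub_le (hSLp n).1 ((hSLp n).1.sub hWm.1) hs.le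
        _ ≤ C * eLpNorm (g n) s volume + eLpNorm (beurling (g n) - ⇑W) s volume := by
            gcongr; exact h _ (hgt n)
        _ ≤ C * (eLpNorm u s volume + eLpNorm (u - g n) s volume) +
            eLpNorm (beurling (g n) - ⇑W) s volume := by
            gcongr
            conv_lhs => rw [e2]
            exact eLpNorm_sub_le hu.1 (hu.1.sub (hgLp n).1) hs.le
        _ = _ := by rw [add_comm, add_comm (eLpNorm u s volume)]
    have h2 := hWlim.add (ENNReal.Tendsto.const_mul (a := (C : ℝ≥0∞))
      (hlim0.add_const (eLpNorm u s volume)) (Or.inr ENNReal.coe_ne_top))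
    rw [zero_add, zero_add] at h2
    exact ge_of_tendsto' h2 h1
  · -- both pairings are limits of the pairings for test functions
    have pair : ∀ {f : ℂ → ℂ} {f' : ℕ → ℂ → ℂ} {χ : ℂ → ℂ}, MemLp f s volume →
        (∀ n, MemLp (f' n) s volume) → MemLp χ t volume →
        Tendsto (fun n => eLpNorm (f' n - f) s volume) atTop (𝓝 0) →
        Tendsto (fun n => ∫ z, f' n z * χ z) atTop (𝓝 (∫ z, f z * χ z)) := by
      intro f f' χ hf hf' hχ hl
      have h1 : Tendsto (fun n => eLpNorm (f' n - f) s volume * eLpNorm χ t volume) atTop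
          (𝓝 0) := by
        have := ENNReal.Tendsto.mul_const hl (Or.inr hχ.2.ne)
        rwa [zero_mul] at this
      rw [tendsto_iff_edist_tendsto_0]
      refine tendsto_of_tendsto_of_tendsto_of_le_of_le tendsto_const_nhds h1 (fun _ => zero_le)
        fun n => ?_
      simp only
      have i1 : Integrable (fun z => f' n z * χ z) volume := (hf' n).integrable_mul hχ
      have i2 : Integrable (fun z => f z * χ z) volume := hf.integrable_mul hχ
      rw [edist_eq_enorm_sub, ← integral_sub i1 i2]
      simp only [← sub_mul]
      exact enorm_integral_mul_le (p := s) (q := t) ((hf' n).1.sub hf.1) hχ.1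
    have p1 := pair hWm hSLp (hφ.memLp t) hWlim
    have p2 := pair hu hgLp (memLp_beurling hφ ht1) (hlim0.congr fun n => by
      rw [← eLpNorm_neg, neg_sub])
    refine tendsto_nhds_unique p1 (p2.congr fun n => ?_)
    exact ((isTransposeBeurling_beurling (hgt n)).2 φ hφ).symm

/-! ### The transform of a mean-zero function away from its support -/

lemma beurling_eq_integral_of_separated {g : ℂ → ℂ} (hg : IsTestFunction g) {y : ℂ} {d : ℝ}
    (hd : 0 < d) (h : ∀ z, g z ≠ 0 → d ≤ ‖z - y‖) :
    beurling g y = -(1 / (Real.pi : ℂ)) * ∫ z, g z / (z - y) ^ 2 := by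
  refine tendsto_nhds_unique (tendsto_truncBeurling hg y) (tendsto_const_nhds.congr' ?_)
  filter_upwards [nhdsWithin_le_nhds (Iio_mem_nhds hd)] with ε hε
  have hm : MeasurableSet {z : ℂ | ε < ‖y - z‖} := measurableSet_lt measurable_const (by fun_prop)
  rw [truncBeurling, ← integral_indicator hm]
  congr 2
  ext z
  by_cases hz : g z = 0
  · simp [Set.indicator, hz]
  · rw [Set.indicator_of_mem, ← neg_sub z y, neg_sq]
    have := h z hz
    rw [norm_sub_rev] at this
    exact lt_of_lt_of_le hε this

/-- Off a neighbourhood of the support of `b`, the transpose transform of `b` is given by the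
absolutely convergent integral of the kernel. -/
lemma IsTransposeBeurling.ae_eq_integral {b w : ℂ → ℂ} (hbm : Measurable b)
    (hb : Integrable b volume) (h : IsTransposeBeurling b w) {c : ℂ} {r d : ℝ} (hd : 0 < d)
    (hs : ∀ y, b y ≠ 0 → ‖y - c‖ ≤ r) :
    ∀ᵐ z, r + d < ‖z - c‖ → w z = -(1 / (Real.pi : ℂ)) * ∫ y, b y / (z - y) ^ 2 := by
  set U : Set ℂ := {z | r + d < ‖z - c‖} with hU
  have hUo : IsOpen U := isOpen_lt continuous_const (by fun_prop)
  have hsep : ∀ z ∈ U, ∀ y, b y ≠ 0 → d ≤ ‖z - y‖ := fun z hz y hy => by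
    have h1 := hs y hy
    have h2 : ‖z - c‖ ≤ ‖z - y‖ + ‖y - c‖ := norm_sub_le_norm_sub_add_norm_sub _ _ _
    have h3 : r + d < ‖z - c‖ := hz
    linarith
  have hdiv : ∀ z ∈ U, ∀ y, ‖b y / (z - y) ^ 2‖ ≤ ‖b y‖ * (d ^ 2)⁻¹ := fun z hz y => by
    by_cases hy : b y = 0
    · simp [hy]
    · rw [norm_div, norm_pow, div_eq_mul_inv]
      have := hsep z hz y hy
      gcongr
  set T : ℂ → ℂ := fun z => -(1 / (Real.pi : ℂ)) * ∫ y, b y / (z - y) ^ 2 with hT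
  have hTm : StronglyMeasurable T := by
    have : Measurable (Function.uncurry fun z y : ℂ => b y / (z - y) ^ 2) :=
      (hbm.comp measurable_snd).div (by fun_prop)
    exact this.stronglyMeasurable.integral_prod_right.const_mul _
  have hpi : ‖-(1 / (Real.pi : ℂ))‖ ≤ 1 := by
    rw [norm_neg, norm_div, norm_one, Complex.norm_real, Real.norm_of_nonneg Real.pi_pos.le,
      div_le_one Real.pi_pos]
    linarith [Real.pi_gt_three]
  have hTb : ∀ z ∈ U, ‖T z‖ ≤ (∫ y, ‖b y‖) * (d ^ 2)⁻¹ := fun z hz => by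
    rw [hT, norm_mul, ← integral_mul_const, ← one_mul (∫ y, ‖b y‖ * (d ^ 2)⁻¹)]
    exact mul_le_mul hpi (norm_integral_le_of_norm_le (hb.norm.mul_const _)
      (ae_of_all _ (hdiv z hz))) (norm_nonneg _) zero_le_one
  have hTl : LocallyIntegrable (U.indicator T) volume := by
    have : MemLp (U.indicator T) ∞ volume := by
      refine memLp_top_of_bound (hTm.indicator hUo.measurableSet).aestronglyMeasurable
        ((∫ y, ‖b y‖) * (d ^ 2)⁻¹) (ae_of_all _ fun z => ?_)
      by_cases hz : z ∈ U
      · rw [Set.indicator_of_mem hz]; exact hTb z hz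
      · rw [Set.indicator_of_notMem hz, norm_zero]
        have : 0 ≤ ∫ y, ‖b y‖ := integral_nonneg fun _ => norm_nonneg _
        positivity
    exact this.locallyIntegrable le_top
  have key := hUo.ae_eq_zero_of_integral_contDiff_smul_eq_zero (μ := volume)
    (f := fun z => w z - U.indicator T z) ((h.1.sub hTl).locallyIntegrableOn U)
    (fun g hg hgc hgU => ?_)
  · filter_upwards [key] with z hz hzU
    have := hz hzU
    rwa [Set.indicator_of_mem (show z ∈ U from hzU), sub_eq_zero] at this
  · have hgt := isTestFunction_ofReal hg hgc
    set χ : ℂ → ℂ := fun z => (g z : ℂ) with hχ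
    have hχU : ∀ z, χ z ≠ 0 → z ∈ U := fun z hz =>
      hgU (subset_tsupport _ (by simpa [hχ] using hz))
    have e1 : ∫ z, g z • (w z - U.indicator T z) =
        (∫ z, w z * χ z) - ∫ z, U.indicator T z * χ z := by
      rw [← integral_sub (integrable_mul_test h.1 hgt) (integrable_mul_test hTl hgt)]
      congr 1; ext z
      simp only [hχ, Complex.real_smul]; ring
    set H : ℂ → ℂ → ℂ := fun z y => χ z * b y / (z - y) ^ 2 with hH
    have hHi : Integrable (Function.uncurry H) (volume.prod volume) := by
      refine Integrable.mono' ((hgt.integrable.norm.mul_prod hb.norm).mul_const ((d ^ 2)⁻¹)) ?_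
        (ae_of_all _ ?_)
      · exact (((hgt.continuous.measurable.comp measurable_fst).mul
          (hbm.comp measurable_snd)).div (by fun_prop)).aestronglyMeasurable
      · rintro ⟨z, y⟩
        simp only [Function.uncurry, hH]
        by_cases hz : χ z = 0
        · simp [hz]
        · rw [mul_div_assoc, norm_mul, mul_assoc]
          gcongr
          exact hdiv z (hχU z hz) y
    have e2 : ∀ z, U.indicator T z * χ z = -(1 / (Real.pi : ℂ)) * ∫ y, H z y := fun z => by
      by_cases hz : χ z = 0
      · simp [hz, hH]
      · rw [Set.indicator_of_mem (hχU z hz), hT]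
        simp only [hH, mul_div_assoc, integral_const_mul]
        ring
    have e3 : ∀ y, b y * beurling χ y = -(1 / (Real.pi : ℂ)) * ∫ z, H z y := fun y => by
      by_cases hy : b y = 0
      · simp [hy, hH]
      · rw [beurling_eq_integral_of_separated hgt hd (fun z hz => hsep z (hχU z hz) y hy),
          mul_left_comm, ← integral_const_mul]
        congr 2; ext z
        simp only [hH]; ring
    rw [e1, h.2 χ hgt]
    simp only [e2, e3, integral_const_mul]
    rw [integral_integral_swap hHi, sub_self]

/-- The smoothness of the kernel `h⁻²`, with the majorant written as the dilation of an integrable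
function. -/
lemma norm_inv_sq_sub_inv_sq_le {a h : ℂ} {l : ℝ} (hl : 0 < l) (ha : 4 * l < ‖a‖)
    (hh : ‖h‖ ≤ 2 * l) :
    ‖((a - h) ^ 2)⁻¹ - (a ^ 2)⁻¹‖ ≤ 40 * (l ^ 2)⁻¹ * (1 + ‖l⁻¹ • a‖) ^ (-3 : ℝ) := by
  have ha0 : 0 < ‖a‖ := by linarith
  have h1 : ‖a‖ / 2 ≤ ‖a - h‖ := by
    have := norm_sub_norm_le a h; linarith
  have h2 : 0 < ‖a - h‖ := by linarith
  have a0 : a ≠ 0 := norm_pos_iff.1 ha0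
  have ah0 : a - h ≠ 0 := norm_pos_iff.1 h2
  have e : ((a - h) ^ 2)⁻¹ - (a ^ 2)⁻¹ = h * (2 * a - h) / (a ^ 2 * (a - h) ^ 2) := by
    field_simp; ring
  have h3 : ‖2 * a - h‖ ≤ 5 / 2 * ‖a‖ := by
    refine (norm_sub_le _ _).trans ?_
    rw [norm_mul, Complex.norm_ofNat]; linarith
  have h4 : 1 + ‖l⁻¹ • a‖ ≤ 5 / 4 * (‖a‖ / l) := by
    rw [norm_smul, norm_inv, Real.norm_of_nonneg hl.le]
    have h4 : 4 ≤ ‖a‖ / l := by rw [le_div_iff₀ hl]; linarith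
    rw [← div_eq_inv_mul]
    linarith
  have h5 : (0 : ℝ) < 1 + ‖l⁻¹ • a‖ := by positivity
  have h6 : (5 / 4 * (‖a‖ / l)) ^ (-3 : ℝ) ≤ (1 + ‖l⁻¹ • a‖) ^ (-3 : ℝ) :=
    Real.rpow_le_rpow_of_nonpos h5 h4 (by norm_num)
  rw [e, norm_div, norm_mul, norm_mul, norm_pow, norm_pow]
  calc _ ≤ 2 * l * (5 / 2 * ‖a‖) / (‖a‖ ^ 2 * (‖a‖ / 2) ^ 2) := by gcongr
    _ = 20 * l * (‖a‖ ^ 3)⁻¹ := by field_simp; ring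
    _ ≤ 40 * (l ^ 2)⁻¹ * (5 / 4 * (‖a‖ / l)) ^ (-3 : ℝ) := by
        rw [Real.rpow_neg (by positivity)]
        norm_cast
        have : 40 * (l ^ 2)⁻¹ * ((5 / 4 * (‖a‖ / l)) ^ 3)⁻¹ =
          (512 / 25 : ℝ) * l * (‖a‖ ^ 3)⁻¹ := by field_simp; norm_num
        rw [this]
        gcongr
        norm_num
    _ ≤ _ := by gcongr

/-- A mean-zero function on a square has an integrable transform away from the square. -/
lemma exists_const_lintegral_transpose_le : ∃ A : ℝ≥0, ∀ {P : ℂ × ℝ} {b w : ℂ → ℂ}, 0 < P.2 →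
    Measurable b → Integrable b volume → (∀ y, y ∉ box P → b y = 0) → ∫ y, b y = 0 →
    IsTransposeBeurling b w →
    ∫⁻ z in {z | 4 * P.2 < ‖z - P.1‖}, ‖w z‖ₑ ≤ A * ∫⁻ y, ‖b y‖ₑ := by
  have hint : Integrable (fun x : ℂ => (1 + ‖x‖) ^ (-3 : ℝ)) volume :=
    integrable_one_add_norm (by rw [Complex.finrank_real_complex]; norm_num)
  refine ⟨(40 * ∫ x : ℂ, (1 + ‖x‖) ^ (-3 : ℝ)).toNNReal, fun {P b w} hP hbm hb hsupp hmean h => ?_⟩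
  have hbs : ∀ y, b y ≠ 0 → ‖y - P.1‖ ≤ 2 * P.2 := fun y hy => by
    have hy' : y ∈ box P := by_contra fun h => hy (hsupp y h)
    exact norm_sub_le_of_mem_box hy' (corner_mem_box hP)
  have hm : MeasurableSet {z : ℂ | 4 * P.2 < ‖z - P.1‖} :=
    measurableSet_lt measurable_const (by fun_prop)
  have hpt : ∀ᵐ z, 4 * P.2 < ‖z - P.1‖ → ‖w z‖ₑ ≤ ENNReal.ofReal
      ((∫ y, ‖b y‖) * (40 * (P.2 ^ 2)⁻¹) * (1 + ‖P.2⁻¹ • (z - P.1)‖) ^ (-3 : ℝ)) := by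
    filter_upwards [h.ae_eq_integral hbm hb hP hbs] with z hz hz4
    have hsep : ∀ y, b y ≠ 0 → P.2 ≤ ‖z - y‖ := fun y hy => by
      have h1 := hbs y hy
      have h2 : ‖z - P.1‖ ≤ ‖z - y‖ + ‖y - P.1‖ := norm_sub_le_norm_sub_add_norm_sub _ _ _
      linarith
    have hi : Integrable (fun y => b y / (z - y) ^ 2) volume := by
      refine (hb.norm.mul_const ((P.2 ^ 2)⁻¹)).mono' (hbm.div (by fun_prop)).aestronglyMeasurable
        (ae_of_all _ fun y => ?_)
      by_cases hy : b y = 0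
      · simp [hy]
      · rw [norm_div, norm_pow, div_eq_mul_inv]
        have := hsep y hy
        gcongr
    have e : ∫ y, b y / (z - y) ^ 2 =
        ∫ y, b y * (((z - P.1 - (y - P.1)) ^ 2)⁻¹ - ((z - P.1) ^ 2)⁻¹) := by
      have h0 : ∫ y, b y * ((z - P.1) ^ 2)⁻¹ = 0 := by rw [integral_mul_const, hmean, zero_mul]
      rw [← sub_zero (∫ y, b y / (z - y) ^ 2), ← h0, ← integral_sub hi (hb.mul_const _)]
      congr 1; ext y
      rw [sub_sub_sub_cancel_right]; ring
    rw [hz (by linarith), e, ← ofReal_norm]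
    refine ENNReal.ofReal_le_ofReal ?_
    have hpi : ‖-(1 / (Real.pi : ℂ))‖ ≤ 1 := by
      rw [norm_neg, norm_div, norm_one, Complex.norm_real, Real.norm_of_nonneg Real.pi_pos.le,
        div_le_one Real.pi_pos]
      linarith [Real.pi_gt_three]
    rw [norm_mul, mul_assoc (∫ y, ‖b y‖), ← integral_mul_const, ← one_mul (∫ y, ‖b y‖ * _)]
    refine mul_le_mul hpi (norm_integral_le_of_norm_le (hb.norm.mul_const _)
      (ae_of_all _ fun y => ?_)) (norm_nonneg _) zero_le_one
    by_cases hy : b y = 0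
    · simp [hy]
    · rw [norm_mul]
      gcongr
      exact norm_inv_sq_sub_inv_sq_le hP hz4 (hbs y hy)
  set κ := ∫ x : ℂ, (1 + ‖x‖) ^ (-3 : ℝ) with hκ
  have hκ0 : 0 ≤ κ := integral_nonneg fun x => by positivity
  have hsc : ∫ z : ℂ, (1 + ‖P.2⁻¹ • (z - P.1)‖) ^ (-3 : ℝ) = P.2 ^ 2 * κ := by
    rw [integral_sub_right_eq_self (fun z : ℂ => (1 + ‖P.2⁻¹ • z‖) ^ (-3 : ℝ)) P.1,
      Measure.integral_comp_smul volume (fun x : ℂ => (1 + ‖x‖) ^ (-3 : ℝ)) P.2⁻¹,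
      Complex.finrank_real_complex, smul_eq_mul, inv_pow, inv_inv, abs_of_nonneg (by positivity)]
  have hsci : Integrable (fun z : ℂ => (1 + ‖P.2⁻¹ • (z - P.1)‖) ^ (-3 : ℝ)) volume :=
    ((integrable_comp_smul_iff volume (fun x : ℂ => (1 + ‖x‖) ^ (-3 : ℝ))
      (inv_ne_zero hP.ne')).2 hint).comp_sub_right P.1
  have hJ0 : 0 ≤ ∫ y, ‖b y‖ := integral_nonneg fun _ => norm_nonneg _
  calc _ ≤ ∫⁻ z in {z | 4 * P.2 < ‖z - P.1‖}, ENNReal.ofReal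
          ((∫ y, ‖b y‖) * (40 * (P.2 ^ 2)⁻¹) * (1 + ‖P.2⁻¹ • (z - P.1)‖) ^ (-3 : ℝ)) :=
        setLIntegral_mono_ae' hm hpt
    _ ≤ ∫⁻ z, ENNReal.ofReal
          ((∫ y, ‖b y‖) * (40 * (P.2 ^ 2)⁻¹) * (1 + ‖P.2⁻¹ • (z - P.1)‖) ^ (-3 : ℝ)) :=
        setLIntegral_le_lintegral _ _
    _ = ENNReal.ofReal ((∫ y, ‖b y‖) * (40 * κ)) := by
        rw [← ofReal_integral_eq_lintegral_ofReal (hsci.const_mul _)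
          (ae_of_all _ fun z => by positivity), integral_const_mul, hsc]
        congr 1
        field_simp
    _ = _ := by
        rw [mul_comm, ENNReal.ofReal_mul (by positivity), ofReal_integral_norm_eq_lintegral_enorm hb]
        rfl

/-! ### The level-set inequality -/

lemma TailIntegrable.sum {ι : Type*} {F : Finset ι} {u : ι → ℂ → ℂ}
    (hu : ∀ i ∈ F, TailIntegrable (u i)) : TailIntegrable (fun z => ∑ i ∈ F, u i z) := by
  classical
  induction F using Finset.induction_on with
  | empty => simpa using isTestFunction_zero.tailIntegrable
  | insert a F ha ih =>
    simp only [Finset.sum_insert ha]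
    exact (hu a (by simp)).add (ih fun i hi => hu i (by simp [hi]))

lemma IsTransposeBeurling.sum {ι : Type*} {F : Finset ι} {u w : ι → ℂ → ℂ}
    (hu : ∀ i ∈ F, TailIntegrable (u i)) (h : ∀ i ∈ F, IsTransposeBeurling (u i) (w i)) :
    IsTransposeBeurling (fun z => ∑ i ∈ F, u i z) (fun z => ∑ i ∈ F, w i z) := by
  classical
  induction F using Finset.induction_on with
  | empty => simp [IsTransposeBeurling, locallyIntegrable_zero]
  | insert a F ha ih =>
    simp only [Finset.sum_insert ha]
    have hF : ∀ i ∈ F, TailIntegrable (u i) := fun i hi => hu i (by simp [hi])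
    exact (h a (by simp)).add (hu a (by simp)) (.sum hF)
      (ih hF fun i hi => h i (by simp [hi]))

lemma exists_box_of_test {f : ℂ → ℂ} (hf : IsTestFunction f) {lam : ℝ} (hlam : 0 < lam) :
    ∃ Q : ℂ × ℝ, 0 < Q.2 ∧ (∀ z, f z ≠ 0 → z ∈ box Q) ∧ ∫ x in box Q, ‖f x‖ ≤ lam * Q.2 ^ 2 := by
  obtain ⟨R, hR1, hR⟩ := exists_support_radius hf
  set J := ∫ x, ‖f x‖ with hJ
  have hJ0 : 0 ≤ J := integral_nonneg fun _ => norm_nonneg _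
  set N := R + 1 + J / lam with hN
  have h0 : 0 ≤ J / lam := by positivity
  refine ⟨(⟨-N, -N⟩, 2 * N), by simp only; linarith, fun z hz => ?_, ?_⟩
  · have h1 : ‖z‖ ≤ R := not_lt.1 fun h => hz (hR z h)
    have h2 := abs_le.1 ((Complex.abs_re_le_norm z).trans h1)
    have h3 := abs_le.1 ((Complex.abs_im_le_norm z).trans h1)
    simp only [box, Set.mem_Ico, Set.mem_ofPred_eq]
    exact ⟨⟨by linarith, by linarith⟩, by linarith, by linarith⟩
  · refine (setIntegral_le_integral hf.integrable.norm (ae_of_all _ fun _ => norm_nonneg _)).trans ?_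
    have h1 : J / lam ≤ N := by linarith
    rw [div_le_iff₀ hlam] at h1
    simp only
    nlinarith

lemma lintegral_enorm_osc_le {f : ℂ → ℂ} {P : ℂ × ℝ} (hP : 0 < P.2)
    (hf : IntegrableOn f (box P) volume) {lam : ℝ}
    (h : ∫ x in box P, ‖f x‖ ≤ 4 * lam * P.2 ^ 2) :
    ∫⁻ x, ‖osc f P x‖ₑ ≤ 8 * ENNReal.ofReal lam * volume (box P) := by
  have hv : volume (box P) = ENNReal.ofReal (P.2 ^ 2) := by
    rw [volume_box, ← ENNReal.ofReal_mul hP.le, sq]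
  have e4 : ENNReal.ofReal (4 * lam) = 4 * ENNReal.ofReal lam := by
    rw [ENNReal.ofReal_mul (by norm_num)]; norm_num
  have h1 : ∫⁻ x in box P, ‖f x‖ₑ ≤ 4 * ENNReal.ofReal lam * volume (box P) := by
    rw [← ofReal_integral_norm_eq_lintegral_enorm hf, hv, ← e4,
      ← ENNReal.ofReal_mul' (by positivity)]
    exact ENNReal.ofReal_le_ofReal h
  have h2 : ‖mean f P‖ₑ ≤ 4 * ENNReal.ofReal lam := by
    rw [← ofReal_norm, ← e4]
    exact ENNReal.ofReal_le_ofReal (norm_mean_le hP h)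
  calc _ = ∫⁻ x in box P, ‖f x - mean f P‖ₑ := by
        rw [← lintegral_indicator (measurableSet_box P)]
        congr 1; ext x
        by_cases hx : x ∈ box P
        · rw [osc_of_mem hx, Set.indicator_of_mem hx]
        · rw [osc_of_notMem hx, Set.indicator_of_notMem hx, enorm_zero]
    _ ≤ ∫⁻ x in box P, (‖f x‖ₑ + 4 * ENNReal.ofReal lam) :=
        lintegral_mono fun x => (enorm_sub_le).trans (by gcongr)
    _ = (∫⁻ x in box P, ‖f x‖ₑ) + 4 * ENNReal.ofReal lam * volume (box P) := by
        rw [lintegral_add_right _ measurable_const, setLIntegral_const]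
    _ ≤ 4 * ENNReal.ofReal lam * volume (box P) + 4 * ENNReal.ofReal lam * volume (box P) := by
        gcongr
    _ = _ := by ring

lemma measurable_osc {f : ℂ → ℂ} (hf : Measurable f) (P : ℂ × ℝ) : Measurable (osc f P) :=
  (hf.sub_const _).indicator (measurableSet_box P)

/-- The `L²` norm of the good part of the Calderón–Zygmund decomposition. Off the stopping squares it
is `f`, which is at most `2 * lam` there; on a stopping square it is the mean of `f`, which is at
most `4 * lam`. -/
lemma IsStoppingFamily.lintegral_good_le {f : ℂ → ℂ} (hf : IsTestFunction f) {lam : ℝ}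
    {Q : ℂ × ℝ} {F : Finset (ℂ × ℝ)}
    (hF : IsStoppingFamily (fun x => ‖f x‖) lam Q F)
    (hoff : ∀ x, (∀ P ∈ F, x ∉ box P) → ‖f x‖ ≤ 2 * lam) :
    ∫⁻ x, ‖f x - ∑ P ∈ F, osc f P x‖ₑ ^ 2 ≤ (∫⁻ x in {x | ‖f x‖ ≤ 2 * lam}, ‖f x‖ₑ ^ 2) +
      16 * ENNReal.ofReal lam ^ 2 * ∑ P ∈ F, volume (box P) := by
  have hm : MeasurableSet {x | ‖f x‖ ≤ 2 * lam} :=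
    measurableSet_le hf.continuous.norm.measurable measurable_const
  have h1 : ∀ x, ‖f x - ∑ P ∈ F, osc f P x‖ₑ ^ 2 ≤
      ({x | ‖f x‖ ≤ 2 * lam}).indicator (fun x => ‖f x‖ₑ ^ 2) x +
      ∑ P ∈ F, (box P).indicator (fun _ => 16 * ENNReal.ofReal lam ^ 2) x := by
    intro x
    by_cases hx : ∃ P ∈ F, x ∈ box P
    · obtain ⟨P, hP, hxP⟩ := hx
      have hne : ∀ P' ∈ F, P' ≠ P → x ∉ box P' := fun P' hP' hne hx' =>
        Set.disjoint_left.1 (hF.disjoint hP' hP hne) hx' hxP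
      rw [Finset.sum_eq_single_of_mem P hP fun P' hP' hn => osc_of_notMem (hne P' hP' hn),
        osc_of_mem hxP, sub_sub_cancel]
      refine le_add_left ((?_ : _ ≤ (box P).indicator (fun _ => 16 * ENNReal.ofReal lam ^ 2) x).trans
        (Finset.single_le_sum (f := fun P => (box P).indicator
          (fun _ => 16 * ENNReal.ofReal lam ^ 2) x) (fun _ _ => zero_le) hP))
      rw [Set.indicator_of_mem hxP]
      have h2 : ‖mean f P‖ₑ ≤ 4 * ENNReal.ofReal lam := by
        have := norm_mean_le (hF.pos P hP) (hF.integral_le P hP)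
        rw [← ofReal_norm]
        refine (ENNReal.ofReal_le_ofReal this).trans_eq ?_
        rw [ENNReal.ofReal_mul (by norm_num)]; norm_num
      refine (pow_le_pow_left' h2 2).trans_eq ?_
      ring
    · push Not at hx
      rw [Finset.sum_eq_zero fun P hP => osc_of_notMem (hx P hP), sub_zero]
      refine le_add_right ?_
      rw [Set.indicator_of_mem]
      exact hoff x hx
  refine (lintegral_mono h1).trans_eq ?_
  rw [lintegral_add_left ((hf.continuous.measurable.enorm.pow_const 2).indicator hm),
    lintegral_indicator hm, lintegral_finsetSum _ fun P _ =>
      measurable_const.indicator (measurableSet_box P), Finset.mul_sum]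
  congr 1
  refine Finset.sum_congr rfl fun P _ => ?_
  rw [lintegral_indicator_const (measurableSet_box P)]

lemma eLpNorm_two_sq (f : ℂ → ℂ) : eLpNorm f 2 volume ^ 2 = ∫⁻ z, ‖f z‖ₑ ^ 2 := by
  rw [eLpNorm_two_eq, ← ENNReal.rpow_natCast, ← ENNReal.rpow_mul]
  norm_num

lemma memLp_osc {f : ℂ → ℂ} {p : ℝ≥0∞} (hf : MemLp f p volume) (P : ℂ × ℝ) :
    MemLp (osc f P) p volume := by
  have : IsFiniteMeasure (volume.restrict (box P)) :=
    ⟨by rw [Measure.restrict_apply_univ]; exact (volume_box_ne_top P).lt_top⟩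
  exact (memLp_indicator_iff_restrict (measurableSet_box P)).2
    ((hf.restrict (box P)).sub (memLp_const _))

/-- The Calderón–Zygmund decomposition at height `lam`. Only the part of `f` above `lam / 2` enters
through the stopping squares, and only the part below `2 * lam` through the good part; this is
what makes the inequality integrable against `lam ^ (s - 1)` for every `1 < s < 2`. -/
lemma BoundedOnTests.exists_level_inequality {C : ℝ≥0} (hC : BoundedOnTests 2 C) :
    ∃ K : ℝ≥0, ∀ {f : ℂ → ℂ}, IsTestFunction f → ∀ {lam : ℝ}, 0 < lam →
      volume {z | lam < ‖beurling f z‖} ≤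
        K * ((ENNReal.ofReal lam)⁻¹ * ∫⁻ z in {z | lam / 2 < ‖f z‖}, ‖f z‖ₑ) +
        K * ((ENNReal.ofReal lam)⁻¹ ^ 2 * ∫⁻ z in {z | ‖f z‖ ≤ 2 * lam}, ‖f z‖ₑ ^ 2) := by
  obtain ⟨A, hA⟩ := exists_const_lintegral_transpose_le
  refine ⟨128 * C ^ 2 + 32 * A + 32 * NNReal.pi, fun {f} hf {lam} hlam => ?_⟩
  have hfc := hf.continuous
  obtain ⟨Q, hQ, hfQ, hle⟩ := exists_box_of_test hf hlam
  obtain ⟨F, hF, hoff'⟩ := exists_stoppingFamily_of_continuous hfc hf.2 hlam hQ hle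
  have hoff : ∀ x, (∀ P ∈ F, x ∉ box P) → ‖f x‖ ≤ 2 * lam := fun x hx => by
    by_cases h0 : f x = 0
    · rw [h0, norm_zero]; positivity
    · exact hoff' x (hfQ x h0) hx
  have hfP : ∀ P, IntegrableOn f (box P) volume := fun P => hf.integrable.integrableOn
  set V := ∑ P ∈ F, volume (box P) with hV
  set L := ENNReal.ofReal lam with hL
  set M := L⁻¹ with hM
  have hL0 : L ≠ 0 := by simpa [hL] using hlam
  have hLt : L ≠ ∞ := ENNReal.ofReal_ne_top
  have hLM : L * M = 1 := ENNReal.mul_inv_cancel hL0 hLt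
  have hL2 : (L / 2)⁻¹ = 2 * M := by
    rw [ENNReal.inv_div (Or.inl ENNReal.ofNat_ne_top) (Or.inl two_ne_zero), div_eq_mul_inv]
  set E := ∫⁻ z in {z | lam / 2 < ‖f z‖}, ‖f z‖ₑ with hE
  set D := ∫⁻ z in {z | ‖f z‖ ≤ 2 * lam}, ‖f z‖ₑ ^ 2 with hD
  have hVE : V ≤ 2 * (M * E) := by
    have h1 := IsStoppingFamily.sum_sq_le hfc hf.2 hlam hF.pos hF.lt_integral hF.disjoint
    have h2 : V = ENNReal.ofReal (∑ P ∈ F, P.2 ^ 2) := by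
      rw [ENNReal.ofReal_sum_of_nonneg fun P _ => sq_nonneg _]
      refine Finset.sum_congr rfl fun P hP => ?_
      rw [volume_box, ← ENNReal.ofReal_mul (hF.pos P hP).le, sq]
    rw [h2]
    refine (ENNReal.ofReal_le_ofReal h1).trans_eq ?_
    rw [ENNReal.ofReal_mul (by positivity), ofReal_integral_norm_eq_lintegral_enorm
      hf.integrable.integrableOn, ENNReal.ofReal_div_of_pos hlam, div_eq_mul_inv, mul_assoc]
    norm_num
    rfl
  set g : ℂ → ℂ := fun x => f x - ∑ P ∈ F, osc f P x with hg
  have hgood := hF.lintegral_good_le hf hoff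
  have hoscL : ∀ P, MemLp (osc f P) 2 volume := fun P =>
    memLp_osc (hf.memLp 2) P
  have hgL : MemLp g 2 volume := (hf.memLp 2).sub (memLp_finsetSum _ fun P _ => hoscL P)
  obtain ⟨wg, wgL, wgle, hwg⟩ := hC.exists_isTransposeBeurling (by norm_num) (by norm_num) hgL
  choose w wL wle hw using fun P =>
    hC.exists_isTransposeBeurling (by norm_num) (by norm_num) (hoscL P)
  have htail : ∀ P, TailIntegrable (osc f P) := fun P =>
    (hoscL P).tailIntegrable one_le_two (by norm_num)
  have hsum := hwg.add (hgL.tailIntegrable one_le_two (by norm_num)) (.sum fun P _ => htail P)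
    (IsTransposeBeurling.sum (F := F) (fun P _ => htail P) fun P _ => hw P)
  have hfe : (fun z => g z + ∑ P ∈ F, osc f P z) = f := by ext z; simp [hg]
  rw [hfe] at hsum
  have hae := (isTransposeBeurling_beurling hf).ae_eq hsum
  -- off the enlarged stopping squares, the bad parts are handled by the kernel estimate
  set B : Set ℂ := ⋃ P ∈ F, Metric.closedBall P.1 (4 * P.2) with hB
  have hBm : MeasurableSet B := Finset.measurableSet_biUnion _ fun P _ =>
    Metric.isClosed_closedBall.measurableSet
  have hsub : volume {z | lam < ‖beurling f z‖} ≤ volume {z | (L / 2) ^ 2 ≤ ‖wg z‖ₑ ^ 2} +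
      (volume.restrict Bᶜ {z | L / 2 ≤ ∑ P ∈ F, ‖w P z‖ₑ} + volume B) := by
    have h1 : volume {z | lam < ‖beurling f z‖} ≤ volume ({z | (L / 2) ^ 2 ≤ ‖wg z‖ₑ ^ 2} ∪
        ({z | L / 2 ≤ ∑ P ∈ F, ‖w P z‖ₑ} ∩ Bᶜ ∪ B)) := by
      refine measure_mono_ae ?_
      filter_upwards [hae] with z hz (hlt : lam < ‖beurling f z‖)
      by_cases h2 : (L / 2) ^ 2 ≤ ‖wg z‖ₑ ^ 2
      · exact Or.inl h2
      by_cases h3 : z ∈ B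
      · exact Or.inr (Or.inr h3)
      refine Or.inr (Or.inl ⟨?_, h3⟩)
      by_contra h4
      rw [Set.mem_ofPred_eq, not_le] at h4
      have h5 : ‖wg z‖ₑ < L / 2 := lt_of_pow_lt_pow_left' 2 (not_le.1 h2)
      have h6 : ‖beurling f z‖ₑ < L := by
        rw [hz, ← ENNReal.add_halves L]
        exact (enorm_add_le _ _).trans_lt (ENNReal.add_lt_add h5
          ((enorm_sum_le _ _).trans_lt h4))
      rw [← ofReal_norm, hL, ENNReal.ofReal_lt_ofReal_iff hlam] at h6
      exact absurd h6 (not_lt.2 hlt.le)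
    refine h1.trans ((measure_union_le _ _).trans ?_)
    gcongr
    refine (measure_union_le _ _).trans ?_
    rw [Measure.restrict_apply' hBm.compl]
  have t1 : volume {z | (L / 2) ^ 2 ≤ ‖wg z‖ₑ ^ 2} ≤ 4 * C ^ 2 * (M ^ 2 * D) + 64 * C ^ 2 * V := by
    have h1 : ∫⁻ z, ‖wg z‖ₑ ^ 2 ≤ C ^ 2 * ∫⁻ z, ‖g z‖ₑ ^ 2 := by
      have := pow_le_pow_left' wgle 2
      rwa [mul_pow, eLpNorm_two_sq, eLpNorm_two_sq] at this
    have hL2' : (L / 2) ^ 2 ≠ 0 := by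
      refine pow_ne_zero 2 (ENNReal.div_ne_zero.2 ⟨hL0, by norm_num⟩)
    refine (meas_ge_le_lintegral_div (wgL.1.enorm.pow_const 2) hL2'
      (ENNReal.pow_ne_top (ENNReal.div_ne_top hLt two_ne_zero))).trans ?_
    rw [div_eq_mul_inv, ENNReal.inv_pow, hL2]
    calc _ ≤ C ^ 2 * (D + 16 * L ^ 2 * V) * (2 * M) ^ 2 := by
          gcongr
          exact h1.trans (by gcongr)
      _ = 4 * C ^ 2 * (M ^ 2 * D) + 64 * C ^ 2 * (L * M) ^ 2 * V := by ring
      _ = _ := by rw [hLM]; ring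
  have t2 : volume.restrict Bᶜ {z | L / 2 ≤ ∑ P ∈ F, ‖w P z‖ₑ} ≤ 16 * A * V := by
    refine (meas_ge_le_lintegral_div (Finset.aemeasurable_fun_sum _ fun P _ =>
      (wL P).1.restrict.enorm) (ENNReal.div_ne_zero.2 ⟨hL0, by norm_num⟩)
      (ENNReal.div_ne_top hLt two_ne_zero)).trans ?_
    rw [div_eq_mul_inv, hL2, lintegral_finsetSum' _ fun P _ => (wL P).1.restrict.enorm]
    have h1 : ∀ P ∈ F, ∫⁻ z in Bᶜ, ‖w P z‖ₑ ≤ A * (8 * L * volume (box P)) := fun P hP => by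
      calc _ ≤ ∫⁻ z in {z | 4 * P.2 < ‖z - P.1‖}, ‖w P z‖ₑ := by
            refine lintegral_mono_set fun z hz => ?_
            by_contra h
            refine hz (Set.mem_biUnion hP ?_)
            rw [mem_closedBall_iff_norm]
            exact not_lt.1 h
        _ ≤ A * ∫⁻ y, ‖osc f P y‖ₑ := hA (hF.pos P hP) (measurable_osc hfc.measurable P)
            (integrable_osc (hfP P)) (fun y hy => osc_of_notMem hy)
            (integral_osc (hF.pos P hP) (hfP P)) (hw P)
        _ ≤ _ := by
            gcongr
            exact lintegral_enorm_osc_le (hF.pos P hP) (hfP P) (hF.integral_le P hP)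
    calc _ ≤ (∑ P ∈ F, A * (8 * L * volume (box P))) * (2 * M) := by
          gcongr with P hP; exact h1 P hP
      _ = 16 * A * (L * M) * V := by rw [hV, ← Finset.mul_sum, ← Finset.mul_sum]; ring
      _ = _ := by rw [hLM, mul_one]
  have t3 : volume B ≤ 16 * NNReal.pi * V := by
    refine (measure_biUnion_finset_le _ _).trans ?_
    rw [hV, Finset.mul_sum]
    refine Finset.sum_le_sum fun P hP => le_of_eq ?_
    rw [Complex.volume_closedBall, volume_box, ENNReal.ofReal_mul (by norm_num)]
    norm_num
    ring
  refine hsub.trans ?_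
  calc _ ≤ 4 * C ^ 2 * (M ^ 2 * D) + 64 * C ^ 2 * V + (16 * A * V + 16 * NNReal.pi * V) := by
        gcongr
    _ = 4 * C ^ 2 * (M ^ 2 * D) + (64 * C ^ 2 + 16 * A + 16 * NNReal.pi) * V := by ring
    _ ≤ 4 * C ^ 2 * (M ^ 2 * D) + (64 * C ^ 2 + 16 * A + 16 * NNReal.pi) * (2 * (M * E)) := by
        gcongr
    _ = (128 * C ^ 2 + 32 * A + 32 * NNReal.pi) * (M * E) + 4 * C ^ 2 * (M ^ 2 * D) := by ring
    _ ≤ _ := by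
        push_cast
        gcongr
        refine le_trans ?_ (le_add_right (le_add_right le_rfl))
        gcongr
        norm_num

/-! ### The `L^s` bounds, `1 < s < ∞` -/

lemma lintegral_rpow_Ioo {s : ℝ} (hs : 1 < s) {a : ℝ} (ha : 0 ≤ a) :
    ∫⁻ t in Set.Ioo 0 (2 * a), ENNReal.ofReal (t ^ (s - 2)) =
      ENNReal.ofReal ((2 * a) ^ (s - 1) / (s - 1)) := by
  have h2a : 0 ≤ 2 * a := by positivity
  have hi : IntervalIntegrable (fun t : ℝ => t ^ (s - 2)) volume 0 (2 * a) :=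
    intervalIntegral.intervalIntegrable_rpow' (by linarith)
  rw [setLIntegral_congr Ioo_ae_eq_Ioc, ← ofReal_integral_eq_lintegral_ofReal
    ((intervalIntegrable_iff_integrableOn_Ioc_of_le h2a).1 hi)
    ((ae_restrict_iff' measurableSet_Ioc).2 (ae_of_all _ fun t ht =>
      Real.rpow_nonneg ht.1.le _)), ← intervalIntegral.integral_of_le h2a,
    integral_rpow (Or.inl (by linarith)), Real.zero_rpow (by linarith), sub_zero]
  rw [show s - 2 + 1 = s - 1 by ring]

lemma lintegral_rpow_Ici {s : ℝ} (hs : s < 2) {a : ℝ} (ha : 0 < a) :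
    ∫⁻ t in Set.Ici (a / 2), ENNReal.ofReal (t ^ (s - 3)) =
      ENNReal.ofReal ((a / 2) ^ (s - 2) / (2 - s)) := by
  have ha2 : 0 < a / 2 := by positivity
  rw [setLIntegral_congr Ioi_ae_eq_Ici.symm, ← ofReal_integral_eq_lintegral_ofReal
    (integrableOn_Ioi_rpow_of_lt (by linarith) ha2)
    ((ae_restrict_iff' measurableSet_Ioi).2 (ae_of_all _ fun t ht =>
      Real.rpow_nonneg (ha2.le.trans (le_of_lt ht)) _)), integral_Ioi_rpow_of_lt (by linarith) ha2]
  congr 1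
  rw [show s - 3 + 1 = -(2 - s) by ring, show s - 2 = -(2 - s) by ring]
  field_simp

/-- Marcinkiewicz interpolation: a weak-type level-set inequality, as the Calderón–Zygmund
decomposition yields it, integrates to a strong `L^s` inequality. -/
lemma lintegral_rpow_le_of_level_inequality {s : ℝ} (hs1 : 1 < s) (hs2 : s < 2) (K : ℝ≥0) :
    ∃ K' : ℝ≥0, ∀ {f g : ℂ → ℂ}, Measurable f → Measurable g →
      (∀ {lam : ℝ}, 0 < lam → volume {z | lam < ‖g z‖} ≤
        K * ((ENNReal.ofReal lam)⁻¹ * ∫⁻ z in {z | lam / 2 < ‖f z‖}, ‖f z‖ₑ) +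
        K * ((ENNReal.ofReal lam)⁻¹ ^ 2 * ∫⁻ z in {z | ‖f z‖ ≤ 2 * lam}, ‖f z‖ₑ ^ 2)) →
      ∫⁻ z, ‖g z‖ₑ ^ s ≤ K' * ∫⁻ z, ‖f z‖ₑ ^ s := by
  set c₁ := ENNReal.ofReal (2 ^ (s - 1) / (s - 1)) with hc₁
  set c₂ := ENNReal.ofReal ((1 / 2) ^ (s - 2) / (2 - s)) with hc₂
  obtain ⟨K', hK'⟩ : ∃ K' : ℝ≥0, (K' : ℝ≥0∞) = ENNReal.ofReal s * (K * c₁ + K * c₂) :=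
    ⟨_, ENNReal.coe_toNNReal (by finiteness)⟩
  refine ⟨K', fun {f g} hf hg h => ?_⟩
  have hs0 : 0 < s := by linarith
  have hrp : ∀ (u : ℂ), ‖u‖ₑ ^ s = ENNReal.ofReal (‖u‖ ^ s) := fun u => by
    rw [← ofReal_norm, ENNReal.ofReal_rpow_of_nonneg (norm_nonneg _) hs0.le]
  -- the two kernels, after multiplication by `lam ^ (s - 1)`
  set k₁ : ℝ → ℂ → ℝ≥0∞ := fun t z =>
    {x : ℝ × ℂ | x.1 / 2 < ‖f x.2‖}.indicator
      (fun x => ENNReal.ofReal (x.1 ^ (s - 2)) * ‖f x.2‖ₑ) (t, z) with hk₁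
  set k₂ : ℝ → ℂ → ℝ≥0∞ := fun t z =>
    {x : ℝ × ℂ | ‖f x.2‖ ≤ 2 * x.1}.indicator
      (fun x => ENNReal.ofReal (x.1 ^ (s - 3)) * ‖f x.2‖ₑ ^ 2) (t, z) with hk₂
  have hfm : Measurable fun x : ℝ × ℂ => ‖f x.2‖ := (hf.comp measurable_snd).norm
  have hfm' : Measurable fun x : ℝ × ℂ => ‖f x.2‖ₑ := (hf.comp measurable_snd).enorm
  have hpow : ∀ e : ℝ, Measurable fun x : ℝ × ℂ => ENNReal.ofReal (x.1 ^ e) := fun e =>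
    (measurable_fst.pow_const e).ennreal_ofReal
  have mk₁ : Measurable (Function.uncurry k₁) :=
    ((hpow _).mul hfm').indicator (measurableSet_lt (measurable_fst.div_const 2) hfm)
  have mk₂ : Measurable (Function.uncurry k₂) :=
    ((hpow _).mul (hfm'.pow_const 2)).indicator
      (measurableSet_le hfm (measurable_fst.const_mul 2))
  have hpt : ∀ t ∈ Set.Ioi (0 : ℝ), volume {z | t < ‖g z‖} * ENNReal.ofReal (t ^ (s - 1)) ≤
      K * (∫⁻ z, k₁ t z) + K * ∫⁻ z, k₂ t z := by
    intro t (ht : 0 < t)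
    refine (mul_le_mul_left (h ht) _).trans_eq ?_
    have p1 : ENNReal.ofReal (t ^ (s - 2)) = (ENNReal.ofReal t)⁻¹ * ENNReal.ofReal (t ^ (s - 1)) := by
      rw [← ENNReal.ofReal_inv_of_pos ht, ← ENNReal.ofReal_mul (by positivity),
        ← Real.rpow_neg_one, ← Real.rpow_add ht]
      congr 2; ring
    have p2 : ENNReal.ofReal (t ^ (s - 3)) =
        (ENNReal.ofReal t)⁻¹ ^ 2 * ENNReal.ofReal (t ^ (s - 1)) := by
      rw [← ENNReal.ofReal_inv_of_pos ht, ← ENNReal.ofReal_pow (by positivity),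
        ← ENNReal.ofReal_mul (by positivity), ← Real.rpow_neg_one, ← Real.rpow_natCast,
        ← Real.rpow_mul ht.le, ← Real.rpow_add ht]
      congr 2; push_cast; ring
    have m1 : MeasurableSet {z | t / 2 < ‖f z‖} := measurableSet_lt measurable_const hf.norm
    have m2 : MeasurableSet {z | ‖f z‖ ≤ 2 * t} := measurableSet_le hf.norm measurable_const
    have i1 : ∫⁻ z, k₁ t z = ENNReal.ofReal (t ^ (s - 2)) *
        ∫⁻ z in {z | t / 2 < ‖f z‖}, ‖f z‖ₑ := by
      rw [← lintegral_const_mul _ hf.enorm, ← lintegral_indicator m1]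
      rfl
    have i2 : ∫⁻ z, k₂ t z = ENNReal.ofReal (t ^ (s - 3)) *
        ∫⁻ z in {z | ‖f z‖ ≤ 2 * t}, ‖f z‖ₑ ^ 2 := by
      rw [← lintegral_const_mul _ (hf.enorm.pow_const 2), ← lintegral_indicator m2]
      rfl
    rw [i1, i2, p1, p2]
    ring
  have e1 : ∫⁻ t in Set.Ioi (0 : ℝ), ∫⁻ z, k₁ t z = c₁ * ∫⁻ z, ‖f z‖ₑ ^ s := by
    rw [lintegral_lintegral_swap mk₁.aemeasurable,
      ← lintegral_const_mul _ (hf.enorm.pow_const s)]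
    congr 1; ext z
    have : ∀ t, k₁ t z = (Set.Iio (2 * ‖f z‖)).indicator
        (fun t => ENNReal.ofReal (t ^ (s - 2)) * ‖f z‖ₑ) t := fun t => by
      simp only [hk₁, Set.indicator, Set.mem_ofPred_eq, Set.mem_Iio, div_lt_iff₀ (two_pos : (0 : ℝ) < 2),
        mul_comm (2 : ℝ)]
    simp only [this]
    rw [lintegral_indicator measurableSet_Iio, Measure.restrict_restrict measurableSet_Iio,
      Set.inter_comm, Set.Ioi_inter_Iio, lintegral_mul_const' _ _ enorm_ne_top,
      lintegral_rpow_Ioo hs1 (norm_nonneg _), hrp, hc₁, ← ofReal_norm,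
      ← ENNReal.ofReal_mul' (norm_nonneg _), ← ENNReal.ofReal_mul' (by positivity)]
    congr 1
    rw [Real.mul_rpow two_pos.le (norm_nonneg _)]
    rcases eq_or_ne ‖f z‖ 0 with h0 | h0
    · rw [h0, Real.zero_rpow hs0.ne']; simp
    · have : ‖f z‖ ^ s = ‖f z‖ ^ (s - 1) * ‖f z‖ := by
        rw [← Real.rpow_add_one h0]; congr 1; ring
      rw [this]; ring
  have e2 : ∫⁻ t in Set.Ioi (0 : ℝ), ∫⁻ z, k₂ t z ≤ c₂ * ∫⁻ z, ‖f z‖ₑ ^ s := by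
    rw [lintegral_lintegral_swap mk₂.aemeasurable,
      ← lintegral_const_mul _ (hf.enorm.pow_const s)]
    refine lintegral_mono fun z => ?_
    rcases eq_or_ne (f z) 0 with h0 | h0
    · have : ∀ t, k₂ t z = 0 := fun t => by simp [hk₂, Set.indicator, h0]
      simp [this]
    have hn : 0 < ‖f z‖ := norm_pos_iff.2 h0
    have : ∀ t, k₂ t z = (Set.Ici (‖f z‖ / 2)).indicator
        (fun t => ENNReal.ofReal (t ^ (s - 3)) * ‖f z‖ₑ ^ 2) t := fun t => by
      simp only [hk₂, Set.indicator, Set.mem_ofPred_eq, Set.mem_Ici, div_le_iff₀ (two_pos : (0 : ℝ) < 2),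
        mul_comm (2 : ℝ)]
    simp only [this]
    refine (setLIntegral_le_lintegral _ _).trans_eq ?_
    rw [lintegral_indicator measurableSet_Ici, lintegral_mul_const' _ _ (by finiteness),
      lintegral_rpow_Ici hs2 hn, hrp, hc₂, ← ofReal_norm, ← ENNReal.ofReal_pow (norm_nonneg _),
      ← ENNReal.ofReal_mul' (by positivity), ← ENNReal.ofReal_mul' (by positivity)]
    congr 1
    have : ‖f z‖ ^ s = ‖f z‖ ^ (s - 2) * ‖f z‖ ^ 2 := by
      rw [← Real.rpow_natCast, ← Real.rpow_add hn]; congr 1; push_cast; ring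
    rw [this, div_eq_mul_one_div ‖f z‖ 2, Real.mul_rpow hn.le (by norm_num)]
    ring
  have hcake := lintegral_rpow_eq_lintegral_meas_lt_mul volume (f := fun z => ‖g z‖)
    (ae_of_all _ fun z => norm_nonneg _) hg.norm.aemeasurable hs0
  simp only [hrp (g _)]
  rw [hcake, hK']
  calc _ ≤ ENNReal.ofReal s * ∫⁻ t in Set.Ioi (0 : ℝ),
          (K * (∫⁻ z, k₁ t z) + K * ∫⁻ z, k₂ t z) := by
        gcongr 1
        exact setLIntegral_mono' measurableSet_Ioi hpt
    _ = ENNReal.ofReal s * (K * (∫⁻ t in Set.Ioi (0 : ℝ), ∫⁻ z, k₁ t z) +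
          K * ∫⁻ t in Set.Ioi (0 : ℝ), ∫⁻ z, k₂ t z) := by
        rw [lintegral_add_left (mk₁.lintegral_prod_right.const_mul _),
          lintegral_const_mul' _ _ ENNReal.coe_ne_top, lintegral_const_mul' _ _ ENNReal.coe_ne_top]
    _ ≤ ENNReal.ofReal s * (K * (c₁ * ∫⁻ z, ‖f z‖ₑ ^ s) + K * (c₂ * ∫⁻ z, ‖f z‖ₑ ^ s)) := by
        rw [e1]; gcongr
    _ = _ := by ring

lemma exists_boundedOnTests_of_lt_two {s : ℝ} (hs1 : 1 < s) (hs2 : s < 2) :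
    ∃ C : ℝ≥0, BoundedOnTests (ENNReal.ofReal s) C := by
  obtain ⟨C, hC⟩ := exists_eLpNorm_two_beurling_le
  obtain ⟨K, hK⟩ := BoundedOnTests.exists_level_inequality hC
  obtain ⟨K', hK'⟩ := lintegral_rpow_le_of_level_inequality hs1 hs2 K
  have hs0 : 0 < s := by linarith
  refine ⟨K' ^ (1 / s), fun φ hφ => ?_⟩
  have h := hK' hφ.continuous.measurable (stronglyMeasurable_beurling hφ).measurable
    (fun {lam} hlam => hK hφ hlam)
  have e : ∀ u : ℂ → ℂ, eLpNorm u (ENNReal.ofReal s) volume = (∫⁻ z, ‖u z‖ₑ ^ s) ^ (1 / s) :=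
    fun u => by
      rw [eLpNorm_eq_lintegral_rpow_enorm_toReal (by simpa using hs0) ENNReal.ofReal_ne_top,
        ENNReal.toReal_ofReal hs0.le]
  rw [e, e, ENNReal.coe_rpow_of_nonneg _ (by positivity),
    ← ENNReal.mul_rpow_of_nonneg _ _ (by positivity)]
  exact ENNReal.rpow_le_rpow h (by positivity)

/-- The Beurling transform is its own transpose, so its `L^s` bounds are stable under duality. -/
lemma BoundedOnTests.of_holderConjugate {s t : ℝ} (hst : s.HolderConjugate t) {C : ℝ≥0}
    (hC : BoundedOnTests (ENNReal.ofReal t) C) : BoundedOnTests (ENNReal.ofReal s) C := by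
  intro φ hφ
  have hS : MemLp (beurling φ) (ENNReal.ofReal s) volume :=
    memLp_beurling hφ (by simpa using hst.lt)
  have hψ := memLp_normingFun hst hS
  obtain ⟨w, hw, hwle, hwt⟩ := hC.exists_isTransposeBeurling (by simpa using hst.symm.lt)
    ENNReal.ofReal_ne_top hψ
  refine eLpNorm_le_of_enorm_integral_normingFun_le hst hS ?_
  have : (ENNReal.ofReal t).HolderConjugate (ENNReal.ofReal s) := hst.symm.ennrealOfReal
  have e : ∫ z, beurling φ z * normingFun s (beurling φ) z = ∫ z, w z * φ z := by
    rw [hwt.2 φ hφ]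
    simp only [mul_comm]
  rw [e]
  refine (enorm_integral_mul_le (p := ENNReal.ofReal t) (q := ENNReal.ofReal s) hw.1
    hφ.continuous.aestronglyMeasurable).trans ?_
  calc _ ≤ C * eLpNorm (normingFun s (beurling φ)) (ENNReal.ofReal t) volume *
        eLpNorm φ (ENNReal.ofReal s) volume := by gcongr
    _ = _ := by ring

/-- The Beurling transform is bounded on `L^s` for `1 < s < ∞`. -/
lemma exists_boundedOnTests {s : ℝ} (hs : 1 < s) :
    ∃ C : ℝ≥0, BoundedOnTests (ENNReal.ofReal s) C := by
  rcases lt_trichotomy s 2 with h | rfl | h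
  · exact exists_boundedOnTests_of_lt_two hs h
  · obtain ⟨C, hC⟩ := exists_eLpNorm_two_beurling_le
    refine ⟨C, ?_⟩
    rw [ENNReal.ofReal_ofNat]
    exact hC
  · have hst := Real.HolderConjugate.conjExponent hs
    obtain ⟨C, hC⟩ := exists_boundedOnTests_of_lt_two hst.symm.lt (by
      rw [Real.conjExponent, div_lt_iff₀ (by linarith)]; linarith)
    exact ⟨C, hC.of_holderConjugate hst⟩

/-! ### The commutator of a symbol in `L^r` modulo constants -/

lemma IsTransposeBeurling.congr_left {u u' w : ℂ → ℂ} (h : IsTransposeBeurling u w)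
    (hu : u =ᵐ[volume] u') : IsTransposeBeurling u' w := by
  refine ⟨h.1, fun φ hφ => (h.2 φ hφ).trans (integral_congr_ae ?_)⟩
  filter_upwards [hu] with z hz
  rw [hz]

lemma enorm_mul_le_of_holderTriple {p q r : ℝ≥0∞} [r.HolderTriple p q] {f g : ℂ → ℂ}
    (hf : AEStronglyMeasurable f volume) (hg : AEStronglyMeasurable g volume) :
    eLpNorm (fun z => f z * g z) q volume ≤ eLpNorm f r volume * eLpNorm g p volume := by
  have h := eLpNorm_le_eLpNorm_mul_eLpNorm'_of_norm (p := r) (q := p) (r := q) hf hg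
    (fun a b : ℂ => a * b) 1 (ae_of_all _ fun z => by simp)
  simpa using h

/-- The commutator with a symbol in `L^r` plus a constant is bounded: the constant drops out, and
both terms are bounded for the rest. -/
lemma beurlingCommutatorBounded_of_ae_eq {p q r : ℝ} (hq : 1 < q) (hqp : q < p)
    (hrpq : r.HolderTriple p q) {a b : ℂ → ℂ} {c : ℂ} (hb : LocallyIntegrable b volume)
    (ha : MemLp a (ENNReal.ofReal r) volume) (hab : b =ᵐ[volume] fun z => a z + c) :
    BeurlingCommutatorBounded b (ENNReal.ofReal p) (ENNReal.ofReal q) := by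
  obtain ⟨Cp, hCp⟩ := exists_boundedOnTests (hq.trans hqp)
  obtain ⟨Cq, hCq⟩ := exists_boundedOnTests hq
  have hp1 : 1 < ENNReal.ofReal p := by simpa using hq.trans hqp
  have hq1 : 1 < ENNReal.ofReal q := by simpa using hq
  have := hrpq.ennrealOfReal
  set N := eLpNorm a (ENNReal.ofReal r) volume with hN
  obtain ⟨C, hC⟩ : ∃ C : ℝ≥0, (C : ℝ≥0∞) = N * (Cp + Cq) :=
    ⟨_, ENNReal.coe_toNNReal (ENNReal.mul_ne_top ha.2.ne (by finiteness))⟩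
  refine ⟨C, fun v hv => ?_⟩
  have hSv : MemLp (beurling v) (ENNReal.ofReal p) volume := memLp_beurling hv hp1
  have hav : MemLp (fun z => a z * v z) (ENNReal.ofReal q) volume :=
    (hv.memLp (ENNReal.ofReal p)).mul ha
  have haS : MemLp (fun z => a z * beurling v z) (ENNReal.ofReal q) volume := hSv.mul ha
  obtain ⟨T, hT, hTle, hTw⟩ := hCq.exists_isTransposeBeurling hq1 ENNReal.ofReal_ne_top hav
  have hsum := hTw.add (hav.tailIntegrable hq1.le ENNReal.ofReal_ne_top)
    (hv.const_mul c).tailIntegrable ((isTransposeBeurling_beurling hv).const_mul c)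
  have hbv : IsTransposeBeurling (fun y => b y * v y) (fun z => T z + c * beurling v z) := by
    refine hsum.congr_left ?_
    filter_upwards [hab] with z hz
    rw [hz]; ring
  have hh : (fun z => b z * beurling v z - (T z + c * beurling v z)) =ᵐ[volume]
      fun z => a z * beurling v z - T z := by
    filter_upwards [hab] with z hz
    rw [hz]; ring
  refine ⟨fun z => b z * beurling v z - (T z + c * beurling v z), ⟨beurling v, _,
    (isBeurlingTransform_iff hv.tailIntegrable).2 (isTransposeBeurling_beurling hv),
    (isBeurlingTransform_iff (.of_mul_test hb hv)).2 hbv, ae_eq_refl _⟩,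
    (haS.sub hT).ae_eq hh.symm, ?_⟩
  rw [eLpNorm_congr_ae hh, hC]
  calc _ ≤ eLpNorm (fun z => a z * beurling v z) (ENNReal.ofReal q) volume +
        eLpNorm T (ENNReal.ofReal q) volume := eLpNorm_sub_le haS.1 hT.1 hq1.le
    _ ≤ N * (Cp * eLpNorm v (ENNReal.ofReal p) volume) +
        Cq * (N * eLpNorm v (ENNReal.ofReal p) volume) := by
        refine add_le_add ?_ (hTle.trans ?_)
        · exact (enorm_mul_le_of_holderTriple (p := ENNReal.ofReal p) (r := ENNReal.ofReal r)
            ha.1 hSv.1).trans (by gcongr; exact hCp v hv)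
        · gcongr
          exact enorm_mul_le_of_holderTriple ha.1 hv.continuous.aestronglyMeasurable
    _ = _ := by ring

/-- The constant is unique because the plane has infinite measure. -/
lemma eq_of_memLp_sub_const {b : ℂ → ℂ} {r : ℝ} (hr : 0 < r) {c c' : ℂ}
    (h : MemLp (fun z => b z - c) (ENNReal.ofReal r) volume)
    (h' : MemLp (fun z => b z - c') (ENNReal.ofReal r) volume) : c = c' := by
  have h1 : MemLp (fun _ : ℂ => c' - c) (ENNReal.ofReal r) volume := by
    have := h.sub h'
    refine this.ae_eq (ae_of_all _ fun z => ?_)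
    simp
  rw [memLp_const_iff (by simpa using hr) ENNReal.ofReal_ne_top] at h1
  rcases h1 with h1 | h1
  · exact (sub_eq_zero.1 h1).symm
  · simp at h1

end Beurling

theorem theorem4p1 (p q r : ℝ) (hq : 1 < q) (hqp : q < p) (hr : 1 / r = 1 / q - 1 / p) :
    ∃ K : ℝ≥0, ∀ b : ℂ → ℂ, LocallyIntegrable b volume →
      (BeurlingCommutatorBounded b (ENNReal.ofReal p) (ENNReal.ofReal q) ↔
        ∃ (a : ℂ → ℂ) (c : ℂ), MemLp a (ENNReal.ofReal r) volume ∧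
          b =ᵐ[volume] fun z => a z + c) ∧
      (BeurlingCommutatorBounded b (ENNReal.ofReal p) (ENNReal.ofReal q) →
        ∀ c : ℂ, MemLp (fun z => b z - c) (ENNReal.ofReal r) volume →
          eLpNorm (fun z => b z - c) (ENNReal.ofReal r) volume ≤
            K * beurlingCommutatorNorm b (ENNReal.ofReal p) (ENNReal.ofReal q)) := by
  have hq0 : 0 < q := by linarith
  have hr0 : 0 < r := by
    rw [← one_div_pos, hr, sub_pos]
    exact one_div_lt_one_div_of_lt hq0 hqp
  obtain ⟨K, hK⟩ := Beurling.exists_const_eLpNorm_sub_le_mul hq hqp hr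
  have hK' : ∀ {b : ℂ → ℂ}, LocallyIntegrable b volume → ∀ {C : ℝ≥0},
      BeurlingCommutatorBound b (ENNReal.ofReal p) (ENNReal.ofReal q) C →
      ∃ c : ℂ, MemLp (fun z => b z - c) (ENNReal.ofReal r) volume ∧
        eLpNorm (fun z => b z - c) (ENNReal.ofReal r) volume ≤ K * C := fun hb _ hC => by
    obtain ⟨c, hm, hle⟩ := hK hb hC
    exact ⟨c, ⟨hm, hle.trans_lt (by finiteness)⟩, hle⟩
  refine ⟨K + 1, fun b hb => ⟨⟨fun ⟨C, hC⟩ => ?_, fun ⟨a, c, ha, hab⟩ => ?_⟩, fun _ c hc => ?_⟩⟩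
  · obtain ⟨c, hc, -⟩ := hK' hb hC
    exact ⟨_, c, hc, ae_of_all _ fun z => by simp⟩
  · refine Beurling.beurlingCommutatorBounded_of_ae_eq hq hqp ⟨?_, hr0, hq0.trans hqp⟩ hb ha hab
    rw [← one_div, hr]; simp
  · -- `K + 1 ≠ 0`, so that it can be moved across the infimum over all bounds
    rw [← ENNReal.div_le_iff' (by simp) ENNReal.coe_ne_top]
    refine le_iInf₂ fun C hC => ?_
    rw [ENNReal.div_le_iff' (by simp) ENNReal.coe_ne_top]
    obtain ⟨c', hc', hle⟩ := hK' hb hC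
    rw [Beurling.eq_of_memLp_sub_const hr0 hc hc']
    refine hle.trans ?_
    gcongr
    exact le_self_add
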